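/- Let $\eta(\tau)=q^{1/24}\prod_{n\ge1}(1-q^n)$, $q=e^{2\pi i\tau}$, $\operatorname{Im}\tau>0$, be the Dedekind eta function, and for rational $r,s$ put $$\mathbb K_1(r,s)(\tau)=\frac{\eta(\tau/2)^{16s-8r-16}\,\eta(2\tau)^{8r+8s-12}}{\eta(\tau)^{24s-32}},\qquad \mathbb K_2(r,s)(\tau)=\frac{\eta(\tau/2)^{16s-8r-12}\,\eta(2\tau)^{8s+8r-12}}{\eta(\tau)^{24s-30}}.$$ For $1\le j\le 11$ put $r=j/12$ and $$K(r)=\mathbb K_1\left(\tfrac{1-r}2,1+\tfrac r2\right),\quad E(r)=\mathbb K_1\left(-\tfrac r2,\tfrac{3+r}2\right),\quad (r_1,q_1)=\left(1-\tfrac j{24},1+\tfrac j{24}\right),\quad (r_2,q_2)=\left(\tfrac{12-j}{24},\tfrac{12+j}{24}\right)$$ (all eta exponents that occur are integers). Let $$F(HD_4(r);z)=\sum_{k\ge0}\frac{(r)_k^2(\frac12)_k^2}{(1)_k^2(\frac12+r)_k^2}z^k,\qquad F(HD_5(r);z)=\sum_{k\ge0}\frac{(r)_k^2(1+\frac r2)_k(\frac12)_k^2}{(1)_k^2(\frac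 r2)_k(\frac12+r)_k^2}z^k,$$ where $(a)_k=a(a+1)\cdots(a+k-1)$, and $$\Omega_{j,\mathbb C}=\frac{\pi}{\sin(j\pi/12)}\,\frac{\Gamma(j/12)^2}{\Gamma(j/12+1/2)^2}.$$ Let $L(f,1)=-2\pi i\int_0^{i\infty}f(t)\,dt$ (integral along the imaginary axis). For $f=E(r)$, which has a pole at $i\infty$, $L(f,1)$ denotes the regularized value, that is, the Hadamard finite part: the limit as $T\to\infty$ of $-2\pi i\int_0^{iT}f(t)\,dt$ minus a finite linear combination of exponentials $e^{aT}$, $a>0$ (the limit is independent of the combination for which it exists). Theorem. For every integer $1\le j\le 11$, $K(j/12)$ is a weight two holomorphic modular form for a congruence subgroup, and $E(j/12)$ is a weakly holomorphic modular form of weight two for a congruence subgroup (holomorphic on the upper half plane, meromorphic at the cusps) which is not a holomorphic modular form. The two series above converge at $z=-1$ (as limits of partial sums), the integrals defining $L(K(j/12),1)$, $L(\mathbb K_2(r_1,q_1),1)$, $L(\mathbb K_2(r_2,q_2),1)$ converge absolutely, the regularized value $L(E(j/12),1)$ exists, and $$2^{\frac j2-4}\,\Omega_{j,\mathbb C}\cdot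 F(HD_4(j/12);-1)=L(K(j/12),1)\cdot L(\mathbb K_2(r_1,q_1),1),$$ $$2^{\frac j2+1}\,\Omega_{j,\mathbb C}\cdot F(HD_5(j/12);-1)=-L(E(j/12),1)\cdot L(\mathbb K_2(r_2,q_2),1),$$ $$L(K(j/12),1)\cdot L(E(j/12),1)=-\frac{3\cdot 2^{\frac j2+3}}{j\,\sin(\pi j/12)}\,\pi.$$ -/

import Mathlib

open scoped MatrixGroups Manifold Topology ModularForm

namespace HypMod

noncomputable section

/-- A hypergeometric datum: the multisets of upper parameters `α = {r₁, …, rₙ}` and lower parameters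
`β = {q₁, …, qₙ}`, where `q₁ = 1` is listed explicitly (it produces the factor `k!` below). -/
structure HypergeometricDatum where
  α : Multiset ℚ
  β : Multiset ℚ

/-- The coefficient `(r₁)ₖ ⋯ (rₙ)ₖ / ((q₁)ₖ ⋯ (qₙ)ₖ)` of the series `F(α, β; z)`, where `(a)ₖ` is the
rising factorial. -/
def HypergeometricDatum.coeff (HD : HypergeometricDatum) (k : ℕ) : ℂ :=
  (HD.α.map fun a => (ascPochhammer ℂ k).eval (a : ℂ)).prod /
    (HD.β.map fun b => (ascPochhammer ℂ k).eval (b : ℂ)).prod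

/-- `F(HD; z)` converges, with value `v`: the partial sums of the series converge to `v`
(convergence may be conditional, as it is for the `₅F₄` at `-1` below). -/
def HypergeometricDatum.HasValue (HD : HypergeometricDatum) (z v : ℂ) : Prop :=
  Filter.Tendsto (fun N : ℕ => ∑ k ∈ Finset.range N, HD.coeff k * z ^ k) Filter.atTop (𝓝 v)

/-- The well-poised datum `HD₄(r)`. -/
def HD4 (r : ℚ) : HypergeometricDatum where
  α := {r, r, 1 / 2, 1 / 2}
  β := {1, 1, 1 / 2 + r, 1 / 2 + r}

/-- The very well-poised datum `HD₅(r)`. -/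
def HD5 (r : ℚ) : HypergeometricDatum where
  α := {r, 1 + r / 2, r, 1 / 2, 1 / 2}
  β := {1, r / 2, 1, 1 / 2 + r, 1 / 2 + r}

/-- The eta quotient `𝕂₁(r, s)(τ) = η(τ/2)^(16s-8r-16) η(2τ)^(8r+8s-12) / η(τ)^(24s-32)`.
(Complex powers with integer exponent are the usual integer powers.) -/
def K1 (r s : ℚ) (τ : UpperHalfPlane) : ℂ :=
  ModularForm.eta ((τ : ℂ) / 2) ^ ((16 * s - 8 * r - 16 : ℚ) : ℂ) *
    ModularForm.eta (2 * (τ : ℂ)) ^ ((8 * r + 8 * s - 12 : ℚ) : ℂ) /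
      ModularForm.eta (τ : ℂ) ^ ((24 * s - 32 : ℚ) : ℂ)

/-- The eta quotient `𝕂₂(r, s)(τ) = η(τ/2)^(16s-8r-12) η(2τ)^(8s+8r-12) / η(τ)^(24s-30)`. -/
def K2 (r s : ℚ) (τ : UpperHalfPlane) : ℂ :=
  ModularForm.eta ((τ : ℂ) / 2) ^ ((16 * s - 8 * r - 12 : ℚ) : ℂ) *
    ModularForm.eta (2 * (τ : ℂ)) ^ ((8 * s + 8 * r - 12 : ℚ) : ℂ) /
      ModularForm.eta (τ : ℂ) ^ ((24 * s - 30 : ℚ) : ℂ)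

/-- `K(r) = 𝕂₁((1-r)/2, 1+r/2)`. -/
def formK (r : ℚ) : UpperHalfPlane → ℂ := K1 ((1 - r) / 2) (1 + r / 2)

/-- `E(r) = 𝕂₁(-r/2, (3+r)/2)`. -/
def formE (r : ℚ) : UpperHalfPlane → ℂ := K1 (-r / 2) ((3 + r) / 2)

/-- `f` is a modular form of weight `k`, holomorphic on the upper half plane and at all cusps, for
some congruence subgroup of `SL(2, ℤ)`. -/
def IsCongruenceModularForm (k : ℤ) (f : UpperHalfPlane → ℂ) : Prop :=
  ∃ Γ : Subgroup SL(2, ℤ), CongruenceSubgroup.IsCongruenceSubgroup Γ ∧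
    ∃ g : ModularForm (Γ.map (Matrix.SpecialLinearGroup.mapGL ℝ)) k, ⇑g = f

/-- `f` is a weakly holomorphic modular form of weight `k` for some congruence subgroup of
`SL(2, ℤ)`: holomorphic on the upper half plane, and meromorphic at all cusps (every
`f ∣[k] γ` grows at most like a fixed power of `|q|⁻¹`). -/
def IsWeaklyHolomorphicModularForm (k : ℤ) (f : UpperHalfPlane → ℂ) : Prop :=
  MDiff f ∧
  (∃ Γ : Subgroup SL(2, ℤ), CongruenceSubgroup.IsCongruenceSubgroup Γ ∧
    ∀ γ ∈ Γ, f ∣[k] γ = f) ∧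
  ∀ γ : SL(2, ℤ), ∃ C : ℝ,
    (f ∣[k] γ) =O[UpperHalfPlane.atImInfty] fun τ => Real.exp (C * τ.im)

/-- The restriction `y ↦ f(iy)` of `f` to the imaginary axis (used for `y > 0`). -/
def onAxis (f : UpperHalfPlane → ℂ) (y : ℝ) : ℂ :=
  f (UpperHalfPlane.ofComplex (Complex.I * y))

/-- The `L`-value of `f` at `1` exists and equals `L`: the integral
`L(f, 1) = -2πi ∫_0^{i∞} f(t) dt` along `t = iy`, `dt = i dy`, converges absolutely to `L`. -/
def HasLValueOne (f : UpperHalfPlane → ℂ) (L : ℂ) : Prop :=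
  MeasureTheory.IntegrableOn (onAxis f) (Set.Ioi 0) ∧
    L = -2 * Real.pi * Complex.I * ∫ y in Set.Ioi (0 : ℝ), onAxis f y * Complex.I

/-- The regularized `L`-value at `1` of a form `f` with a pole at `i∞`: the Hadamard finite part of
`-2πi ∫_0^{iT} f(t) dt` as `T → ∞`, that is, the limit which is left after a finite linear
combination of growing exponentials `exp (a T)`, `a > 0`, is removed. -/
def HasRegularizedLValueOne (f : UpperHalfPlane → ℂ) (L : ℂ) : Prop :=
  (∀ T : ℝ, 0 < T → MeasureTheory.IntegrableOn (onAxis f) (Set.Ioc 0 T)) ∧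
    ∃ (S : Finset ℝ) (c : ℝ → ℂ), (∀ a ∈ S, 0 < a) ∧
      Filter.Tendsto (fun T : ℝ =>
          -2 * Real.pi * Complex.I * (∫ y in Set.Ioc 0 T, onAxis f y * Complex.I) -
            ∑ a ∈ S, c a * Real.exp (a * T))
        Filter.atTop (𝓝 L)

/-- The regularized value extends the convergent one. -/
theorem HasLValueOne.hasRegularizedLValueOne {f : UpperHalfPlane → ℂ} {L : ℂ}
    (h : HasLValueOne f L) : HasRegularizedLValueOne f L := by
  refine ⟨fun T _ => h.1.mono_set Set.Ioc_subset_Ioi_self, ∅, 0, by simp, ?_⟩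
  have h1 := MeasureTheory.intervalIntegral_tendsto_integral_Ioi (0 : ℝ)
    (h.1.mul_const Complex.I) Filter.tendsto_id
  have h2 := h1.const_mul (-2 * Real.pi * Complex.I)
  rw [← h.2] at h2
  refine h2.congr' ?_
  filter_upwards [Filter.eventually_ge_atTop 0] with T hT
  simp [intervalIntegral.integral_of_le hT]

/-- If a combination of growing exponentials has a limit, the limit is zero. -/
theorem limit_sum_exp_eq_zero (S : Finset ℝ) (hS : ∀ a ∈ S, 0 < a) (c : ℝ → ℂ) (l : ℂ)
    (h : Filter.Tendsto (fun T : ℝ => ∑ a ∈ S, c a * Real.exp (a * T)) Filter.atTop (𝓝 l)) :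
    l = 0 := by
  induction S using Finset.induction_on_max with
  | empty =>
    simp only [Finset.sum_empty] at h
    exact tendsto_nhds_unique h tendsto_const_nhds
  | insert b S hb ih =>
    have hbpos : 0 < b := hS b (by simp)
    have hbS : b ∉ S := fun hh => lt_irrefl _ (hb b hh)
    have hexp : ∀ a : ℝ, a < 0 → Filter.Tendsto (fun T : ℝ => ((Real.exp (a * T) : ℝ) : ℂ))
        Filter.atTop (𝓝 0) := by
      intro a ha
      have := Real.tendsto_exp_atBot.comp
        ((Filter.tendsto_const_mul_atBot_of_neg (f := fun T : ℝ => T) ha).2 Filter.tendsto_id)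
      exact_mod_cast (Complex.continuous_ofReal.tendsto 0).comp this
    have h1 : Filter.Tendsto (fun T : ℝ => (∑ a ∈ insert b S, c a * Real.exp (a * T)) *
        ((Real.exp (-b * T) : ℝ) : ℂ)) Filter.atTop (𝓝 (l * 0)) := h.mul (hexp _ (by linarith))
    have h2 : Filter.Tendsto (fun T : ℝ => c b + ∑ a ∈ S, c a *
        ((Real.exp ((a - b) * T) : ℝ) : ℂ)) Filter.atTop (𝓝 (c b + ∑ a ∈ S, c a * 0)) :=
      tendsto_const_nhds.add (tendsto_finsetSum _ fun a ha =>
        (hexp _ (by linarith [hb a ha])).const_mul _)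
    have h3 : c b = 0 := by
      have := tendsto_nhds_unique (h1.congr fun T => ?_) h2
      · simpa using this.symm
      · rw [Finset.sum_insert hbS, add_mul, mul_assoc, ← Complex.ofReal_mul, ← Real.exp_add,
          Finset.sum_mul]
        congr 1
        · simp
        · refine Finset.sum_congr rfl fun a _ => ?_
          rw [mul_assoc, ← Complex.ofReal_mul, ← Real.exp_add]
          congr 3
          ring
    refine ih (fun a ha => hS a (by simp [ha])) ?_
    refine h.congr fun T => ?_
    rw [Finset.sum_insert hbS, h3]
    simp

/-- The regularized value is unique. -/
theorem HasRegularizedLValueOne.unique {f : UpperHalfPlane → ℂ} {L L' : ℂ}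
    (h : HasRegularizedLValueOne f L) (h' : HasRegularizedLValueOne f L') : L = L' := by
  classical
  obtain ⟨-, S, c, hS, hc⟩ := h
  obtain ⟨-, S', c', hS', hc'⟩ := h'
  refine sub_eq_zero.1 (limit_sum_exp_eq_zero (S ∪ S')
    (fun a ha => (Finset.mem_union.1 ha).elim (hS a) (hS' a))
    (fun a => (if a ∈ S' then c' a else 0) - (if a ∈ S then c a else 0)) _
    ((hc.sub hc').congr fun T => ?_))
  simp only [sub_mul, Finset.sum_sub_distrib, ite_mul, zero_mul]
  rw [Finset.sum_ite_mem, Finset.sum_ite_mem, Finset.inter_eq_right.2 Finset.subset_union_left,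
    Finset.inter_eq_right.2 Finset.subset_union_right]
  ring

/-- `Ω_{j,ℂ} = π / sin(jπ/12) · Γ(j/12)² / Γ(j/12 + 1/2)²`. -/
def Omega (j : ℕ) : ℝ :=
  Real.pi / Real.sin (j * Real.pi / 12) *
    (Real.Gamma (j / 12) ^ 2 / Real.Gamma (j / 12 + 1 / 2) ^ 2)

end

end HypMod

/-! Everything is pulled back to the modular function λ on the imaginary axis. Put r = j/12 and let
`thA`, `thB`, `thC` be the fourth powers of θ₄, θ₂, θ₃. Along τ = iy, λ decreases from 1 to 0 with
dλ = -π λ θ₄⁴ dy (`hasDerivAt_axLam`), and G = η(τ/2)/η(τ) satisfies G²⁴ = 16(1-λ)²/λ (`axG_pow`).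
So a weight two quotient in η(τ/2), η(τ) becomes a constant times x^α (1-x)^β dx on (0,1), and
L(K(r),1) is a Beta value. The two 𝕂₂ forms carry in addition the factor θ₃² or √λ θ₃², and θ₃² is
F(λ), F = ₂F₁(1/2,1/2;1;·) (`sqrt_eq_ellipF`). Their L-values are therefore multiples of ∫ x^(-c)
(1-x)^(r-1) F(x) dx with c = (1+r)/2 or c = r/2; termwise integration (`integral_beta_mul_ellipF`)
gives B(1-c, r) times a ₃F₂ at 1 whose terms are `unitSummand r c`.

The same ₃F₂ comes from the hypergeometric side. Both series at -1 are alternating sums of `vwpCoeff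
r c`, with these same two c, and Whipple's transformation (`whipple_limit`) turns them into a Gamma
quotient times that ₃F₂. The terminating version is proved by inserting a Saalschütz sum, exchanging
summations and summing the inner very-well-poised ₅F₄. The limit must use the alternation of signs,
since the second series converges only conditionally.

For E(r) the integrand is θ₄⁴ G^j. The derivative of G^j is a multiple of θ₄⁴ G^j + 2 θ₂⁴ G^j, so
the divergent integral is an explicit multiple of G^j, which is an exponential up to o(1), minus
twice a convergent integral that is again a Beta value (`hasRegularizedLValueOne_formE`).

All three identities then reduce to one product, B((1-r)/2, r) B(1-r/2, r), evaluated by duplication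
and reflection (`beta_mul_beta`).

Modularity: K and E are η(τ/2)^a η(τ)^(4-a) with a = j-4 and a = j+8. On Γ⁰(2) such a quotient has
an explicit multiplier by 24th roots of unity (`etaQuot_slash_of_even`), trivial on Γ(48). The
orders (8-a)/48 and (a+4)/24 at the cusps decide holomorphy.

The theta and Eisenstein identities used on the way all rest on the vanishing of level one cusp
forms of weight below twelve (`eq_zero_of_levelOne`). -/

namespace HypMod

open Finset Filter

/-! ### Terminating hypergeometric summations -/

/-- The rising factorial `(x)_n`. -/
noncomputable def rising (x : ℝ) (n : ℕ) : ℝ := ∏ i ∈ range n, (x + i)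

lemma rising_zero (x : ℝ) : rising x 0 = 1 := by simp [rising]

lemma rising_succ (x : ℝ) (n : ℕ) : rising x (n + 1) = rising x n * (x + n) := by
  simp [rising, prod_range_succ]

lemma rising_add (x : ℝ) (m n : ℕ) : rising x (m + n) = rising x m * rising (x + m) n := by
  simp only [rising, prod_range_add]
  congr 1
  refine prod_congr rfl fun i _ => ?_
  push_cast
  ring

lemma rising_succ' (x : ℝ) (n : ℕ) : rising x (n + 1) = x * rising (x + 1) n := by
  rw [add_comm n 1, rising_add]
  simp [rising]

lemma rising_shift (x : ℝ) (n : ℕ) : x * rising (x + 1) n = rising x n * (x + n) := by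
  rw [← rising_succ', rising_succ]

lemma rising_pos {x : ℝ} (hx : 0 < x) (n : ℕ) : 0 < rising x n :=
  prod_pos fun i _ => by positivity

lemma rising_one (n : ℕ) : rising 1 n = n.factorial := by
  induction n with
  | zero => simp [rising]
  | succ n ih => rw [rising_succ, ih, Nat.factorial_succ]; push_cast; ring

lemma rising_neg_eq_zero {n k : ℕ} (h : n < k) : rising (-n) k = 0 :=
  prod_eq_zero (mem_range.2 h) (by ring)

lemma rising_neg_mul (n k : ℕ) (h : k ≤ n) :
    rising (-n) k * (n - k).factorial = (-1) ^ k * n.factorial := by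
  induction k with
  | zero => simp [rising_zero]
  | succ k ih =>
    have h1 := ih (by omega)
    obtain ⟨m, rfl⟩ := Nat.exists_eq_add_of_le h
    have e1 : k + 1 + m - (k + 1) = m := by omega
    have e2 : k + 1 + m - k = m + 1 := by omega
    rw [e2, Nat.factorial_succ] at h1
    rw [e1, rising_succ, pow_succ]
    push_cast at h1 ⊢
    linear_combination (-1 : ℝ) * h1

/-- The summand of the balanced terminating `₃F₂(1-c, -n, a+n; 1, 1+a-c; 1)`. -/
noncomputable def saalSummand (a c : ℝ) (n k : ℕ) : ℝ :=
  rising (1 - c) k * rising (-n) k * rising (a + n) k / (k.factorial ^ 2 * rising (1 + a - c) k)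

/-- A creative-telescoping pair: the right side is the rational certificate times the summand, and
the induction on M only checks one difference. It yields a first order recurrence in n for the full
sum. -/
lemma saalSummand_recurrence {a c : ℝ} (ha : 0 < a) (hc : c < 1 + a) (n M : ℕ) :
    ∑ k ∈ range M, ((n + 1) * (1 + a - c + n) * saalSummand a c (n + 1) k -
      (a + n) * (c + n) * saalSummand a c n k) =
    -(a + 2 * n + 1) / (a + n) * M ^ 2 * (a - c + M) * rising (1 - c) M * rising (a + n) M *
      rising (-(n + 1 : ℕ)) M / ((n + 1) * M.factorial ^ 2 * rising (1 + a - c) M) := by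
  induction M with
  | zero => simp
  | succ k ih =>
    rw [sum_range_succ, ih]
    simp only [saalSummand]
    have h1 := rising_shift (a + n) k
    have h2 := rising_shift (-(n + 1 : ℕ)) k
    have e2 : (-((n + 1 : ℕ) : ℝ)) + 1 = -n := by push_cast; ring
    have e1 : a + ((n + 1 : ℕ) : ℝ) = a + n + 1 := by push_cast; ring
    rw [e2] at h2
    rw [e1, rising_succ, rising_succ, rising_succ, rising_succ, Nat.factorial_succ]
    have p1 : 0 < a + n := by positivity
    have p2 : 0 < rising (1 + a - c) k := rising_pos (by linarith) k
    have p3 : 0 < 1 + a - c + k := by have : (0 : ℝ) ≤ k := by positivity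
                                      linarith
    have p4 : (0 : ℝ) < n + 1 := by positivity
    have p5 : (0 : ℝ) < k + 1 := by positivity
    have p6 : (0 : ℝ) < k.factorial := by positivity
    have f1 : rising (a + n + 1) k = rising (a + n) k * (a + n + k) / (a + n) := by
      field_simp; linarith
    have f2 : rising (-n) k = rising (-(n + 1 : ℕ)) k * (n + 1 - k) / (n + 1) := by
      field_simp; push_cast at h2 ⊢; linarith
    rw [f1, f2]
    push_cast
    field_simp
    ring

/-- A case of the Pfaff–Saalschütz summation. -/
theorem sum_saalSummand {a c : ℝ} (ha : 0 < a) (hc : c < 1 + a) (n : ℕ) :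
    ∑ k ∈ range (n + 1), saalSummand a c n k =
      rising a n * rising c n / (n.factorial * rising (1 + a - c) n) := by
  induction n with
  | zero => simp [saalSummand, rising_zero]
  | succ n ih =>
    -- The range n + 2 covers all nonzero terms of the sum for n + 1, and the boundary term then
    -- contains the factor (-(n+1))_{n+2} = 0.
    have h := saalSummand_recurrence ha hc n (n + 2)
    rw [rising_neg_eq_zero (show n + 1 < n + 2 by omega)] at h
    rw [sum_sub_distrib, ← mul_sum, ← mul_sum, sum_range_succ (fun k => saalSummand a c n k), ih]
      at h
    have h0 : saalSummand a c n (n + 1) = 0 := by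
      simp [saalSummand, rising_neg_eq_zero (show n < n + 1 by omega)]
    rw [h0] at h
    have p2 : 0 < rising (1 + a - c) n := rising_pos (by linarith) n
    have p3 : 0 < 1 + a - c + n := by have : (0 : ℝ) ≤ n := by positivity
                                      linarith
    rw [rising_succ, rising_succ, rising_succ, Nat.factorial_succ]
    rw [eq_div_iff (by positivity)]
    push_cast
    simp only [mul_zero, zero_div, add_zero] at h
    field_simp at h
    linear_combination h

/-- The summand of the terminating very-well-poised `₅F₄(a, 1+a/2, d, d, -N; 1)`. -/
noncomputable def vwpSummand (a d : ℝ) (N n : ℕ) : ℝ :=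
  rising a n * (a + 2 * n) / a * rising d n ^ 2 * rising (-N) n /
    (n.factorial * rising (1 + a - d) n ^ 2 * rising (1 + a + N) n)

/-- The same telescoping method, now in the upper parameter -N; the boundary term dies at M = N + 2.
-/
lemma vwpSummand_recurrence {a d : ℝ} (ha : 0 < a) (hd : d < 1 + a) (N M : ℕ) :
    ∑ n ∈ range M, ((1 + a - d + N) ^ 2 * vwpSummand a d (N + 1) n -
      (1 + a + N) * (1 + a - 2 * d + N) * vwpSummand a d N n) =
    -(1 + a + N) * M * (M + a - d) ^ 2 / a * rising a M * rising d M ^ 2 *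
      rising (-(N + 1 : ℕ)) M /
      ((N + 1) * M.factorial * rising (1 + a - d) M ^ 2 * rising (1 + a + N) M) := by
  induction M with
  | zero => simp
  | succ k ih =>
    rw [sum_range_succ, ih]
    simp only [vwpSummand]
    have h1 := rising_shift (1 + a + N) k
    have h2 := rising_shift (-(N + 1 : ℕ)) k
    have e2 : (-((N + 1 : ℕ) : ℝ)) + 1 = -N := by push_cast; ring
    have e1 : 1 + a + ((N + 1 : ℕ) : ℝ) = 1 + a + N + 1 := by push_cast; ring
    rw [e2] at h2
    rw [e1, rising_succ, rising_succ, rising_succ, rising_succ, rising_succ, Nat.factorial_succ]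
    have p1 : 0 < 1 + a + N := by positivity
    have p1' : 0 < 1 + a + N + k := by positivity
    have p2 : 0 < rising (1 + a - d) k := rising_pos (by linarith) k
    have p3 : 0 < 1 + a - d + k := by have : (0 : ℝ) ≤ k := by positivity
                                      linarith
    have p4 : (0 : ℝ) < N + 1 := by positivity
    have p5 : (0 : ℝ) < k + 1 := by positivity
    have p6 : (0 : ℝ) < k.factorial := by positivity
    have p7 : 0 < rising (1 + a + N) k := rising_pos p1 k
    have f1 : rising (1 + a + N + 1) k = rising (1 + a + N) k * (1 + a + N + k) / (1 + a + N) := by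
      field_simp; linarith
    have f2 : rising (-N) k = rising (-(N + 1 : ℕ)) k * (N + 1 - k) / (N + 1) := by
      field_simp; push_cast at h2 ⊢; linarith
    rw [f1, f2]
    push_cast
    field_simp
    ring

/-- The terminating very-well-poised ₅F₄ summation, with two numerator parameters equal. It
evaluates the inner sum in Whipple's transformation. -/
theorem sum_vwpSummand {a d : ℝ} (ha : 0 < a) (hd : d < 1 + a) (N : ℕ) :
    ∑ n ∈ range (N + 1), vwpSummand a d N n =
      rising (1 + a) N * rising (1 + a - 2 * d) N / rising (1 + a - d) N ^ 2 := by
  induction N with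
  | zero => simp [vwpSummand, rising_zero, ha.ne']
  | succ N ih =>
    have h := vwpSummand_recurrence ha hd N (N + 2)
    rw [rising_neg_eq_zero (show N + 1 < N + 2 by omega)] at h
    rw [sum_sub_distrib, ← mul_sum, ← mul_sum, sum_range_succ (fun k => vwpSummand a d N k), ih]
      at h
    have h0 : vwpSummand a d N (N + 1) = 0 := by
      simp [vwpSummand, rising_neg_eq_zero (show N < N + 1 by omega)]
    rw [h0] at h
    have p2 : 0 < rising (1 + a - d) N := rising_pos (by linarith) N
    have p3 : 0 < 1 + a - d + N := by have : (0 : ℝ) ≤ N := by positivity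
                                      linarith
    rw [rising_succ, rising_succ, rising_succ]
    rw [eq_div_iff (by positivity)]
    simp only [mul_zero, zero_div, add_zero] at h
    generalize rising (1 + a - 2 * d) N = z at h ⊢
    field_simp at h
    linear_combination h

/-- The summand of `₃F₂(1/2, 1/2, 1-c; 1, 1+a-c; 1)`. -/
noncomputable def unitSummand (a c : ℝ) (k : ℕ) : ℝ :=
  (rising (1 / 2) k / k.factorial) ^ 2 * (rising (1 - c) k / rising (1 + a - c) k)

/-- The coefficient `(-1)^n (a)_n² (1/2)_n² (a+2n) (c)_n / (n!² (1/2+a)_n² a (1+a-c)_n)` without its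
sign. -/
noncomputable def vwpCoeff (a c : ℝ) (n : ℕ) : ℝ :=
  (rising a n * rising (1 / 2) n / (n.factorial * rising (1 / 2 + a) n)) ^ 2 *
    ((a + 2 * n) / a * (rising c n / rising (1 + a - c) n))

/-- A terminating form of Whipple's transformation of a very-well-poised series. -/
theorem whipple_terminating {a c : ℝ} (ha : 0 < a) (hc : c < 1 + a) (N : ℕ) :
    ∑ n ∈ range (N + 1), rising (-N) n / rising (1 + a + N) n * vwpCoeff a c n =
      rising (1 + a) N / rising (1 / 2 + a) N ^ 2 *
        ∑ k ∈ range (N + 1), unitSummand a c k *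
          (N.factorial / (N - k).factorial * rising a (N - k)) := by
  have hpos : ∀ n : ℕ, 0 < rising (1 + a - c) n := rising_pos (by linarith)
  -- The factor (a)_n (c)_n / (n! (1+a-c)_n) is traded for its Saalschütz expansion over k ≤ n; the
  -- order of summation is then reversed.
  have h1 : ∀ n ∈ range (N + 1), rising (-N) n / rising (1 + a + N) n * vwpCoeff a c n =
      ∑ k ∈ range (n + 1), rising (-N) n / rising (1 + a + N) n *
        (rising a n * (a + 2 * n) / a * rising (1 / 2) n ^ 2 /
          (n.factorial * rising (1 / 2 + a) n ^ 2)) * saalSummand a c n k := by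
    intro n _
    rw [← mul_sum, sum_saalSummand ha hc, vwpCoeff]
    have := hpos n
    have p1 : 0 < rising (1 / 2 + a) n := rising_pos (by linarith) n
    have p2 : 0 < rising (1 + a + N) n := rising_pos (by positivity) n
    field_simp
  rw [sum_congr rfl h1, sum_comm' (t' := range (N + 1)) (s' := fun k => Ico k (N + 1))
    (fun n k => by simp only [mem_range, mem_Ico]; omega), mul_sum]
  refine sum_congr rfl fun k hk => ?_
  obtain ⟨M, rfl⟩ := Nat.exists_eq_add_of_le (Nat.lt_succ_iff.1 (mem_range.1 hk))
  rw [sum_Ico_eq_sum_range, show k + M + 1 - k = M + 1 by omega, show k + M - k = M by omega]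
  have q1 : 0 < rising (1 / 2 + a) k := rising_pos (by linarith) k
  have q2 : 0 < rising (1 + a + (k + M : ℕ)) k := rising_pos (by positivity) k
  have q3 := hpos k
  have q4 : 0 < a + 2 * k := by positivity
  -- With n = k + m, the sum over m is very-well-poised again, with a replaced by a + 2k, d = 1/2 +
  -- k and N replaced by M = N - k. All that does not depend on m is pulled out.
  have key : ∀ m : ℕ, rising (-(k + M : ℕ)) (k + m) / rising (1 + a + (k + M : ℕ)) (k + m) *
        (rising a (k + m) * (a + 2 * (k + m : ℕ)) / a * rising (1 / 2) (k + m) ^ 2 /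
          ((k + m).factorial * rising (1 / 2 + a) (k + m) ^ 2)) * saalSummand a c (k + m) k =
      ((-1) ^ k * (rising a (2 * k) * (a + 2 * k) / a) * rising (1 / 2) k ^ 2 *
        rising (-(k + M : ℕ)) k / (rising (1 / 2 + a) k ^ 2 * rising (1 + a + (k + M : ℕ)) k) *
        (rising (1 - c) k / (k.factorial ^ 2 * rising (1 + a - c) k))) *
        vwpSummand (a + 2 * k) (1 / 2 + k) M m := by
    intro m
    have e1 : rising a (k + m) * rising (a + (k + m : ℕ)) k =
        rising a (2 * k) * rising (a + 2 * k) m := by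
      rw [← rising_add, show k + m + k = 2 * k + m by ring, rising_add]
      push_cast
      rfl
    have e2 := rising_neg_mul (k + m) k (by omega)
    rw [show k + m - k = m by omega] at e2
    have e3 : rising (-(k + M : ℕ)) (k + m) = rising (-(k + M : ℕ)) k * rising (-M) m := by
      rw [rising_add]; congr 2; push_cast; ring
    have e4 : rising (1 + a + (k + M : ℕ)) (k + m) =
        rising (1 + a + (k + M : ℕ)) k * rising (1 + (a + 2 * k) + M) m := by
      rw [rising_add]; congr 2; push_cast; ring
    have e5 : rising (1 / 2 + a) (k + m) =
        rising (1 / 2 + a) k * rising (1 + (a + 2 * k) - (1 / 2 + k)) m := by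
      rw [rising_add]; congr 2; ring
    have q5 : 0 < rising (1 + (a + 2 * k) - (1 / 2 + k)) m := rising_pos (by
      have : (0 : ℝ) ≤ k := by positivity
      linarith) m
    have q6 : 0 < rising (1 + (a + 2 * k) + M) m := rising_pos (by positivity) m
    rw [saalSummand, vwpSummand, e3, e4, e5, rising_add (1 / 2)]
    generalize rising (1 + (a + 2 * k) - (1 / 2 + k)) m = x5 at *
    generalize rising (1 + (a + 2 * k) + M) m = x6 at *
    generalize rising (1 / 2 + (k : ℝ)) m = x7 at *
    have e6 : rising (-(k + m : ℕ)) k = (-1) ^ k * (k + m).factorial / m.factorial := by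
      rw [eq_div_iff (by positivity), e2]
    rw [e6]
    have q8 : (0 : ℝ) < (k + m).factorial := by positivity
    generalize rising (-((k + M : ℕ) : ℝ)) k = y1
    generalize rising (1 + a + ((k + M : ℕ) : ℝ)) k = y2 at *
    generalize rising (1 / 2 + a) k = y3 at *
    generalize rising (1 + a - c) k = y4 at *
    generalize rising (-(M : ℝ)) m = y5
    generalize rising (1 / 2 : ℝ) k = y6
    generalize rising (1 - c) k = y7
    generalize rising (a + ((k + m : ℕ) : ℝ)) k = y8 at *
    generalize rising (a + 2 * (k : ℝ)) m = y9 at *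
    push_cast
    field_simp
    linear_combination (a + 2 * (k + m)) * y1 * y5 * y6 ^ 2 * x7 ^ 2 * y7 * e1
  rw [sum_congr rfl fun m _ => key m, ← mul_sum,
    sum_vwpSummand q4 (by have : (0 : ℝ) ≤ k := by positivity
                          linarith)]
  -- Both sides are (a)_{2k+M+1}, cut at different places.
  have e7 : rising a (2 * k) * (a + 2 * k) * rising (1 + (a + 2 * k)) M =
      a * (rising (1 + a) (k + M) * rising (1 + a + (k + M : ℕ)) k) := by
    rw [← rising_add, show k + M + k = 2 * k + M by ring, rising_add (1 + a)]
    have := rising_shift a (2 * k)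
    push_cast at this
    rw [← this, add_comm a 1]
    push_cast
    rw [add_assoc]
    ring
  have e8 := rising_neg_mul (k + M) k (by omega)
  rw [show k + M - k = M by omega] at e8
  have e9 : rising (-(k + M : ℕ)) k = (-1) ^ k * (k + M).factorial / M.factorial := by
    rw [eq_div_iff (by positivity), e8]
  have e10 : rising (1 / 2 + a) (k + M) =
        rising (1 / 2 + a) k * rising (1 + (a + 2 * k) - (1 / 2 + k)) M := by
    rw [rising_add]; congr 2; ring
  have q5 : 0 < rising (1 + (a + 2 * k) - (1 / 2 + k)) M := rising_pos (by
      have : (0 : ℝ) ≤ k := by positivity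
      linarith) M
  rw [e9, e10, unitSummand, show 1 + (a + 2 * k) - 2 * (1 / 2 + k) = a by ring]
  generalize rising (1 + (a + 2 * k) - (1 / 2 + k)) M = x5 at *
  generalize rising (1 + a + ((k + M : ℕ) : ℝ)) k = y2 at *
  generalize rising (1 / 2 + a) k = y3 at *
  generalize rising (1 + a - c) k = y4 at *
  generalize rising (1 / 2 : ℝ) k = y6
  generalize rising (1 - c) k = y7
  generalize rising (1 + (a + 2 * (k : ℝ))) M = y8 at *
  field_simp
  rw [← pow_mul, mul_comm k 2, pow_mul]
  simp only [neg_one_sq, one_pow, one_mul]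
  linear_combination y6 ^ 2 * y7 * rising a M * e7

end HypMod

namespace HypMod

open Finset Filter

/-! ### Passage to the limit in the terminating transformation -/

/-- The block of terms from n/2 to n contains at least n/2 terms, each at least f n, and the block
sums tend to zero. -/
lemma tendsto_nat_mul_of_antitone_summable {f : ℕ → ℝ} (hf : Antitone f) (h0 : ∀ n, 0 ≤ f n)
    (hs : Summable f) : Tendsto (fun n : ℕ => (n : ℝ) * f n) atTop (𝓝 0) := by
  have h1 := hs.hasSum.tendsto_sum_nat
  have h2 : Tendsto (fun n : ℕ => n / 2) atTop atTop := Nat.tendsto_div_const_atTop (by norm_num)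
  have h3 := ((h1.sub (h1.comp h2)).const_mul 2)
  rw [sub_self, mul_zero] at h3
  refine squeeze_zero (fun n => mul_nonneg n.cast_nonneg (h0 n)) (fun n => ?_) h3
  have h4 : ∑ i ∈ range n, f i - ∑ i ∈ range (n / 2), f i = ∑ i ∈ Ico (n / 2) n, f i :=
    (sum_Ico_eq_sub f (Nat.div_le_self n 2)).symm
  simp only [Function.comp_apply]
  rw [h4]
  have h5 : ((Ico (n / 2) n).card : ℝ) * f n ≤ ∑ i ∈ Ico (n / 2) n, f i := by
    rw [← nsmul_eq_mul]
    exact card_nsmul_le_sum _ _ _ fun i hi => hf (mem_Ico.1 hi).2.le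
  have h6 : (n : ℝ) ≤ 2 * ((Ico (n / 2) n).card : ℝ) := by
    rw [Nat.card_Ico]
    exact_mod_cast (by omega : n ≤ 2 * (n - n / 2))
  nlinarith [h0 n]

/-- A regularity theorem for alternating series: if the terms are multiplied by antitone weights
which tend to one, the sums of the weighted series tend to the sum of the series. -/
lemma tendsto_alternating_of_weighted {v : ℕ → ℝ} (hv : Antitone v) (hv0 : Tendsto v atTop (𝓝 0))
    {ω : ℕ → ℕ → ℝ} (hω : ∀ N, Antitone (ω N)) (hω0 : ∀ N n, 0 ≤ ω N n)
    (hfin : ∀ N n, N < n → ω N n = 0) (h1 : ∀ n, Tendsto (fun N => ω N n) atTop (𝓝 1)) {l : ℝ}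
    (hl : Tendsto (fun N => ∑ n ∈ range (N + 1), (-1) ^ n * (ω N n * v n)) atTop (𝓝 l)) :
    Tendsto (fun M => ∑ n ∈ range M, (-1) ^ n * v n) atTop (𝓝 l) := by
  obtain ⟨L, hL⟩ := hv.tendsto_alternating_series_of_tendsto_zero hv0
  have hvn : ∀ n, 0 ≤ v n := fun n => hv.le_of_tendsto hv0 n
  have hanti : ∀ N, Antitone fun n => ω N n * v n := fun N m n hmn =>
    mul_le_mul (hω N hmn) (hv hmn) (hvn n) (hω0 N m)
  have hsum : ∀ N, Tendsto (fun M => ∑ n ∈ range M, (-1) ^ n * (ω N n * v n)) atTop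
      (𝓝 (∑ n ∈ range (N + 1), (-1) ^ n * (ω N n * v n))) := fun N => by
    refine tendsto_const_nhds.congr' ?_
    filter_upwards [eventually_ge_atTop (N + 1)] with M hM
    refine sum_subset (range_subset_range.2 hM) fun n _ hn => ?_
    rw [hfin N n (by simpa using hn)]
    simp
  have hpart : ∀ M, Tendsto (fun N => ∑ n ∈ range M, (-1) ^ n * (ω N n * v n)) atTop
      (𝓝 (∑ n ∈ range M, (-1) ^ n * v n)) := fun M => by
    refine tendsto_finsetSum _ fun n _ => ?_
    simpa using ((h1 n).mul_const (v n)).const_mul ((-1) ^ n)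
  -- For every N the even partial sums of the weighted series lie below its sum and the odd ones
  -- above. These bounds survive N → ∞ with k fixed, which squeezes l between the even and odd
  -- partial sums of the limit series; no absolute convergence is needed.
  have lower : ∀ k, ∑ n ∈ range (2 * k), (-1) ^ n * v n ≤ l := fun k =>
    le_of_tendsto_of_tendsto' (hpart _) hl fun N =>
      (hanti N).alternating_series_le_tendsto (hsum N) k
  have upper : ∀ k, l ≤ ∑ n ∈ range (2 * k + 1), (-1) ^ n * v n := fun k =>
    le_of_tendsto_of_tendsto' hl (hpart _) fun N =>
      (hanti N).tendsto_le_alternating_series (hsum N) k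
  have t1 : Tendsto (fun k : ℕ => 2 * k) atTop atTop :=
    tendsto_id.const_mul_atTop' (by norm_num)
  have t2 : Tendsto (fun k : ℕ => 2 * k + 1) atTop atTop := tendsto_atTop_mono (fun k => Nat.le_succ _) t1
  have e1 : L ≤ l := le_of_tendsto' (hL.comp t1) lower
  have e2 : l ≤ L := ge_of_tendsto' (hL.comp t2) upper
  rwa [le_antisymm e2 e1]

/-- The coefficient `(a)_m / m!` of `(1-x)^{-a}`. -/
noncomputable def binomCoeff (a : ℝ) (m : ℕ) : ℝ := rising a m / m.factorial

lemma binomCoeff_pos {a : ℝ} (ha : 0 < a) (m : ℕ) : 0 < binomCoeff a m :=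
  div_pos (rising_pos ha m) (by positivity)

lemma binomCoeff_succ (a : ℝ) (m : ℕ) :
    binomCoeff a (m + 1) = binomCoeff a m * ((a + m) / (m + 1)) := by
  rw [binomCoeff, binomCoeff, rising_succ, Nat.factorial_succ]
  push_cast
  field_simp

lemma sum_binomCoeff {a : ℝ} (ha : 0 < a) (N : ℕ) :
    ∑ m ∈ range (N + 1), binomCoeff a m = (a + N) / a * binomCoeff a N := by
  induction N with
  | zero => simp [ha.ne']
  | succ N ih =>
    rw [sum_range_succ, ih, binomCoeff_succ]
    push_cast
    field_simp
    ring

/-- The sequence m (a)_m / m! is increasing, and N - k ≥ N/2 costs only a factor 2. This is the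
dominating bound for the first half of the convolution. -/
lemma binomCoeff_sub_le {a : ℝ} (ha : 0 < a) {N k : ℕ} (h : 2 * k ≤ N) :
    binomCoeff a (N - k) ≤ 2 * binomCoeff a N := by
  have hmono : Monotone fun m : ℕ => (m : ℝ) * binomCoeff a m := by
    refine monotone_nat_of_le_succ fun m => ?_
    rw [binomCoeff_succ]
    have := binomCoeff_pos ha m
    push_cast
    have : ((m : ℝ) + 1) * (binomCoeff a m * ((a + m) / (m + 1))) = (a + m) * binomCoeff a m := by
      field_simp
    rw [this]
    nlinarith
  have h1 := hmono (Nat.sub_le N k)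
  simp only at h1
  rcases Nat.eq_zero_or_pos N with rfl | hN
  · obtain rfl : k = 0 := by omega
    have := binomCoeff_pos ha 0
    simp only [Nat.sub_zero]
    linarith
  · have h2 : (N : ℝ) ≤ 2 * ((N - k : ℕ) : ℝ) := by exact_mod_cast (by omega : N ≤ 2 * (N - k))
    have h3 : (0 : ℝ) < N := by exact_mod_cast hN
    have p := binomCoeff_pos ha (N - k)
    have : (N : ℝ) * binomCoeff a (N - k) ≤ N * (2 * binomCoeff a N) := by nlinarith
    exact le_of_mul_le_mul_left this h3

lemma tendsto_binomCoeff_sub_div {a : ℝ} (ha : 0 < a) (k : ℕ) :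
    Tendsto (fun N => binomCoeff a (N - k) / binomCoeff a N) atTop (𝓝 1) := by
  rw [← tendsto_add_atTop_iff_nat k]
  simp only [Nat.add_sub_cancel]
  induction k with
  | zero =>
    refine tendsto_const_nhds.congr fun N => ?_
    rw [add_zero, div_self (binomCoeff_pos ha N).ne']
  | succ k ih =>
    have h1 : Tendsto (fun n : ℕ => ((n : ℝ) + (k + 1)) / ((n : ℝ) + (a + k))) atTop (𝓝 1) := by
      have := tendsto_add_mul_div_add_mul_atTop_nhds ((k : ℝ) + 1) (a + k) 1 (d := 1) one_ne_zero
      simpa [add_comm, add_left_comm, add_assoc] using this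
    have h2 := ih.mul h1
    rw [one_mul] at h2
    refine h2.congr fun n => ?_
    rw [show n + (k + 1) = n + k + 1 from rfl, binomCoeff_succ]
    have p1 := binomCoeff_pos ha (n + k)
    have p2 : 0 < a + (n + k : ℕ) := by positivity
    push_cast at p2 ⊢
    have p3 : 0 < (n : ℝ) + (a + k) := by linarith
    field_simp
    ring

/-- Convolution with the coefficients of `(1-x)^{-a}`. -/
lemma tendsto_sum_mul_binomCoeff {a : ℝ} (ha : 0 < a) {u : ℕ → ℝ} (hu : Antitone u)
    (hu0 : ∀ n, 0 ≤ u n) (hs : Summable u) :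
    Tendsto (fun N => ∑ k ∈ range (N + 1), u k * (binomCoeff a (N - k) / binomCoeff a N)) atTop
      (𝓝 (∑' k, u k)) := by
  -- The convolution is cut at k = N/2. The first half is handled by dominated convergence. In the
  -- second half u k ≤ u (N/2 + 1), and the weights sum to (a + N)/a, so the remainder is O(N u(N/2
  -- + 1)), which tends to zero.
  set f : ℕ → ℕ → ℝ := fun N k =>
    if 2 * k ≤ N then u k * (binomCoeff a (N - k) / binomCoeff a N) else 0 with hf
  have h1 : Tendsto (fun N => ∑' k, f N k) atTop (𝓝 (∑' k, u k)) := by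
    refine tendsto_tsum_of_dominated_convergence (hs.mul_right 2) (fun k => ?_) ?_
    · have := (tendsto_binomCoeff_sub_div ha k).const_mul (u k)
      rw [mul_one] at this
      refine this.congr' ?_
      filter_upwards [eventually_ge_atTop (2 * k)] with N hN
      simp [hf, hN]
    · refine Eventually.of_forall fun N k => ?_
      simp only [hf]
      split_ifs with h
      · have p1 := binomCoeff_pos ha N
        have p2 := binomCoeff_pos ha (N - k)
        rw [Real.norm_of_nonneg (mul_nonneg (hu0 k) (by positivity))]
        refine mul_le_mul_of_nonneg_left ?_ (hu0 k)
        rw [div_le_iff₀ p1]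
        exact binomCoeff_sub_le ha h
      · simpa using hu0 k
  have h2 : Tendsto (fun N : ℕ => u (N / 2 + 1) * ((a + N) / a)) atTop (𝓝 0) := by
    have t : Tendsto (fun N : ℕ => N / 2 + 1) atTop atTop :=
      tendsto_atTop_mono (fun N => Nat.le_succ _) (Nat.tendsto_div_const_atTop (by norm_num))
    have t1 := (hs.tendsto_atTop_zero.comp t)
    have t2 := ((tendsto_nat_mul_of_antitone_summable hu hu0 hs).comp t).const_mul (2 / a)
    have t3 := t1.add t2
    rw [mul_zero, add_zero] at t3
    refine squeeze_zero (fun N => mul_nonneg (hu0 _) (by positivity)) (fun N => ?_) t3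
    simp only [Function.comp_apply]
    have : (N : ℝ) ≤ 2 * ((N / 2 + 1 : ℕ) : ℝ) := by exact_mod_cast (by omega)
    have e : u (N / 2 + 1) + 2 / a * (((N / 2 + 1 : ℕ) : ℝ) * u (N / 2 + 1)) =
        u (N / 2 + 1) * ((a + 2 * ((N / 2 + 1 : ℕ) : ℝ)) / a) := by field_simp
    rw [e]
    exact mul_le_mul_of_nonneg_left (by gcongr) (hu0 _)
  have h3 : ∀ N, ∑' k, f N k = ∑ k ∈ range (N + 1), f N k := fun N =>
    tsum_eq_sum fun k hk => by
      simp only [hf]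
      rw [if_neg]
      simp only [mem_range] at hk
      omega
  have h4 : Tendsto (fun N => ∑ k ∈ range (N + 1), (u k * (binomCoeff a (N - k) / binomCoeff a N) -
      f N k)) atTop (𝓝 0) := by
    refine squeeze_zero (fun N => sum_nonneg fun k _ => ?_) (fun N => ?_) h2
    · have := mul_nonneg (hu0 k) (div_pos (binomCoeff_pos ha (N - k)) (binomCoeff_pos ha N)).le
      simp only [hf]
      split_ifs <;> simp [this]
    · calc _ ≤ ∑ k ∈ range (N + 1), u (N / 2 + 1) * (binomCoeff a (N - k) / binomCoeff a N) := by
            refine sum_le_sum fun k _ => ?_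
            have p := (div_pos (binomCoeff_pos ha (N - k)) (binomCoeff_pos ha N)).le
            simp only [hf]
            split_ifs with h
            · simpa using mul_nonneg (hu0 _) p
            · rw [sub_zero]
              exact mul_le_mul_of_nonneg_right (hu (by omega)) p
        _ = _ := by
            rw [← mul_sum, ← sum_div]
            have := sum_range_reflect (fun k => binomCoeff a k) (N + 1)
            simp only [Nat.add_sub_cancel] at this
            have h5 : ∀ k ∈ range (N + 1), binomCoeff a (N - k) = binomCoeff a (N + 1 - 1 - k) :=
              fun k _ => rfl
            rw [sum_congr rfl h5, sum_range_reflect, sum_binomCoeff ha]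
            have p1 := binomCoeff_pos ha N
            field_simp
  have h5 := h1.add h4
  rw [add_zero] at h5
  refine h5.congr fun N => ?_
  rw [h3, ← sum_add_distrib]
  exact sum_congr rfl fun k _ => by ring

/-- Euler's limit for Γ applied at 1/2 + a, 1 + a and a: the powers of n cancel because (1 + a) + a
= 2(1/2 + a). The index is shifted by one because Euler's product at n has n + 1 factors. -/
lemma tendsto_rising_ratio {a : ℝ} (ha : 0 < a) :
    Tendsto (fun N => rising (1 + a) N * rising a N / rising (1 / 2 + a) N ^ 2) atTop
      (𝓝 (Real.Gamma (1 / 2 + a) ^ 2 / (Real.Gamma (1 + a) * Real.Gamma a))) := by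
  rw [← tendsto_add_atTop_iff_nat 1]
  have h := ((Real.GammaSeq_tendsto_Gamma (1 / 2 + a)).pow 2).div
    ((Real.GammaSeq_tendsto_Gamma (1 + a)).mul (Real.GammaSeq_tendsto_Gamma a))
    (mul_pos (Real.Gamma_pos_of_pos (by linarith)) (Real.Gamma_pos_of_pos ha)).ne'
  refine h.congr' ?_
  filter_upwards [eventually_gt_atTop 0] with n hn
  have hn' : (0 : ℝ) < n := by exact_mod_cast hn
  change (_ / rising (1 / 2 + a) (n + 1)) ^ 2 /
    (_ / rising (1 + a) (n + 1) * (_ / rising a (n + 1))) = _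
  have p1 := rising_pos (show 0 < 1 / 2 + a by linarith) (n + 1)
  have p2 := rising_pos (show 0 < 1 + a by linarith) (n + 1)
  have p3 := rising_pos ha (n + 1)
  have e : ((n : ℝ) ^ (1 / 2 + a)) ^ 2 = (n : ℝ) ^ (1 + a) * (n : ℝ) ^ a := by
    rw [← Real.rpow_natCast, ← Real.rpow_mul hn'.le, ← Real.rpow_add hn']
    congr 1
    push_cast
    ring
  have p4 := Real.rpow_pos_of_pos hn' (1 + a)
  have p5 := Real.rpow_pos_of_pos hn' a
  have p6 : (0 : ℝ) < n.factorial := by positivity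
  rw [div_pow, mul_pow, e]
  generalize rising (1 / 2 + a) (n + 1) = x1 at *
  generalize (n : ℝ) ^ (1 + a) = x2 at *
  generalize (n : ℝ) ^ a = x3 at *
  field_simp

end HypMod

/-! ### Monotonicity and decay of the coefficients; the transformation at -1 -/

namespace HypMod

open Finset Filter

lemma sq_rising_half_div_le (k : ℕ) :
    (rising (1 / 2) k / k.factorial) ^ 2 ≤ 1 / ((k : ℝ) + 1) := by
  induction k with
  | zero => simp [rising_zero]
  | succ k ih =>
    have e : rising (1 / 2) (k + 1) / ((k + 1).factorial : ℝ) =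
        rising (1 / 2) k / k.factorial * ((1 / 2 + k) / (k + 1)) := by
      rw [rising_succ, Nat.factorial_succ]
      push_cast
      field_simp
    rw [e, mul_pow]
    calc _ ≤ 1 / ((k : ℝ) + 1) * ((1 / 2 + k) / (k + 1)) ^ 2 := by gcongr
      _ ≤ _ := by
        push_cast
        have hk : (0 : ℝ) ≤ k := k.cast_nonneg
        rw [div_pow, div_mul_div_comm, div_le_div_iff₀ (by positivity) (by positivity)]
        nlinarith [pow_nonneg hk 2, pow_nonneg hk 3]

lemma antitone_sq_rising_half_div : Antitone fun k : ℕ => (rising (1 / 2) k / k.factorial) ^ 2 := by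
  refine antitone_nat_of_succ_le fun k => ?_
  have p := rising_pos (show (0 : ℝ) < 1 / 2 by norm_num) k
  have e : rising (1 / 2) (k + 1) / ((k + 1).factorial : ℝ) =
        rising (1 / 2) k / k.factorial * ((1 / 2 + k) / (k + 1)) := by
    rw [rising_succ, Nat.factorial_succ]
    push_cast
    field_simp
  rw [e]
  refine pow_le_pow_left₀ (by positivity) (mul_le_of_le_one_right (by positivity) ?_) 2
  rw [div_le_one (by positivity)]
  linarith

section

variable {a c : ℝ}

lemma rising_ratio_succ (a c : ℝ) (k : ℕ) : rising (1 - c) (k + 1) / rising (1 + a - c) (k + 1) =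
    rising (1 - c) k / rising (1 + a - c) k * ((1 - c + k) / (1 + a - c + k)) := by
  rw [rising_succ, rising_succ, mul_div_mul_comm]

lemma rising_ratio_pos (ha : 0 < a) (hc : c < 1) (k : ℕ) :
    0 < rising (1 - c) k / rising (1 + a - c) k :=
  div_pos (rising_pos (by linarith) k) (rising_pos (by linarith) k)

lemma antitone_rising_ratio (ha : 0 < a) (hc : c < 1) :
    Antitone fun k : ℕ => rising (1 - c) k / rising (1 + a - c) k := by
  refine antitone_nat_of_succ_le fun k => ?_
  rw [rising_ratio_succ]
  have hk : (0 : ℝ) ≤ k := k.cast_nonneg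
  refine mul_le_of_le_one_right (rising_ratio_pos ha hc k).le ?_
  rw [div_le_one (by linarith)]
  linarith

lemma unitSummand_nonneg (ha : 0 < a) (hc : c < 1) (k : ℕ) : 0 ≤ unitSummand a c k :=
  mul_nonneg (by positivity) (rising_ratio_pos ha hc k).le

lemma antitone_unitSummand (ha : 0 < a) (hc : c < 1) : Antitone (unitSummand a c) :=
  fun _ n h => mul_le_mul (antitone_sq_rising_half_div h) (antitone_rising_ratio ha hc h)
    (rising_ratio_pos ha hc n).le (by positivity)

/-- The ratio g k = (1-c)_k / (1+a-c)_k is positive and decreasing, so its drops g k - g (k+1) = a g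
k / (1+a-c+k) are summable by telescoping. The squared factor contributes at most 1/(k+1), which
makes the terms comparable with these drops. -/
lemma summable_unitSummand (ha : 0 < a) (hc0 : 0 < c) (hc : c < 1) :
    Summable (unitSummand a c) := by
  set g : ℕ → ℝ := fun k => rising (1 - c) k / rising (1 + a - c) k with hg
  have hgp : ∀ k, 0 < g k := rising_ratio_pos ha hc
  have h1 : Summable fun k => g k - g (k + 1) := by
    refine summable_of_sum_range_le (c := g 0)
      (fun k => sub_nonneg.2 (antitone_rising_ratio ha hc (Nat.le_succ k))) fun n => ?_
    have := sum_range_sub' g n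
    rw [this]
    linarith [hgp n]
  refine Summable.of_nonneg_of_le (unitSummand_nonneg ha hc) (fun k => ?_)
    (h1.mul_left ((1 + a) / a))
  have hk : (0 : ℝ) ≤ k := k.cast_nonneg
  have e : g k - g (k + 1) = g k * (a / (1 + a - c + k)) := by
    have : g (k + 1) = g k * ((1 - c + k) / (1 + a - c + k)) := rising_ratio_succ a c k
    have p : 0 < 1 + a - c + k := by linarith
    rw [this]
    field_simp
    ring
  calc unitSummand a c k ≤ 1 / ((k : ℝ) + 1) * g k :=
        mul_le_mul_of_nonneg_right (sq_rising_half_div_le k) (hgp k).le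
    _ ≤ _ := by
        rw [e]
        have p : 0 < 1 + a - c + k := by linarith
        have : (1 + a) / a * (g k * (a / (1 + a - c + k))) = g k * ((1 + a) / (1 + a - c + k)) := by
          field_simp
        rw [this, mul_comm]
        refine mul_le_mul_of_nonneg_left ?_ (hgp k).le
        rw [div_le_div_iff₀ (by positivity) p]
        nlinarith

/-- A nonterminating form of Whipple's transformation of a very-well-poised series at `-1`. -/
theorem whipple_limit (ha : 0 < a) (hc0 : 0 < c) (hc : c < 1) (hv : Antitone (vwpCoeff a c))
    (hv0 : Tendsto (vwpCoeff a c) atTop (𝓝 0)) :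
    Tendsto (fun M => ∑ n ∈ range M, (-1) ^ n * vwpCoeff a c n) atTop
      (𝓝 (Real.Gamma (1 / 2 + a) ^ 2 / (Real.Gamma (1 + a) * Real.Gamma a) *
        ∑' k, unitSummand a c k)) := by
  -- The weights of the terminating transformation with the sign of (-N)_n extracted; they decrease
  -- in n from 1 to 0 and tend to 1 as N grows.
  set ω : ℕ → ℕ → ℝ := fun N n => (-1) ^ n * rising (-N) n / rising (1 + a + N) n with hω
  have hsucc : ∀ N n : ℕ, ω N (n + 1) = ω N n * ((N - n) / (1 + a + N + n)) := fun N n => by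
    simp only [hω]
    rw [rising_succ, rising_succ, pow_succ]
    have p1 := rising_pos (show 0 < 1 + a + N by positivity) n
    have p2 : 0 < 1 + a + N + n := by positivity
    field_simp
    ring
  have hfin : ∀ N n, N < n → ω N n = 0 := fun N n h => by simp [hω, rising_neg_eq_zero h]
  have hω0 : ∀ N n, 0 ≤ ω N n := fun N n => by
    induction n with
    | zero => simp [hω, rising_zero]
    | succ n ih =>
      rcases lt_or_ge N n with h | h
      · rw [hfin N (n + 1) (by omega)]
      · rw [hsucc]
        have : (n : ℝ) ≤ N := by exact_mod_cast h
        exact mul_nonneg ih (div_nonneg (by linarith) (by positivity))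
  have hanti : ∀ N, Antitone (ω N) := fun N => by
    refine antitone_nat_of_succ_le fun n => ?_
    rw [hsucc]
    refine mul_le_of_le_one_right (hω0 N n) ?_
    rw [div_le_one (by positivity)]
    have : (0 : ℝ) ≤ n := n.cast_nonneg
    linarith
  have h1 : ∀ n, Tendsto (fun N => ω N n) atTop (𝓝 1) := fun n => by
    induction n with
    | zero => simp [hω, rising_zero]
    | succ n ih =>
      have h2 : Tendsto (fun N : ℕ => ((N : ℝ) - n) / (1 + a + N + n)) atTop (𝓝 1) := by
        have := tendsto_add_mul_div_add_mul_atTop_nhds (-(n : ℝ)) (1 + a + n) 1 (d := 1)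
          one_ne_zero
        rw [div_one] at this
        exact this.congr fun N => by ring
      have h3 := ih.mul h2
      rw [one_mul] at h3
      exact h3.congr fun N => (hsucc N n).symm
  refine tendsto_alternating_of_weighted hv hv0 hanti hω0 hfin h1 ?_
  -- The right side of the terminating identity factors as (1+a)_N (a)_N / (1/2+a)_N² times the
  -- convolution of `unitSummand` with normalized binomial coefficients; the two factors have
  -- separate limits.
  refine ((tendsto_rising_ratio ha).mul (tendsto_sum_mul_binomCoeff ha (antitone_unitSummand ha hc)
    (unitSummand_nonneg ha hc) (summable_unitSummand ha hc0 hc))).congr fun N => ?_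
  have e := whipple_terminating ha (show c < 1 + a by linarith) N
  have e' : ∑ n ∈ range (N + 1), rising (-N) n / rising (1 + a + N) n * vwpCoeff a c n =
      ∑ n ∈ range (N + 1), (-1) ^ n * (ω N n * vwpCoeff a c n) := by
    refine sum_congr rfl fun n _ => ?_
    simp only [hω]
    have : ((-1 : ℝ) ^ n) * (-1) ^ n = 1 := by rw [← mul_pow]; simp
    linear_combination (-(rising (-N) n / rising (1 + a + N) n * vwpCoeff a c n)) * this
  rw [← e', e, mul_sum, mul_sum]
  refine sum_congr rfl fun k _ => ?_
  have p1 := rising_pos ha N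
  have p2 := rising_pos (show 0 < 1 / 2 + a by linarith) N
  have p3 : (0 : ℝ) < (N - k).factorial := by positivity
  have p4 : (0 : ℝ) < N.factorial := by positivity
  rw [binomCoeff, binomCoeff]
  generalize rising (1 / 2 + a) N = x1 at *
  field_simp

lemma risingQuot_succ (a : ℝ) (n : ℕ) :
    rising a (n + 1) * rising (1 / 2) (n + 1) / ((n + 1).factorial * rising (1 / 2 + a) (n + 1)) =
      rising a n * rising (1 / 2) n / (n.factorial * rising (1 / 2 + a) n) *
        ((a + n) * (1 / 2 + n) / ((n + 1) * (1 / 2 + a + n))) := by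
  rw [rising_succ, rising_succ, rising_succ, Nat.factorial_succ, mul_comm (n + 1 : ℕ), div_mul_div_comm]
  push_cast
  congr 1 <;> ring

lemma risingQuot_pos (ha : 0 < a) (n : ℕ) :
    0 < rising a n * rising (1 / 2) n / (n.factorial * rising (1 / 2 + a) n) := by
  have p1 := rising_pos ha n
  have p2 := rising_pos (show (0 : ℝ) < 1 / 2 by norm_num) n
  have p3 := rising_pos (show 0 < 1 / 2 + a by linarith) n
  positivity

lemma risingQuot_le (ha : 0 < a) (ha1 : a < 1) (n : ℕ) :
    rising a n * rising (1 / 2) n / (n.factorial * rising (1 / 2 + a) n) ≤ 1 / ((n : ℝ) + 1) := by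
  induction n with
  | zero => simp [rising_zero]
  | succ n ih =>
    rw [risingQuot_succ]
    have hn : (0 : ℝ) ≤ n := n.cast_nonneg
    calc _ ≤ 1 / ((n : ℝ) + 1) * ((a + n) * (1 / 2 + n) / ((n + 1) * (1 / 2 + a + n))) := by gcongr
      _ ≤ _ := by
        push_cast
        rw [div_mul_div_comm, div_le_div_iff₀ (by positivity) (by positivity)]
        nlinarith [mul_nonneg hn hn, mul_nonneg hn ha.le, mul_nonneg (mul_nonneg hn hn) hn,
          mul_nonneg (mul_nonneg hn hn) ha.le]

/-- At c = a/2 the linear factor (a + 2n)/a cancels against (c)_n / (1+a-c)_n, which leaves the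
coefficients of `HD4`. -/
lemma vwpCoeff_half (ha : 0 < a) (n : ℕ) : vwpCoeff a (a / 2) n =
    (rising a n * rising (1 / 2) n / (n.factorial * rising (1 / 2 + a) n)) ^ 2 := by
  rw [vwpCoeff]
  have h := rising_shift (a / 2) n
  rw [show 1 + a - a / 2 = a / 2 + 1 by ring]
  have p := rising_pos (show 0 < a / 2 + 1 by linarith) n
  have : (a + 2 * n) / a * (rising (a / 2) n / rising (a / 2 + 1) n) = 1 := by
    rw [← mul_div_assoc, div_eq_one_iff_eq p.ne', div_mul_eq_mul_div, div_eq_iff ha.ne']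
    linarith
  rw [this, mul_one]

/-- At c = (1+a)/2 one has 1 + a - c = c, so the linear factor survives. It equals (1+a/2)_n /
(a/2)_n, which gives the coefficients of `HD5`. -/
lemma vwpCoeff_half_add (ha : 0 < a) (n : ℕ) : vwpCoeff a ((1 + a) / 2) n =
    (rising a n * rising (1 / 2) n / (n.factorial * rising (1 / 2 + a) n)) ^ 2 *
      ((a + 2 * n) / a) := by
  rw [vwpCoeff, show 1 + a - (1 + a) / 2 = (1 + a) / 2 by ring,
    div_self (rising_pos (show 0 < (1 + a) / 2 by linarith) n).ne', mul_one]

lemma antitone_vwpCoeff_half (ha : 0 < a) : Antitone (vwpCoeff a (a / 2)) := by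
  refine antitone_nat_of_succ_le fun n => ?_
  rw [vwpCoeff_half ha, vwpCoeff_half ha, risingQuot_succ]
  have p := risingQuot_pos ha n
  refine pow_le_pow_left₀ (by positivity) (mul_le_of_le_one_right p.le ?_) 2
  have hn : (0 : ℝ) ≤ n := n.cast_nonneg
  rw [div_le_one (by positivity)]
  nlinarith

lemma antitone_vwpCoeff_half_add (ha : 0 < a) (ha1 : a < 1) :
    Antitone (vwpCoeff a ((1 + a) / 2)) := by
  refine antitone_nat_of_succ_le fun n => ?_
  rw [vwpCoeff_half_add ha, vwpCoeff_half_add ha, risingQuot_succ, mul_pow, mul_assoc]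
  refine mul_le_mul_of_nonneg_left ?_ (by positivity)
  have hn : (0 : ℝ) ≤ n := n.cast_nonneg
  push_cast
  rw [div_pow, div_mul_div_comm, div_le_div_iff₀ (by positivity) (by positivity)]
  have key : ((a + n) * (1 / 2 + n)) ^ 2 * (a + 2 * (n + 1)) ≤
      (a + 2 * n) * ((n + 1) * (1 / 2 + a + n)) ^ 2 := by
    have e : (a + 2 * n) * ((n + 1) * (1 / 2 + a + n)) ^ 2 -
        ((a + n) * (1 / 2 + n)) ^ 2 * (a + 2 * (n + 1)) =
        (a + 2 * n) * (n + (1 + a) / 2) ^ 2 + (n + (1 + a) / 2) ^ 2 * (a + 2 * n) ^ 2 / 2 -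
          (a * (1 - a)) ^ 2 / 8 := by ring
    have h1 : a * (1 / 2) ^ 2 ≤ (a + 2 * n) * (n + (1 + a) / 2) ^ 2 := by
      gcongr <;> linarith
    have h2 : 0 ≤ (n + (1 + a) / 2) ^ 2 * (a + 2 * n) ^ 2 / 2 := by positivity
    have h3 : (a * (1 - a)) ^ 2 ≤ a * 1 := by
      rw [mul_pow, sq, mul_assoc]
      refine mul_le_mul_of_nonneg_left ?_ ha.le
      nlinarith
    linarith
  nlinarith

lemma tendsto_vwpCoeff_half (ha : 0 < a) (ha1 : a < 1) :
    Tendsto (vwpCoeff a (a / 2)) atTop (𝓝 0) := by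
  have h := (tendsto_one_div_add_atTop_nhds_zero_nat (𝕜 := ℝ)).pow 2
  rw [zero_pow two_ne_zero] at h
  refine squeeze_zero (fun n => ?_) (fun n => ?_) h
  · rw [vwpCoeff_half ha]; positivity
  · rw [vwpCoeff_half ha]
    exact pow_le_pow_left₀ (risingQuot_pos ha n).le (risingQuot_le ha ha1 n) 2

lemma tendsto_vwpCoeff_half_add (ha : 0 < a) (ha1 : a < 1) :
    Tendsto (vwpCoeff a ((1 + a) / 2)) atTop (𝓝 0) := by
  have h := (tendsto_one_div_add_atTop_nhds_zero_nat (𝕜 := ℝ)).mul_const (2 / a)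
  rw [zero_mul] at h
  refine squeeze_zero (fun n => ?_) (fun n => ?_) h
  · rw [vwpCoeff_half_add ha]; positivity
  · rw [vwpCoeff_half_add ha]
    calc _ ≤ (1 / ((n : ℝ) + 1)) ^ 2 * ((a + 2 * n) / a) := by
          exact mul_le_mul_of_nonneg_right
            (pow_le_pow_left₀ (risingQuot_pos ha n).le (risingQuot_le ha ha1 n) 2) (by positivity)
      _ ≤ _ := by
          have hn : (0 : ℝ) ≤ n := n.cast_nonneg
          rw [div_pow, div_mul_div_comm, div_mul_div_comm, div_le_div_iff₀ (by positivity)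
            (by positivity)]
          have : a + 2 * n ≤ 2 * (n + 1) := by linarith
          nlinarith [mul_nonneg (mul_nonneg ha.le (by linarith : (0 : ℝ) ≤ 2 * (n + 1) - (a + 2 * n)))
            (by positivity : (0 : ℝ) ≤ n + 1)]

end

end HypMod

namespace HypMod

open Finset Filter MeasureTheory

/-! ### The series attached to the hypergeometric data -/

lemma eval_ascPochhammer_ofReal (x : ℝ) (n : ℕ) :
    (ascPochhammer ℂ n).eval (x : ℂ) = (rising x n : ℂ) := by
  induction n with
  | zero => simp [rising_zero]
  | succ n ih => rw [ascPochhammer_succ_eval, ih, rising_succ]; push_cast; rfl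

lemma rising_one_add_half_div {a : ℝ} (ha : 0 < a) (n : ℕ) :
    rising (1 + a / 2) n / rising (a / 2) n = (a + 2 * n) / a := by
  have h := rising_shift (a / 2) n
  have p := rising_pos (half_pos ha) n
  rw [add_comm 1, div_eq_div_iff p.ne' ha.ne']
  linarith

lemma HD4_coeff {r : ℚ} (hr : 0 < r) (k : ℕ) :
    (HD4 r).coeff k = (vwpCoeff (r : ℝ) ((r : ℝ) / 2) k : ℂ) := by
  have hr' : (0 : ℝ) < r := by exact_mod_cast hr
  have e1 : ((r : ℚ) : ℂ) = (((r : ℚ) : ℝ) : ℂ) := by push_cast; rfl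
  have e2 : ((1 / 2 : ℚ) : ℂ) = ((1 / 2 : ℝ) : ℂ) := by push_cast; rfl
  have e3 : ((1 / 2 + r : ℚ) : ℂ) = ((1 / 2 + (r : ℝ) : ℝ) : ℂ) := by push_cast; rfl
  have e4 : ((1 : ℚ) : ℂ) = ((1 : ℝ) : ℂ) := by push_cast; rfl
  rw [vwpCoeff_half hr']
  simp only [HypergeometricDatum.coeff, HD4, Multiset.insert_eq_cons, Multiset.bind_def,
    Multiset.pure_def, Multiset.bind_singleton, Multiset.map_cons,
    Multiset.map_singleton, Multiset.prod_cons, Multiset.prod_singleton]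
  rw [e1, e2, e3, e4]
  simp only [eval_ascPochhammer_ofReal, rising_one]
  push_cast
  ring

lemma HD5_coeff {r : ℚ} (hr : 0 < r) (k : ℕ) :
    (HD5 r).coeff k = (vwpCoeff (r : ℝ) ((1 + (r : ℝ)) / 2) k : ℂ) := by
  have hr' : (0 : ℝ) < r := by exact_mod_cast hr
  have e1 : ((r : ℚ) : ℂ) = (((r : ℚ) : ℝ) : ℂ) := by push_cast; rfl
  have e2 : ((1 / 2 : ℚ) : ℂ) = ((1 / 2 : ℝ) : ℂ) := by push_cast; rfl
  have e3 : ((1 / 2 + r : ℚ) : ℂ) = ((1 / 2 + (r : ℝ) : ℝ) : ℂ) := by push_cast; rfl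
  have e4 : ((1 : ℚ) : ℂ) = ((1 : ℝ) : ℂ) := by push_cast; rfl
  have e5 : ((1 + r / 2 : ℚ) : ℂ) = ((1 + (r : ℝ) / 2 : ℝ) : ℂ) := by push_cast; rfl
  have e6 : ((r / 2 : ℚ) : ℂ) = (((r : ℝ) / 2 : ℝ) : ℂ) := by push_cast; rfl
  rw [vwpCoeff_half_add hr', ← rising_one_add_half_div hr']
  simp only [HypergeometricDatum.coeff, HD5, Multiset.insert_eq_cons, Multiset.bind_def,
    Multiset.pure_def, Multiset.bind_singleton, Multiset.map_cons,
    Multiset.map_singleton, Multiset.prod_cons, Multiset.prod_singleton]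
  rw [e1, e2, e3, e4, e5, e6]
  simp only [eval_ascPochhammer_ofReal, rising_one]
  push_cast
  ring

/-- The Gamma quotient in Whipple's transformation. -/
noncomputable def whippleFactor (a : ℝ) : ℝ :=
  Real.Gamma (1 / 2 + a) ^ 2 / (Real.Gamma (1 + a) * Real.Gamma a)

lemma hasValue_of_tendsto {HD : HypergeometricDatum} {v : ℕ → ℝ} (h : ∀ k, HD.coeff k = (v k : ℂ))
    {l : ℝ} (hl : Tendsto (fun M => ∑ n ∈ range M, (-1) ^ n * v n) atTop (𝓝 l)) :
    HD.HasValue (-1) l := by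
  refine ((Complex.continuous_ofReal.tendsto l).comp hl).congr fun M => ?_
  simp only [Function.comp_apply]
  push_cast
  exact sum_congr rfl fun k _ => by rw [h]; ring

theorem hasValue_HD4 {r : ℚ} (hr : 0 < r) (hr1 : r < 1) : (HD4 r).HasValue (-1)
    ((whippleFactor r * ∑' k, unitSummand r ((r : ℝ) / 2) k : ℝ) : ℂ) := by
  have hr' : (0 : ℝ) < r := by exact_mod_cast hr
  have hr1' : (r : ℝ) < 1 := by exact_mod_cast hr1
  exact hasValue_of_tendsto (HD4_coeff hr) (whipple_limit hr' (by linarith) (by linarith)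
    (antitone_vwpCoeff_half hr') (tendsto_vwpCoeff_half hr' hr1'))

theorem hasValue_HD5 {r : ℚ} (hr : 0 < r) (hr1 : r < 1) : (HD5 r).HasValue (-1)
    ((whippleFactor r * ∑' k, unitSummand r ((1 + (r : ℝ)) / 2) k : ℝ) : ℂ) := by
  have hr' : (0 : ℝ) < r := by exact_mod_cast hr
  have hr1' : (r : ℝ) < 1 := by exact_mod_cast hr1
  exact hasValue_of_tendsto (HD5_coeff hr) (whipple_limit hr' (by linarith) (by linarith)
    (antitone_vwpCoeff_half_add hr' hr1') (tendsto_vwpCoeff_half_add hr' hr1'))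

/-! ### The complete elliptic integral as a power series -/

lemma hasDerivAt_tsum_pow {b : ℕ → ℝ} (hb : ∀ k, |b k| ≤ 1) {x : ℝ} (hx : |x| < 1) :
    HasDerivAt (fun y => ∑' k, b k * y ^ k) (∑' k : ℕ, b k * (k * x ^ (k - 1))) x := by
  obtain ⟨ρ, h1, h2⟩ := exists_between hx
  have hρ0 : 0 ≤ ρ := (abs_nonneg x).trans h1.le
  have hu : Summable fun k : ℕ => (k : ℝ) * ρ ^ (k - 1) := by
    rw [← summable_nat_add_iff 1]
    have := summable_pow_mul_geometric_of_norm_lt_one 1 (r := ρ) (by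
      rwa [Real.norm_of_nonneg hρ0])
    have h0 := summable_geometric_of_lt_one hρ0 h2
    refine (this.add h0).congr fun k => ?_
    simp
    ring
  have hb' : ∀ k, |b k| ≤ 1 := hb
  refine hasDerivAt_tsum_of_isPreconnected (t := Metric.ball 0 ρ) (y₀ := 0) hu Metric.isOpen_ball
    (convex_ball _ _).isPreconnected
    (fun k y _ => (hasDerivAt_pow k y).const_mul (b k)) (fun k y hy => ?_)
    (Metric.mem_ball_self ((abs_nonneg x).trans_lt h1)) ?_ (by simpa using h1)
  · rw [mem_ball_zero_iff, Real.norm_eq_abs] at hy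
    rw [norm_mul, norm_mul, norm_pow, Real.norm_eq_abs, Real.norm_eq_abs, Real.norm_eq_abs,
      Nat.abs_cast]
    calc |b k| * (k * |y| ^ (k - 1)) ≤ 1 * (k * ρ ^ (k - 1)) := by gcongr; exact hb k
      _ = _ := one_mul _
  · refine summable_of_ne_finset_zero (s := {0}) fun k hk => ?_
    rw [zero_pow (by simpa using hk), mul_zero]

/-- The coefficients of `₂F₁(1/2, 1/2; 1; x)`. -/
noncomputable def ellipCoeff (k : ℕ) : ℝ := (rising (1 / 2) k / k.factorial) ^ 2

/-- The function `₂F₁(1/2, 1/2; 1; x)`. -/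
noncomputable def ellipF (x : ℝ) : ℝ := ∑' k, ellipCoeff k * x ^ k

/-- The coefficients of `x (1 - x) F'(x)`, `F = ₂F₁(1/2, 1/2; 1; x)`. -/
noncomputable def ellipCoeff' : ℕ → ℝ
  | 0 => 0
  | k + 1 => ellipCoeff k / (4 * (k + 1))

/-- The function `x (1 - x) F'(x)`, `F = ₂F₁(1/2, 1/2; 1; x)`. -/
noncomputable def ellipP (x : ℝ) : ℝ := ∑' k, ellipCoeff' k * x ^ k

lemma ellipCoeff_nonneg (k : ℕ) : 0 ≤ ellipCoeff k := sq_nonneg _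

lemma ellipCoeff_le_one (k : ℕ) : ellipCoeff k ≤ 1 :=
  (sq_rising_half_div_le k).trans (by
    rw [div_le_one (by positivity)]; linarith [(k.cast_nonneg : (0 : ℝ) ≤ k)])

lemma abs_ellipCoeff_le (k : ℕ) : |ellipCoeff k| ≤ 1 := by
  rw [abs_of_nonneg (ellipCoeff_nonneg k)]
  exact ellipCoeff_le_one k

lemma abs_ellipCoeff'_le (k : ℕ) : |ellipCoeff' k| ≤ 1 := by
  cases k with
  | zero => simp [ellipCoeff']
  | succ k =>
    rw [ellipCoeff', abs_of_nonneg (div_nonneg (ellipCoeff_nonneg k) (by positivity)),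
      div_le_one (by positivity)]
    linarith [ellipCoeff_le_one k, (k.cast_nonneg : (0 : ℝ) ≤ k)]

lemma ellipCoeff_succ (k : ℕ) :
    ellipCoeff (k + 1) * (k + 1) ^ 2 = ellipCoeff k * (k + 1 / 2) ^ 2 := by
  rw [ellipCoeff, ellipCoeff, rising_succ, Nat.factorial_succ]
  push_cast
  field_simp
  ring

lemma summable_bdd_mul_pow {b : ℕ → ℝ} (hb : ∀ k, |b k| ≤ 1) {x : ℝ} (hx : |x| < 1) :
    Summable fun k => b k * x ^ k :=
  Summable.of_norm_bounded (summable_geometric_of_lt_one (abs_nonneg x) hx) fun k => by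
    rw [norm_mul, norm_pow, Real.norm_eq_abs, Real.norm_eq_abs]
    exact mul_le_of_le_one_left (by positivity) (hb k)

lemma summable_bdd_mul_pow' {b : ℕ → ℝ} (hb : ∀ k, |b k| ≤ 1) {x : ℝ} (hx : |x| < 1) :
    Summable fun k : ℕ => b k * (k * x ^ k) := by
  have := summable_pow_mul_geometric_of_norm_lt_one 1 (r := |x|) (by simpa using hx)
  refine Summable.of_norm_bounded this fun k => ?_
  rw [norm_mul, norm_mul, norm_pow, Real.norm_eq_abs, Real.norm_eq_abs, Real.norm_eq_abs,
    Nat.abs_cast, pow_one]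
  exact mul_le_of_le_one_left (by positivity) (hb k)

/-- Together with `hasDerivAt_ellipP` this writes the hypergeometric equation (x(1-x)F')' = F/4 as a
first order system for (F, P), the form in which it is compared with theta functions. Multiplying by
x(1-x) turns the claim into the coefficient recurrence `ellipCoeff_succ`. -/
lemma hasDerivAt_ellipF {x : ℝ} (hx0 : 0 < x) (hx : x < 1) :
    HasDerivAt ellipF (ellipP x / (x * (1 - x))) x := by
  have hx' : |x| < 1 := by rwa [abs_of_pos hx0]
  have h := hasDerivAt_tsum_pow abs_ellipCoeff_le hx'
  convert! h using 1
  have h1x : 0 < 1 - x := by linarith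
  rw [div_eq_iff (by positivity)]
  have hs := summable_bdd_mul_pow' abs_ellipCoeff_le hx'
  have e1 : (∑' k : ℕ, ellipCoeff k * (k * x ^ (k - 1))) * x =
      ∑' k : ℕ, ellipCoeff k * (k * x ^ k) := by
    rw [← tsum_mul_right]
    refine tsum_congr fun k => ?_
    cases k with
    | zero => simp
    | succ k => rw [Nat.add_sub_cancel, pow_succ]; ring
  rw [← mul_assoc, e1, mul_sub, mul_one]
  have e2 : ∑' k : ℕ, ellipCoeff k * (k * x ^ k) =
      ∑' k : ℕ, ellipCoeff (k + 1) * (((k + 1 : ℕ) : ℝ) * x ^ (k + 1)) := by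
    rw [hs.tsum_eq_zero_add]
    simp
  have hs1 := (summable_nat_add_iff 1).2 hs
  rw [← tsum_mul_right, e2, ← hs1.tsum_sub (hs.mul_right x), ellipP,
    (summable_bdd_mul_pow abs_ellipCoeff'_le hx').tsum_eq_zero_add]
  simp only [ellipCoeff', zero_mul, zero_add]
  refine tsum_congr fun k => ?_
  have := ellipCoeff_succ k
  have e : ellipCoeff (k + 1) = ellipCoeff k * (k + 1 / 2) ^ 2 / (k + 1) ^ 2 := by
    field_simp
    linarith
  rw [e]
  push_cast
  field_simp
  ring

lemma hasDerivAt_ellipP {x : ℝ} (hx : |x| < 1) : HasDerivAt ellipP (ellipF x / 4) x := by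
  have h := hasDerivAt_tsum_pow abs_ellipCoeff'_le hx
  convert! h using 1
  have hs : Summable fun k : ℕ => ellipCoeff' k * (k * x ^ (k - 1)) := by
    rw [← summable_nat_add_iff 1]
    refine ((summable_bdd_mul_pow abs_ellipCoeff_le hx).div_const 4).congr fun k => ?_
    simp only [ellipCoeff', Nat.add_sub_cancel]
    push_cast
    field_simp
  rw [hs.tsum_eq_zero_add, ellipF, ← tsum_div_const]
  simp only [ellipCoeff', zero_mul, zero_add, Nat.add_sub_cancel]
  refine tsum_congr fun k => ?_
  push_cast
  field_simp

lemma ellipF_zero : ellipF 0 = 1 := by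
  rw [ellipF, tsum_eq_single 0 fun k hk => by rw [zero_pow hk, mul_zero]]
  simp [ellipCoeff, rising_zero]

lemma ellipP_zero : ellipP 0 = 0 := by
  rw [ellipP, tsum_eq_single 0 fun k hk => by rw [zero_pow hk, mul_zero]]
  simp [ellipCoeff']

lemma continuousAt_ellipF_zero : ContinuousAt ellipF 0 :=
  (hasDerivAt_tsum_pow abs_ellipCoeff_le (by simp)).continuousAt

lemma continuousAt_ellipP_zero : ContinuousAt ellipP 0 :=
  (hasDerivAt_tsum_pow abs_ellipCoeff'_le (by simp)).continuousAt

lemma one_le_ellipF {x : ℝ} (hx0 : 0 ≤ x) (hx : x < 1) : 1 ≤ ellipF x := by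
  have h := (summable_bdd_mul_pow abs_ellipCoeff_le (by rwa [abs_of_nonneg hx0])).le_tsum 0
    fun k _ => mul_nonneg (ellipCoeff_nonneg k) (pow_nonneg hx0 k)
  have e : ellipCoeff 0 * x ^ 0 = 1 := by simp [ellipCoeff, rising_zero]
  rwa [e] at h

/-! ### Beta integrals -/

open ProbabilityTheory in
lemma integrableOn_beta_and_integral {u v : ℝ} (hu : 0 < u) (hv : 0 < v) :
    IntegrableOn (fun x : ℝ => x ^ (u - 1) * (1 - x) ^ (v - 1)) (Set.Ioo 0 1) ∧
      ∫ x in Set.Ioo (0 : ℝ) 1, x ^ (u - 1) * (1 - x) ^ (v - 1) = beta u v := by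
  have h1 := Complex.betaIntegral_convergent (u := u) (v := v) (by simpa) (by simpa)
  rw [intervalIntegrable_iff_integrableOn_Ioo_of_le zero_le_one] at h1
  have e : ∀ x ∈ Set.Ioo (0 : ℝ) 1, ((x : ℂ) ^ ((u : ℂ) - 1) * (1 - (x : ℂ)) ^ ((v : ℂ) - 1)).re =
      x ^ (u - 1) * (1 - x) ^ (v - 1) := fun x hx => by
    have e1 : (x : ℂ) ^ ((u : ℂ) - 1) = ((x ^ (u - 1) : ℝ) : ℂ) := by
      rw [Complex.ofReal_cpow hx.1.le]; push_cast; rfl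
    have e2 : (1 - (x : ℂ)) ^ ((v : ℂ) - 1) = (((1 - x) ^ (v - 1) : ℝ) : ℂ) := by
      rw [Complex.ofReal_cpow (by linarith [hx.2])]; push_cast; rfl
    rw [e1, e2, ← Complex.ofReal_mul, Complex.ofReal_re]
  refine ⟨IntegrableOn.congr_fun h1.re e measurableSet_Ioo, ?_⟩
  rw [← setIntegral_congr_fun measurableSet_Ioo e, beta_eq_betaIntegralReal u v hu hv,
    Complex.betaIntegral, intervalIntegral.integral_of_le zero_le_one, integral_Ioc_eq_integral_Ioo]
  exact integral_re h1

open ProbabilityTheory in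
lemma beta_add_nat {u v : ℝ} (hu : 0 < u) (hv : 0 < v) (k : ℕ) :
    beta (u + k) v = beta u v * (rising u k / rising (u + v) k) := by
  have hG : ∀ x : ℝ, 0 < x → Real.Gamma (x + k) = Real.Gamma x * rising x k := by
    intro x hx
    induction k with
    | zero => simp [rising_zero]
    | succ k ih =>
      rw [rising_succ, Nat.cast_succ, ← add_assoc, Real.Gamma_add_one (by positivity), ih]
      ring
  rw [beta, beta, hG u hu, show u + k + v = u + v + k by ring, hG _ (add_pos hu hv)]
  rw [div_mul_div_comm]
  congr 1
  ring

-- Expand F and integrate each power against the Beta density. All terms are nonnegative, so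
-- summability of their integrals justifies the exchange.
open ProbabilityTheory in
theorem integral_beta_mul_ellipF {a c : ℝ} (ha : 0 < a) (hc0 : 0 < c) (hc : c < 1) :
    IntegrableOn (fun x : ℝ => x ^ (-c) * (1 - x) ^ (a - 1) * ellipF x) (Set.Ioo 0 1) ∧
      ∫ x in Set.Ioo (0 : ℝ) 1, x ^ (-c) * (1 - x) ^ (a - 1) * ellipF x =
        beta (1 - c) a * ∑' k, unitSummand a c k := by
  set f : ℕ → ℝ → ℝ := fun k x => ellipCoeff k * (x ^ ((1 - c + k) - 1) * (1 - x) ^ (a - 1)) with hf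
  have hb : ∀ k : ℕ, IntegrableOn (f k) (Set.Ioo 0 1) ∧
      ∫ x in Set.Ioo (0 : ℝ) 1, f k x = beta (1 - c) a * unitSummand a c k := fun k => by
    have hk : 0 < 1 - c + k := by have : (0 : ℝ) ≤ k := k.cast_nonneg
                                  linarith
    have := integrableOn_beta_and_integral hk ha
    refine ⟨this.1.const_mul _, ?_⟩
    simp only [hf]
    rw [integral_const_mul, this.2, beta_add_nat (by linarith) ha, unitSummand, ellipCoeff,
      show 1 - c + a = 1 + a - c by ring]
    ring
  have hnn : ∀ k, ∀ x ∈ Set.Ioo (0 : ℝ) 1, 0 ≤ f k x := fun k x hx => by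
    have := ellipCoeff_nonneg k
    have h1 : 0 ≤ 1 - x := by linarith [hx.2]
    have h2 := hx.1.le
    simp only [hf]
    positivity
  have hnorm : ∀ k, ∫ x in Set.Ioo (0 : ℝ) 1, ‖f k x‖ = beta (1 - c) a * unitSummand a c k :=
    fun k => by
      rw [← (hb k).2]
      exact setIntegral_congr_fun measurableSet_Ioo fun x hx => Real.norm_of_nonneg (hnn k x hx)
  have hsum : Summable fun k => ∫ x in Set.Ioo (0 : ℝ) 1, ‖f k x‖ := by
    simp only [hnorm]
    exact (summable_unitSummand ha hc0 hc).mul_left _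
  have hF : ∀ x ∈ Set.Ioo (0 : ℝ) 1,
      ∑' k, f k x = x ^ (-c) * (1 - x) ^ (a - 1) * ellipF x := fun x hx => by
    rw [ellipF, ← tsum_mul_left]
    refine tsum_congr fun k => ?_
    simp only [hf]
    rw [show 1 - c + k - 1 = -c + k by ring, Real.rpow_add hx.1, Real.rpow_natCast]
    ring
  have hint := hasSum_integral_of_summable_integral_norm (fun k => (hb k).1) hsum
  rw [setIntegral_congr_fun measurableSet_Ioo hF] at hint
  refine ⟨?_, ?_⟩
  -- If the sum were not integrable, its integral would be 0 by convention; then every term would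
  -- integrate to zero, but the term k = 0 gives B(1-c, a) > 0.
  · by_contra hni
    have h0 := integral_undef hni
    rw [h0] at hint
    have h1 := (hasSum_zero_iff_of_nonneg fun k =>
      setIntegral_nonneg measurableSet_Ioo (hnn k)).1 hint
    have h2 := congrFun h1 0
    simp only [(hb 0).2, Pi.zero_apply] at h2
    have h3 := beta_pos (show 0 < 1 - c by linarith) ha
    simp [unitSummand, rising_zero, h3.ne'] at h2
  · rw [← hint.tsum_eq, ← tsum_mul_left]
    exact tsum_congr fun k => (hb k).2

end HypMod

/-! ### Euler's product and the transformation laws of η -/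

namespace HypMod

open Filter ModularForm
open Complex hiding eta
open UpperHalfPlane hiding I

/-- Euler's product `∏ (1 - q ^ (n + 1))`. -/
noncomputable def eulerProd (q : ℂ) : ℂ := ∏' n : ℕ, (1 - q ^ (n + 1))

theorem eulerProd_zero : eulerProd 0 = 1 := by simp [eulerProd]

theorem differentiableAt_eulerProd {q : ℂ} (hq : ‖q‖ < 1) : DifferentiableAt ℂ eulerProd q :=
  differentiableOn_tprod_one_sub_pow.differentiableAt
    (Metric.isOpen_ball.mem_nhds (by simpa using hq))

theorem tendsto_eulerProd : Tendsto eulerProd (𝓝 0) (𝓝 1) := by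
  have := (differentiableAt_eulerProd (q := 0) (by simp)).continuousAt.tendsto
  rwa [eulerProd_zero] at this

theorem eulerProd_eq_mul {q : ℂ} (hq : ‖q‖ < 1) :
    eulerProd q = eulerProd (q ^ 2) * ∏' n : ℕ, (1 - q ^ (2 * n + 1)) := by
  have h2 : ‖q ^ 2‖ < 1 := by rw [norm_pow]; exact pow_lt_one₀ (norm_nonneg _) hq (by norm_num)
  have hodd : Multipliable fun n : ℕ => 1 - q ^ (2 * n + 1) := by
    have := (summable_geometric_of_lt_one (norm_nonneg _) h2).mul_left ‖q‖
    have := multipliable_one_add_of_summable (f := fun n : ℕ => -q ^ (2 * n + 1))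
      (by simpa [pow_succ, pow_mul, mul_comm, mul_pow] using this)
    simpa [sub_eq_add_neg] using this
  have heven : Multipliable fun n : ℕ => 1 - q ^ (2 * n + 1 + 1) := by
    have := multipliable_one_sub_pow h2
    refine this.congr fun n => ?_
    rw [← pow_mul]; ring_nf
  have := tprod_even_mul_odd (f := fun n : ℕ => 1 - q ^ (n + 1)) hodd heven
  rw [eulerProd, ← this, mul_comm, eulerProd]
  congr 1
  refine tprod_congr fun n => ?_
  rw [← pow_mul]; ring_nf

/-- The odd-index factors of q and -q multiply to those of q², because (1 - x)(1 + x) = 1 - x². -/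
theorem eulerProd_mul_neg {q : ℂ} (hq : ‖q‖ < 1) :
    eulerProd q * eulerProd (-q) * eulerProd (q ^ 4) = eulerProd (q ^ 2) ^ 3 := by
  have h2 : ‖q ^ 2‖ < 1 := by rw [norm_pow]; exact pow_lt_one₀ (norm_nonneg _) hq (by norm_num)
  have hodd : ∀ p : ℂ, ‖p‖ < 1 → Multipliable fun n : ℕ => 1 - p ^ (2 * n + 1) := by
    intro p hp
    have h2 : ‖p ^ 2‖ < 1 := by rw [norm_pow]; exact pow_lt_one₀ (norm_nonneg _) hp (by norm_num)
    have := (summable_geometric_of_lt_one (norm_nonneg _) h2).mul_left ‖p‖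
    have := multipliable_one_add_of_summable (f := fun n : ℕ => -p ^ (2 * n + 1))
      (by simpa [pow_succ, pow_mul, mul_comm, mul_pow] using this)
    simpa [sub_eq_add_neg] using this
  have e1 := eulerProd_eq_mul hq
  have e2 := eulerProd_eq_mul (q := -q) (by simpa using hq)
  have e3 := eulerProd_eq_mul h2
  have e4 : (∏' n : ℕ, (1 - q ^ (2 * n + 1))) * (∏' n : ℕ, (1 - (-q) ^ (2 * n + 1))) =
      ∏' n : ℕ, (1 - (q ^ 2) ^ (2 * n + 1)) := by
    rw [← (hodd q hq).tprod_mul (hodd (-q) (by simpa using hq))]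
    refine tprod_congr fun n => ?_
    rw [Odd.neg_pow (by simp), ← pow_mul]
    ring
  rw [neg_sq] at e2
  rw [← pow_mul] at e3
  calc _ = eulerProd (q ^ 2) ^ 2 * (eulerProd (q ^ (2 * 2)) *
      ((∏' n : ℕ, (1 - q ^ (2 * n + 1))) * (∏' n : ℕ, (1 - (-q) ^ (2 * n + 1))))) := by
        rw [e1, e2]; ring
    _ = _ := by rw [e4, ← e3]; ring

theorem eta_eq (z : ℂ) :
    eta z = cexp (2 * Real.pi * I * z / 24) * eulerProd (cexp (2 * Real.pi * I * z)) := by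
  simp only [eta, eta_q_eq_pow, eulerProd, Function.Periodic.qParam]
  norm_num

/-- The primitive 24th root of unity `exp (2πi / 24)`. -/
noncomputable def zeta24 : ℂ := cexp (2 * Real.pi * I / 24)

theorem zeta24_ne_zero : zeta24 ≠ 0 := exp_ne_zero _

theorem zeta24_pow_twelve : zeta24 ^ 12 = -1 := by
  rw [zeta24, ← Complex.exp_nat_mul, ← Complex.exp_pi_mul_I]
  congr 1; push_cast; ring

theorem zeta24_pow_twentyfour : zeta24 ^ 24 = 1 := by
  rw [show 24 = 12 * 2 from rfl, pow_mul, zeta24_pow_twelve]; norm_num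

theorem eta_add_one (z : ℂ) : eta (z + 1) = zeta24 * eta z := by
  rw [eta_eq, eta_eq, zeta24, ← mul_assoc, ← Complex.exp_add]
  congr 2
  · ring
  · rw [mul_add, mul_one, Complex.exp_add, Complex.exp_two_pi_mul_I, mul_one]

theorem norm_exp_two_pi_I_lt_one' {z : ℂ} (hz : 0 < z.im) : ‖cexp (2 * Real.pi * I * z)‖ < 1 :=
  norm_exp_two_pi_I_lt_one ⟨z, hz⟩

theorem eta_half_mul {z : ℂ} (hz : 0 < z.im) :
    eta (z / 2) * eta ((z + 1) / 2) * eta (2 * z) = cexp (2 * Real.pi * I / 48) * eta z ^ 3 := by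
  set s := cexp (2 * Real.pi * I * (z / 2)) with hs
  have hs1 : ‖s‖ < 1 := norm_exp_two_pi_I_lt_one' (by simpa using hz)
  have e2 : cexp (2 * Real.pi * I * ((z + 1) / 2)) = -s := by
    rw [show 2 * Real.pi * I * ((z + 1) / 2) = 2 * Real.pi * I * (z / 2) + Real.pi * I by ring,
      Complex.exp_add, Complex.exp_pi_mul_I, mul_neg_one]
  have e3 : cexp (2 * Real.pi * I * (2 * z)) = s ^ 4 := by
    rw [hs, ← Complex.exp_nat_mul]; congr 1; push_cast; ring
  have e4 : cexp (2 * Real.pi * I * z) = s ^ 2 := by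
    rw [hs, ← Complex.exp_nat_mul]; congr 1; push_cast; ring
  rw [eta_eq (z / 2), eta_eq ((z + 1) / 2), eta_eq (2 * z), eta_eq z, e2, e3, e4, ← hs, mul_pow,
    ← eulerProd_mul_neg hs1]
  have : cexp (2 * Real.pi * I * (z / 2) / 24) * cexp (2 * Real.pi * I * ((z + 1) / 2) / 24) *
      cexp (2 * Real.pi * I * (2 * z) / 24) =
      cexp (2 * Real.pi * I / 48) * cexp (2 * Real.pi * I * z / 24) ^ 3 := by
    rw [← Complex.exp_nat_mul]; simp only [← Complex.exp_add]; congr 1; push_cast; ring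
  linear_combination (eulerProd s * eulerProd (-s) * eulerProd (s ^ 4)) * this

theorem im_neg_one_div_pos {z : ℂ} (hz : 0 < z.im) : 0 < (-1 / z).im := by
  have := UpperHalfPlane.im_inv_neg_coe_pos ⟨z, hz⟩
  rwa [show -1 / z = (-z)⁻¹ by rw [inv_neg, neg_div, one_div]]

theorem ne_zero_of_im_pos {z : ℂ} (hz : 0 < z.im) : z ≠ 0 := by rintro rfl; simp at hz

/-- Taking the fourth power removes the branch of the square root. -/
theorem eta_neg_one_div_pow_four {z : ℂ} (hz : 0 < z.im) :
    eta (-1 / z) ^ 4 = -z ^ 2 * eta z ^ 4 := by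
  have h : eta (-1 / z) = (sqrt I)⁻¹ * (sqrt z * eta z) := eta_comp_eq_csqrt_I_inv hz
  have h4 : ∀ w : ℂ, w ≠ 0 → sqrt w ^ 4 = w ^ 2 := by
    intro w hw
    rw [sqrt_eq_exp hw, ← exp_nat_mul, show ((4 : ℕ) : ℂ) * (log w / 2) = (2 : ℕ) * log w by
      push_cast; ring, exp_nat_mul, exp_log hw]
  rw [h, mul_pow, mul_pow, inv_pow, h4 _ I_ne_zero, h4 _ (ne_zero_of_im_pos hz), I_sq]
  norm_num

theorem eta_neg_one_div_pow_eight {z : ℂ} (hz : 0 < z.im) :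
    eta (-1 / z) ^ 8 = z ^ 4 * eta z ^ 8 := by
  rw [show 8 = 4 * 2 from rfl, pow_mul, eta_neg_one_div_pow_four hz]; ring

theorem differentiableAt_eta {z : ℂ} (hz : 0 < z.im) : DifferentiableAt ℂ eta z :=
  differentiableAt_eta_of_mem_upperHalfPlaneSet hz

theorem eta_ne_zero' {z : ℂ} (hz : 0 < z.im) : eta z ≠ 0 := eta_ne_zero hz

/-- The filter of neighbourhoods of `i∞` in `ℂ`. -/
def imInf : Filter ℂ := comap Complex.im atTop

theorem tendsto_mul_ofReal_imInf {c : ℝ} (hc : 0 < c) :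
    Tendsto (fun z : ℂ => (c : ℂ) * z) imInf imInf := by
  rw [imInf, tendsto_comap_iff]
  have : (Complex.im ∘ fun z : ℂ => (c : ℂ) * z) = fun z => c * z.im := by ext z; simp
  rw [this]
  exact tendsto_comap.const_mul_atTop hc

theorem tendsto_add_ofReal_imInf (c : ℝ) :
    Tendsto (fun z : ℂ => z + (c : ℂ)) imInf imInf := by
  rw [imInf, tendsto_comap_iff]
  have : (Complex.im ∘ fun z : ℂ => z + (c : ℂ)) = fun z => z.im := by ext z; simp
  rw [this]
  exact tendsto_comap

theorem tendsto_div_two_imInf : Tendsto (fun z : ℂ => z / 2) imInf imInf := by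
  have := tendsto_mul_ofReal_imInf (c := 1 / 2) (by norm_num)
  refine this.congr fun z => ?_
  push_cast; ring

theorem tendsto_two_mul_imInf : Tendsto (fun z : ℂ => 2 * z) imInf imInf := by
  exact_mod_cast tendsto_mul_ofReal_imInf (c := 2) (by norm_num)

theorem tendsto_add_one_imInf : Tendsto (fun z : ℂ => z + 1) imInf imInf := by
  exact_mod_cast tendsto_add_ofReal_imInf 1

theorem eventually_imInf_im_pos : ∀ᶠ z in imInf, 0 < z.im :=
  tendsto_comap.eventually (eventually_gt_atTop 0)

theorem tendsto_exp_imInf {c : ℝ} (hc : 0 < c) :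
    Tendsto (fun z : ℂ => cexp (2 * Real.pi * I * (c * z))) imInf (𝓝 0) := by
  rw [tendsto_zero_iff_norm_tendsto_zero]
  have : (fun z : ℂ => ‖cexp (2 * Real.pi * I * (c * z))‖) =
      (fun y => Real.exp (-(2 * Real.pi * c * y))) ∘ Complex.im := by
    ext z; simp [Complex.norm_exp]; ring
  rw [this]
  refine (Real.tendsto_exp_neg_atTop_nhds_zero.comp ?_).comp tendsto_comap
  exact tendsto_id.const_mul_atTop (by positivity)

theorem tendsto_eulerProd_exp :
    Tendsto (fun z : ℂ => eulerProd (cexp (2 * Real.pi * I * z))) imInf (𝓝 1) := by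
  have := tendsto_exp_imInf (c := 1) one_pos
  simp only [ofReal_one, one_mul] at this
  exact tendsto_eulerProd.comp this

end HypMod

/-! ### Vanishing in level one, and limits of derivatives at i∞ -/

namespace HypMod

open Filter ModularForm
open Complex hiding eta
open UpperHalfPlane hiding I

/-- A level one cusp form of weight less than twelve, given by its values, vanishes. -/
theorem eq_zero_of_levelOne {F : ℂ → ℂ} {k : ℕ} (hk : k < 12)
    (hd : ∀ z : ℂ, 0 < z.im → DifferentiableAt ℂ F z)
    (hS : ∀ z : ℂ, 0 < z.im → F (-1 / z) = z ^ k * F z)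
    (hT : ∀ z : ℂ, 0 < z.im → F (z + 1) = F z)
    (h0 : Tendsto F imInf (𝓝 0)) {z : ℂ} (hz : 0 < z.im) : F z = 0 := by
  set f : ℍ → ℂ := fun τ => F τ with hf
  have fS : f ∣[(k : ℤ)] ModularGroup.S = f := by
    ext τ
    rw [SL_slash_apply, UpperHalfPlane.modular_S_smul]
    have := hS τ τ.im_pos
    rw [show (-1 / (τ : ℂ)) = -(τ : ℂ)⁻¹ by rw [neg_div, one_div]] at this
    have hne : (τ : ℂ) ≠ 0 := τ.ne_zero
    simp only [hf, ModularGroup.denom_S]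
    rw [zpow_neg, zpow_natCast, coe_mk, inv_neg, this]
    field_simp
  have fT : f ∣[(k : ℤ)] ModularGroup.T = f := by
    ext τ
    rw [SL_slash_apply, UpperHalfPlane.modular_T_smul]
    have := hT τ τ.im_pos
    rw [ModularGroup.denom_apply]
    simp [hf, ModularGroup.coe_T, add_comm (1 : ℂ), this]
  have hz0 : UpperHalfPlane.IsZeroAtImInfty f := by
    refine h0.comp ?_
    rw [imInf, tendsto_comap_iff]
    exact tendsto_comap
  let g : CuspForm 𝒮ℒ (k : ℤ) :=
    { toFun := f
      slash_action_eq' := by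
        rintro A ⟨A, rfl⟩
        exact SlashInvariantForm.slash_action_generators_SL2Z fS fT A
      holo' := by
        rw [UpperHalfPlane.mdifferentiable_iff]
        refine .congr (fun z hz ↦ (hd z hz).differentiableWithinAt) fun z hz ↦ ?_
        simp [hf, ofComplex_apply_of_im_pos hz]
      zero_at_cusps' := by
        intro c hc
        rw [Subgroup.IsArithmetic.isCusp_iff_isCusp_SL2Z] at hc
        rw [OnePoint.isZeroAt_iff_forall_SL2Z hc]
        intro γ _
        rw [SlashInvariantForm.slash_action_generators_SL2Z fS fT]
        exact hz0 }
  have hg : g = 0 := rank_zero_iff_forall_zero.1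
    (CuspForm.rank_eq_zero_of_weight_lt_twelve (by exact_mod_cast hk)) g
  have : g ⟨z, hz⟩ = 0 := by rw [hg]; rfl
  exact this

/-- If `F` is holomorphic and converges at `i∞`, then its derivative tends to zero. -/
theorem tendsto_deriv_imInf {F : ℂ → ℂ} (hd : ∀ z : ℂ, 0 < z.im → DifferentiableAt ℂ F z)
    {c : ℂ} (hc : Tendsto F imInf (𝓝 c)) : Tendsto (deriv F) imInf (𝓝 0) := by
  rw [Metric.tendsto_nhds]
  intro ε hε
  have h := (Metric.tendsto_nhds.1 hc (ε / 2) (by positivity))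
  rw [imInf, eventually_comap, eventually_atTop] at h
  obtain ⟨M, hM⟩ := h
  rw [imInf, eventually_comap]
  -- The extra 1 keeps the closed unit disc about z inside the region where F is holomorphic and
  -- close to c, so that Cauchy's estimate on the unit circle applies.
  filter_upwards [eventually_gt_atTop (max M 0 + 1)] with y hy z hzy
  have him : ∀ w ∈ Metric.closedBall z 1, max M 0 < w.im := by
    intro w hw
    have h1 : |(w - z).im| ≤ 1 := (abs_im_le_norm _).trans (by simpa [dist_eq_norm] using hw)
    have := neg_le_of_abs_le h1
    simp only [sub_im] at this
    linarith
  have hd' : ∀ w ∈ Metric.closedBall z 1, DifferentiableAt ℂ (fun w => F w - c) w := fun w hw =>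
    (hd w ((le_max_right _ _).trans_lt (him w hw))).sub_const c
  have hdc : DiffContOnCl ℂ (fun w => F w - c) (Metric.ball z 1) := by
    apply DifferentiableOn.diffContOnCl
    rw [closure_ball z one_ne_zero]
    exact fun w hw => (hd' w hw).differentiableWithinAt
  have := Complex.norm_deriv_le_of_forall_mem_sphere_norm_le (C := ε / 2) one_pos hdc
    (fun w hw => by
      have := hM w.im ((le_max_left _ _).trans (him w (Metric.sphere_subset_closedBall hw)).le) w rfl
      rw [dist_eq_norm] at this
      exact this.le)
  rw [deriv_sub_const, div_one] at this
  rw [dist_zero_right]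
  linarith

/-! ### The Eisenstein series of weight two as the logarithmic derivative of `η` -/

/-- The weight two Eisenstein series `E₂`, as a function on `ℂ`. -/
noncomputable def eisTwo (z : ℂ) : ℂ := 12 / (Real.pi * I) * logDeriv eta z

theorem pi_I_ne_zero : (Real.pi * I : ℂ) ≠ 0 :=
  mul_ne_zero (ofReal_ne_zero.2 Real.pi_ne_zero) I_ne_zero

theorem deriv_eta_eq {z : ℂ} (hz : 0 < z.im) :
    deriv eta z = Real.pi * I / 12 * eisTwo z * eta z := by
  have := eta_ne_zero' hz
  rw [eisTwo, logDeriv_apply]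
  field_simp [pi_I_ne_zero]

theorem hasDerivAt_eta {z : ℂ} (hz : 0 < z.im) :
    HasDerivAt eta (Real.pi * I / 12 * eisTwo z * eta z) z :=
  deriv_eta_eq hz ▸ (differentiableAt_eta hz).hasDerivAt

theorem isOpen_im_pos : IsOpen {z : ℂ | 0 < z.im} := isOpen_lt continuous_const continuous_im

theorem eventually_im_pos {z : ℂ} (hz : 0 < z.im) : ∀ᶠ w in 𝓝 z, 0 < w.im :=
  isOpen_im_pos.mem_nhds hz

theorem differentiableAt_deriv_of_im_pos {F : ℂ → ℂ}
    (hF : ∀ z : ℂ, 0 < z.im → DifferentiableAt ℂ F z) {z : ℂ} (hz : 0 < z.im) :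
    DifferentiableAt ℂ (deriv F) z := by
  have : DifferentiableOn ℂ F {z : ℂ | 0 < z.im} := fun z hz => (hF z hz).differentiableWithinAt
  exact (this.deriv isOpen_im_pos).differentiableAt (isOpen_im_pos.mem_nhds hz)

theorem differentiableAt_eisTwo {z : ℂ} (hz : 0 < z.im) : DifferentiableAt ℂ eisTwo z := by
  have h := differentiableAt_deriv_of_im_pos (fun z hz => differentiableAt_eta hz) hz
  exact (h.div (differentiableAt_eta hz) (eta_ne_zero' hz)).const_mul _

theorem eisTwo_add_one (z : ℂ) (hz : 0 < z.im) : eisTwo (z + 1) = eisTwo z := by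
  have hz1 : 0 < (z + 1).im := by simpa
  have h1 : HasDerivAt (fun w => eta (w + 1)) (Real.pi * I / 12 * eisTwo (z + 1) * eta (z + 1)) z :=
    by simpa using (hasDerivAt_eta hz1).comp_add_const z 1
  have h2 : HasDerivAt (fun w => eta (w + 1)) (zeta24 * (Real.pi * I / 12 * eisTwo z * eta z)) z := by
    simp only [eta_add_one]
    exact (hasDerivAt_eta hz).const_mul _
  have := h1.unique h2
  rw [eta_add_one] at this
  have e : Real.pi * I / 12 * zeta24 * eta z ≠ 0 := mul_ne_zero (mul_ne_zero
    (div_ne_zero pi_I_ne_zero (by norm_num)) zeta24_ne_zero) (eta_ne_zero' hz)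
  apply mul_left_cancel₀ e
  linear_combination this

theorem hasDerivAt_neg_one_div {z : ℂ} (hz : 0 < z.im) :
    HasDerivAt (fun w : ℂ => -1 / w) (1 / z ^ 2) z := by
  have := (hasDerivAt_inv (ne_zero_of_im_pos hz)).const_mul (-1)
  simpa [div_eq_mul_inv] using this

/-- Differentiate the law for η⁴ and divide by it; the inhomogeneous term is the logarithmic
derivative of the automorphy factor z². -/
theorem eisTwo_neg_one_div {z : ℂ} (hz : 0 < z.im) :
    eisTwo (-1 / z) = z ^ 2 * eisTwo z + 6 * z / (Real.pi * I) := by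
  have h1 := ((hasDerivAt_eta (im_neg_one_div_pos hz)).comp z (hasDerivAt_neg_one_div hz)).pow 4
  have h2 := ((hasDerivAt_pow 2 z).neg).mul ((hasDerivAt_eta hz).pow 4)
  have h3 := h2.congr_of_eventuallyEq (f₁ := (eta ∘ fun w => -1 / w) ^ 4) (by
    filter_upwards [eventually_im_pos hz] with w hw
    simpa using eta_neg_one_div_pow_four hw)
  have h4 := h1.unique h3
  have h5 := eta_neg_one_div_pow_four hz
  have h6 := eta_ne_zero' hz
  have h7 := ne_zero_of_im_pos hz
  have e : z ^ 2 * eta z ^ 4 ≠ 0 := by positivity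
  simp only [Function.comp, Pi.pow_apply, Pi.neg_apply] at h4
  have h8 : 4 * eta (-1 / z) ^ 4 * (Real.pi * I / 12 * eisTwo (-1 / z)) / z ^ 2 =
    -(2 * z * eta z ^ 4 + z ^ 2 * (4 * eta z ^ 4 * (Real.pi * I / 12 * eisTwo z))) := by
    push_cast at h4
    linear_combination h4
  rw [h5] at h8
  have := pi_I_ne_zero
  field_simp at h8 ⊢
  linear_combination (-1/4 : ℂ) * h8

/-- The exponential prefactor of η contributes exactly 1 to the normalized logarithmic derivative,
and Euler's product contributes a term that tends to zero. -/
theorem tendsto_eisTwo : Tendsto eisTwo imInf (𝓝 1) := by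
  have hP := tendsto_eulerProd_exp
  set P : ℂ → ℂ := fun z : ℂ => eulerProd (cexp (2 * Real.pi * I * z)) with hPd
  have hdiff : ∀ z : ℂ, 0 < z.im → DifferentiableAt ℂ P z := fun z hz =>
    (differentiableAt_eulerProd (norm_exp_two_pi_I_lt_one' hz)).comp z
      (f := fun z : ℂ => cexp (2 * Real.pi * I * z)) (by fun_prop)
  have h := (((tendsto_deriv_imInf hdiff hP).div hP one_ne_zero).const_mul
    (12 / (Real.pi * I))).const_add 1
  simp only [zero_div, mul_zero, add_zero] at h
  refine h.congr' ?_
  filter_upwards [eventually_imInf_im_pos] with z hz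
  have h1 : HasDerivAt eta (cexp (2 * Real.pi * I * z / 24) * (2 * Real.pi * I / 24) * P z +
      cexp (2 * Real.pi * I * z / 24) * deriv P z) z := by
    have e : eta = fun z => cexp (2 * Real.pi * I * z / 24) * P z := by ext; exact eta_eq _
    rw [e]
    refine HasDerivAt.mul ?_ (hdiff z hz).hasDerivAt
    refine HasDerivAt.cexp ?_
    simpa using ((hasDerivAt_id z).const_mul (2 * Real.pi * I : ℂ)).div_const 24
  have hne : P z ≠ 0 := by
    have := eta_ne_zero' hz
    rw [eta_eq] at this
    exact right_ne_zero_of_mul this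
  have hexp := exp_ne_zero (2 * Real.pi * I * z / 24)
  have hpi := pi_I_ne_zero
  have e2 : eta z = cexp (2 * Real.pi * I * z / 24) * P z := eta_eq z
  rw [eisTwo, logDeriv_apply, h1.deriv, e2, Pi.div_apply]
  field_simp
  ring

end HypMod

namespace HypMod

open Filter ModularForm
open Complex hiding eta
open UpperHalfPlane hiding I

/-! ### Fourth powers of the theta constants -/

/-- `θ₄⁴` as an eta quotient. -/
noncomputable def thA (z : ℂ) : ℂ := eta (z / 2) ^ 8 / eta z ^ 4

/-- `θ₂⁴` as an eta quotient. -/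
noncomputable def thB (z : ℂ) : ℂ := 16 * eta (2 * z) ^ 8 / eta z ^ 4

/-- `θ₃⁴`, the translate of `θ₄⁴`. -/
noncomputable def thC (z : ℂ) : ℂ := thA (z + 1)

theorem im_div_two_pos {z : ℂ} (hz : 0 < z.im) : 0 < (z / 2).im := by simpa using hz

theorem im_two_mul_pos {z : ℂ} (hz : 0 < z.im) : 0 < (2 * z).im := by simpa using hz

theorem im_add_one_pos {z : ℂ} (hz : 0 < z.im) : 0 < (z + 1).im := by simpa using hz

theorem im_sub_one_pos {z : ℂ} (hz : 0 < z.im) : 0 < (z - 1).im := by simpa using hz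

theorem thA_mul_thB_mul_thC {z : ℂ} (hz : 0 < z.im) :
    thA z * thB z * thC z = 16 * eta z ^ 12 := by
  have h := congrArg (fun x => x ^ 8) (eta_half_mul hz)
  have e : cexp (2 * Real.pi * I / 48) ^ 8 = zeta24 ^ 4 := by
    rw [zeta24, ← Complex.exp_nat_mul, ← Complex.exp_nat_mul]
    congr 1; push_cast; ring
  simp only [mul_pow, e] at h
  have h0 := eta_ne_zero' hz
  have h1 := zeta24_ne_zero
  rw [thA, thB, thC, thA, eta_add_one]
  generalize eta (2 * z) = x at *
  generalize eta (z / 2) = y at *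
  generalize eta ((z + 1) / 2) = t at *
  field_simp
  linear_combination h

theorem thA_neg_one_div {z : ℂ} (hz : 0 < z.im) : thA (-1 / z) = -z ^ 2 * thB z := by
  have h0 := eta_ne_zero' hz
  have h1 := ne_zero_of_im_pos hz
  have e := eta_neg_one_div_pow_eight (im_two_mul_pos hz)
  rw [thA, thB, eta_neg_one_div_pow_four hz, show -1 / z / 2 = -1 / (2 * z) by field_simp, e]
  field_simp
  ring

theorem thB_neg_one_div {z : ℂ} (hz : 0 < z.im) : thB (-1 / z) = -z ^ 2 * thA z := by
  have h0 := eta_ne_zero' hz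
  have h1 := ne_zero_of_im_pos hz
  have e := eta_neg_one_div_pow_eight (im_div_two_pos hz)
  rw [thA, thB, eta_neg_one_div_pow_four hz, show 2 * (-1 / z) = -1 / (z / 2) by field_simp, e]
  field_simp
  ring

theorem thB_add_one (z : ℂ) : thB (z + 1) = -thB z := by
  rw [thB, thB, show 2 * (z + 1) = 2 * z + 1 + 1 by ring]
  simp only [eta_add_one, mul_pow]
  have h1 := zeta24_ne_zero
  rcases eq_or_ne (eta z) 0 with h | h
  · simp [h]
  · field_simp
    linear_combination eta (2 * z) ^ 8 * zeta24_pow_twelve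

theorem thA_add_two (z : ℂ) : thA (z + 2) = thA z := by
  rw [thA, thA, show z + 2 = z + 1 + 1 by ring, show (z + 1 + 1) / 2 = z / 2 + 1 by ring]
  simp only [eta_add_one, mul_pow]
  have h1 := zeta24_ne_zero
  rcases eq_or_ne (eta z) 0 with h | h
  · simp [h]
  · field_simp

theorem thC_add_one (z : ℂ) : thC (z + 1) = thA z := by
  rw [thC, show z + 1 + 1 = z + 2 by ring, thA_add_two]

theorem thA_sub_one (z : ℂ) : thA (z - 1) = thC z := by
  rw [thC, ← thA_add_two]; ring_nf

/-- The point `-1 / u` with `u = -1 - 1 / (z - 1)` is `-1 / z + 1`. -/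
theorem neg_one_div_add_one {z : ℂ} (hz : 0 < z.im) :
    -1 / z + 1 = -1 / (-1 / (z - 1) - 1) ∧ 0 < (-1 / (z - 1) - 1 : ℂ).im ∧
      (-1 / (z - 1) - 1 : ℂ) * (z - 1) = -z := by
  have h1 := ne_zero_of_im_pos hz
  have h2 := ne_zero_of_im_pos (im_sub_one_pos hz)
  have h3 : (-1 / (z - 1) - 1 : ℂ) * (z - 1) = -z := by field_simp; ring
  have h4 := im_sub_one_pos (im_neg_one_div_pos (im_sub_one_pos hz))
  refine ⟨?_, h4, h3⟩
  have h5 := ne_zero_of_im_pos h4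
  have h6 : -1 / (z - 1) - 1 = -z / (z - 1) := by rw [eq_div_iff h2, h3]
  rw [h6]
  field_simp
  ring

/-- Use TS = S T⁻¹ S T⁻¹ in PSL₂(ℤ), so that only the known laws for `thA` and `thB` under S and
unit translations are needed. -/
theorem thC_neg_one_div {z : ℂ} (hz : 0 < z.im) : thC (-1 / z) = -z ^ 2 * thC z := by
  obtain ⟨e1, e2, e3⟩ := neg_one_div_add_one hz
  rw [thC, e1, thA_neg_one_div e2]
  have := thB_add_one (-1 / (z - 1) - 1)
  rw [sub_add_cancel, thB_neg_one_div (im_sub_one_pos hz), thA_sub_one] at this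
  linear_combination -(-1 / (z - 1) - 1) ^ 2 * this -
    ((-1 / (z - 1) - 1 : ℂ) * (z - 1) - z) * thC z * e3

theorem thA_eq {z : ℂ} : thA z = eulerProd (cexp (2 * Real.pi * I * (z / 2))) ^ 8 /
    eulerProd (cexp (2 * Real.pi * I * z)) ^ 4 := by
  rw [thA, eta_eq, eta_eq, mul_pow, mul_pow, ← Complex.exp_nat_mul, ← Complex.exp_nat_mul,
    show ((8 : ℕ) : ℂ) * (2 * Real.pi * I * (z / 2) / 24) = (4 : ℕ) * (2 * Real.pi * I * z / 24) by
      push_cast; ring, mul_div_mul_left _ _ (exp_ne_zero _)]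

theorem thB_eq {z : ℂ} : thB z = 16 * cexp (Real.pi * I * z) *
    (eulerProd (cexp (2 * Real.pi * I * (2 * z))) ^ 8 /
    eulerProd (cexp (2 * Real.pi * I * z)) ^ 4) := by
  rw [thB, eta_eq, eta_eq, mul_pow, mul_pow, ← Complex.exp_nat_mul, ← Complex.exp_nat_mul,
    show ((8 : ℕ) : ℂ) * (2 * Real.pi * I * (2 * z) / 24) =
      Real.pi * I * z + (4 : ℕ) * (2 * Real.pi * I * z / 24) by
      push_cast; ring, Complex.exp_add]
  rw [show ∀ a b c d : ℂ, 16 * (a * b * c) / (b * d) = (b * (16 * a * c)) / (b * d) by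
    intros; ring, mul_div_mul_left _ _ (exp_ne_zero _)]
  ring

theorem tendsto_thA : Tendsto thA imInf (𝓝 1) := by
  have := ((tendsto_eulerProd_exp.comp tendsto_div_two_imInf).pow 8).div
    (tendsto_eulerProd_exp.pow 4) (by norm_num)
  rw [one_pow, one_pow, div_one] at this
  exact this.congr fun z => thA_eq.symm

theorem tendsto_thB : Tendsto thB imInf (𝓝 0) := by
  have h := ((tendsto_eulerProd_exp.comp tendsto_two_mul_imInf).pow 8).div
    (tendsto_eulerProd_exp.pow 4) (by norm_num)
  have h2 := ((tendsto_exp_imInf (c := 1 / 2) (by norm_num)).const_mul 16).mul h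
  simp only [mul_zero, zero_mul] at h2
  refine h2.congr fun z => ?_
  simp only [Function.comp, Pi.div_apply]
  rw [thB_eq]
  congr 3
  push_cast; ring

theorem tendsto_thC : Tendsto thC imInf (𝓝 1) := tendsto_thA.comp tendsto_add_one_imInf

theorem differentiableAt_thA {z : ℂ} (hz : 0 < z.im) : DifferentiableAt ℂ thA z := by
  have h1 := differentiableAt_eta (im_div_two_pos hz)
  have h2 : DifferentiableAt ℂ (fun z => eta (z / 2)) z := h1.comp z (f := fun z : ℂ => z / 2) (by fun_prop)
  exact (h2.pow 8).div ((differentiableAt_eta hz).pow 4) (pow_ne_zero _ (eta_ne_zero' hz))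

theorem differentiableAt_thB {z : ℂ} (hz : 0 < z.im) : DifferentiableAt ℂ thB z := by
  have h1 := differentiableAt_eta (im_two_mul_pos hz)
  have h2 : DifferentiableAt ℂ (fun z => eta (2 * z)) z := h1.comp z
    (f := fun z : ℂ => 2 * z) (by fun_prop)
  exact ((h2.pow 8).const_mul 16).div ((differentiableAt_eta hz).pow 4)
    (pow_ne_zero _ (eta_ne_zero' hz))

theorem differentiableAt_thC {z : ℂ} (hz : 0 < z.im) : DifferentiableAt ℂ thC z :=
  (differentiableAt_thA (im_add_one_pos hz)).comp z (f := fun z : ℂ => z + 1) (by fun_prop)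

/-- Jacobi's identity `θ₃⁴ = θ₄⁴ + θ₂⁴`. -/
theorem thC_eq_add {z : ℂ} (hz : 0 < z.im) : thC z = thA z + thB z := by
  -- The defect itself changes sign under both S and T; its square is a level one cusp form of
  -- weight 4.
  have := eq_zero_of_levelOne (F := fun z => (thC z - thA z - thB z) ^ 2) (k := 4) (by norm_num)
    (fun z hz => (((differentiableAt_thC hz).sub (differentiableAt_thA hz)).sub
      (differentiableAt_thB hz)).pow 2)
    (fun z hz => by
      rw [thA_neg_one_div hz, thB_neg_one_div hz, thC_neg_one_div hz]; ring)
    (fun z hz => by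
      rw [thC_add_one, thB_add_one, ← thC]; ring)
    (by simpa using ((tendsto_thC.sub tendsto_thA).sub tendsto_thB).pow 2) hz
  linear_combination pow_eq_zero_iff (two_ne_zero) |>.1 this

/-! ### Eisenstein series of weight two and theta constants -/

/-- The defects Y1, Y2 of the two identities and the translate Y3 of Y1 are permuted in weight 2 by
S (Y1 ↔ Y2) and T (Y1 ↔ Y3), and all vanish at i∞. Their elementary symmetric functions are level
one cusp forms of weights 2, 4 and 6, hence zero, and so are the defects. -/
theorem eisTwo_half_and_double {z : ℂ} (hz : 0 < z.im) :
    eisTwo (z / 2) = 2 * eisTwo z - thB z - thC z ∧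
      4 * eisTwo (2 * z) = 2 * eisTwo z + thA z + thC z := by
  set Y1 : ℂ → ℂ := fun z => 2 * eisTwo z - eisTwo (z / 2) - (thB z + thC z) with hY1
  set Y2 : ℂ → ℂ := fun z => 2 * eisTwo z - 4 * eisTwo (2 * z) + (thA z + thC z) with hY2
  set Y3 : ℂ → ℂ := fun z => Y1 (z + 1) with hY3
  have d1 : ∀ z : ℂ, 0 < z.im → DifferentiableAt ℂ Y1 z := fun z hz =>
    (((differentiableAt_eisTwo hz).const_mul 2).sub
      ((differentiableAt_eisTwo (im_div_two_pos hz)).comp z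
        (f := fun z : ℂ => z / 2) (by fun_prop))).sub
      ((differentiableAt_thB hz).add (differentiableAt_thC hz))
  have d2 : ∀ z : ℂ, 0 < z.im → DifferentiableAt ℂ Y2 z := fun z hz =>
    (((differentiableAt_eisTwo hz).const_mul 2).sub
      (((differentiableAt_eisTwo (im_two_mul_pos hz)).comp z
        (f := fun z : ℂ => 2 * z) (by fun_prop)).const_mul 4)).add
      ((differentiableAt_thA hz).add (differentiableAt_thC hz))
  have d3 : ∀ z : ℂ, 0 < z.im → DifferentiableAt ℂ Y3 z := fun z hz =>
    (d1 _ (im_add_one_pos hz)).comp z (f := fun z : ℂ => z + 1) (by fun_prop)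
  have s1 : ∀ z : ℂ, 0 < z.im → Y1 (-1 / z) = z ^ 2 * Y2 z := by
    intro z hz
    have h1 := ne_zero_of_im_pos hz
    have := pi_I_ne_zero
    simp only [hY1, hY2]
    rw [show -1 / z / 2 = -1 / (2 * z) by field_simp, eisTwo_neg_one_div hz,
      eisTwo_neg_one_div (im_two_mul_pos hz), thB_neg_one_div hz, thC_neg_one_div hz]
    ring
  have s2 : ∀ z : ℂ, 0 < z.im → Y2 (-1 / z) = z ^ 2 * Y1 z := by
    intro z hz
    have h1 := ne_zero_of_im_pos hz
    have := pi_I_ne_zero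
    simp only [hY1, hY2]
    rw [show 2 * (-1 / z) = -1 / (z / 2) by field_simp, eisTwo_neg_one_div hz,
      eisTwo_neg_one_div (im_div_two_pos hz), thA_neg_one_div hz, thC_neg_one_div hz]
    ring
  have t2 : ∀ z : ℂ, 0 < z.im → Y2 (z + 1) = Y2 z := by
    intro z hz
    have h2 := im_two_mul_pos hz
    simp only [hY2]
    rw [thC_add_one, ← thC, eisTwo_add_one z hz, show 2 * (z + 1) = 2 * z + 1 + 1 by ring,
      eisTwo_add_one _ (im_add_one_pos h2), eisTwo_add_one _ h2]
    ring
  have t1 : ∀ z : ℂ, 0 < z.im → Y1 (z + 1 + 1) = Y1 z := by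
    intro z hz
    simp only [hY1]
    rw [thC_add_one, ← thC, eisTwo_add_one _ (im_add_one_pos hz), eisTwo_add_one z hz,
      show (z + 1 + 1) / 2 = z / 2 + 1 by ring,
      eisTwo_add_one _ (im_div_two_pos hz), thB_add_one, thB_add_one]
    ring
  have s3 : ∀ z : ℂ, 0 < z.im → Y3 (-1 / z) = z ^ 2 * Y3 z := by
    intro z hz
    obtain ⟨e1, e2, e3⟩ := neg_one_div_add_one hz
    simp only [hY3]
    rw [e1, s1 _ e2]
    have h := t2 _ e2
    have h' := t1 _ (im_sub_one_pos hz)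
    rw [sub_add_cancel] at h h'
    rw [s2 _ (im_sub_one_pos hz)] at h
    rw [h', ← h]
    linear_combination ((-1 / (z - 1) - 1 : ℂ) * (z - 1) - z) * Y1 (z - 1) * e3
  have l1 : Tendsto Y1 imInf (𝓝 0) := by
    have := ((tendsto_eisTwo.const_mul 2).sub (tendsto_eisTwo.comp tendsto_div_two_imInf)).sub
      (tendsto_thB.add tendsto_thC)
    norm_num at this
    exact this
  have l2 : Tendsto Y2 imInf (𝓝 0) := by
    have := ((tendsto_eisTwo.const_mul 2).sub
      ((tendsto_eisTwo.comp tendsto_two_mul_imInf).const_mul 4)).add (tendsto_thA.add tendsto_thC)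
    norm_num at this
    exact this
  have l3 : Tendsto Y3 imInf (𝓝 0) := l1.comp tendsto_add_one_imInf
  have t3 : ∀ z, Y1 (z + 1) = Y3 z := fun _ => rfl
  have t4 : ∀ z : ℂ, 0 < z.im → Y3 (z + 1) = Y1 z := t1
  have E1 : Y1 z + Y2 z + Y3 z = 0 :=
    eq_zero_of_levelOne (F := fun z => Y1 z + Y2 z + Y3 z) (k := 2) (by norm_num)
      (fun z hz => ((d1 z hz).add (d2 z hz)).add (d3 z hz))
      (fun z hz => by rw [s1 z hz, s2 z hz, s3 z hz]; ring)
      (fun z hz => by rw [t3, t2 z hz, t4 z hz]; ring)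
      (by simpa using (l1.add l2).add l3) hz
  have E2 : Y1 z * Y2 z + Y2 z * Y3 z + Y3 z * Y1 z = 0 :=
    eq_zero_of_levelOne (F := fun z => Y1 z * Y2 z + Y2 z * Y3 z + Y3 z * Y1 z) (k := 4)
      (by norm_num)
      (fun z hz => (((d1 z hz).mul (d2 z hz)).add ((d2 z hz).mul (d3 z hz))).add
        ((d3 z hz).mul (d1 z hz)))
      (fun z hz => by rw [s1 z hz, s2 z hz, s3 z hz]; ring)
      (fun z hz => by rw [t3, t2 z hz, t4 z hz]; ring)
      (by simpa using ((l1.mul l2).add (l2.mul l3)).add (l3.mul l1)) hz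
  have E3 : Y1 z * Y2 z * Y3 z = 0 :=
    eq_zero_of_levelOne (F := fun z => Y1 z * Y2 z * Y3 z) (k := 6) (by norm_num)
      (fun z hz => ((d1 z hz).mul (d2 z hz)).mul (d3 z hz))
      (fun z hz => by rw [s1 z hz, s2 z hz, s3 z hz]; ring)
      (fun z hz => by rw [t3, t2 z hz, t4 z hz]; ring)
      (by simpa using (l1.mul l2).mul l3) hz
  -- Y1 is a root of the monic cubic with these symmetric functions as coefficients, and that cubic
  -- is now X³.
  have z1 : Y1 z = 0 := by
    rw [← pow_eq_zero_iff (n := 3) (by norm_num)]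
    linear_combination Y1 z ^ 2 * E1 - Y1 z * E2 + E3
  have z2 : Y2 z = 0 := by
    rw [← pow_eq_zero_iff (n := 3) (by norm_num)]
    linear_combination Y2 z ^ 2 * E1 - Y2 z * E2 + E3
  constructor
  · linear_combination -z1
  · linear_combination -z2

theorem deriv_eisTwo_neg_one_div {z : ℂ} (hz : 0 < z.im) :
    deriv eisTwo (-1 / z) =
      z ^ 4 * deriv eisTwo z + 2 * z ^ 3 * eisTwo z + 6 * z ^ 2 / (Real.pi * I) := by
  have h1 := (differentiableAt_eisTwo (im_neg_one_div_pos hz)).hasDerivAt.comp z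
    (hasDerivAt_neg_one_div hz)
  have h2 := ((hasDerivAt_pow 2 z).mul (differentiableAt_eisTwo hz).hasDerivAt).add
    (((hasDerivAt_id z).const_mul 6).div_const (Real.pi * I : ℂ))
  have h3 := h2.congr_of_eventuallyEq (f₁ := eisTwo ∘ fun w => -1 / w) (by
    filter_upwards [eventually_im_pos hz] with w hw
    simpa using eisTwo_neg_one_div hw)
  have h4 := h1.unique h3
  have h7 := ne_zero_of_im_pos hz
  have := pi_I_ne_zero
  field_simp at h4 ⊢
  push_cast at h4
  linear_combination h4

theorem deriv_eisTwo_add_one {z : ℂ} (hz : 0 < z.im) :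
    deriv eisTwo (z + 1) = deriv eisTwo z := by
  have h1 : HasDerivAt (fun w => eisTwo (w + 1)) (deriv eisTwo (z + 1)) z :=
    (differentiableAt_eisTwo (im_add_one_pos hz)).hasDerivAt.comp_add_const z 1
  have h2 := (differentiableAt_eisTwo hz).hasDerivAt.congr_of_eventuallyEq
    (f₁ := fun w => eisTwo (w + 1)) (by
    filter_upwards [eventually_im_pos hz] with w hw
    exact eisTwo_add_one w hw)
  exact h1.unique h2

/-- Ramanujan's differential equation for `E₂`, with `E₄` written in terms of theta constants. -/
theorem deriv_eisTwo {z : ℂ} (hz : 0 < z.im) :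
    deriv eisTwo z = Real.pi * I / 6 *
      (eisTwo z ^ 2 - (thA z ^ 2 + thA z * thB z + thB z ^ 2)) := by
  have hpi := pi_I_ne_zero
  -- The quasimodular terms of E₂² and of E₂' cancel in this combination, which leaves a weight 4
  -- form vanishing at i∞.
  have := eq_zero_of_levelOne (F := fun z => eisTwo z ^ 2 - 6 / (Real.pi * I) * deriv eisTwo z -
      (thA z ^ 2 + thA z * thB z + thB z ^ 2)) (k := 4) (by norm_num)
    (fun z hz => (((differentiableAt_eisTwo hz).pow 2).sub
      ((differentiableAt_deriv_of_im_pos (fun z hz => differentiableAt_eisTwo hz) hz).const_mul _)).sub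
      ((((differentiableAt_thA hz).pow 2).add
        ((differentiableAt_thA hz).mul (differentiableAt_thB hz))).add
        ((differentiableAt_thB hz).pow 2)))
    (fun z hz => by
      rw [thA_neg_one_div hz, thB_neg_one_div hz, eisTwo_neg_one_div hz,
        deriv_eisTwo_neg_one_div hz]; ring)
    (fun z hz => by
      rw [deriv_eisTwo_add_one hz, eisTwo_add_one z hz, thB_add_one, ← thC, thC_eq_add hz]; ring)
    (by
      have h1 := ((tendsto_thA.pow 2).add (tendsto_thA.mul tendsto_thB)).add (tendsto_thB.pow 2)
      have h2 := (tendsto_deriv_imInf (fun z hz => differentiableAt_eisTwo hz)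
        tendsto_eisTwo).const_mul (6 / (Real.pi * I) : ℂ)
      simpa using ((tendsto_eisTwo.pow 2).sub h2).sub h1) hz
  field_simp at this ⊢
  linear_combination -this

theorem hasDerivAt_eisTwo {z : ℂ} (hz : 0 < z.im) :
    HasDerivAt eisTwo (Real.pi * I / 6 *
      (eisTwo z ^ 2 - (thA z ^ 2 + thA z * thB z + thB z ^ 2))) z :=
  deriv_eisTwo hz ▸ (differentiableAt_eisTwo hz).hasDerivAt

theorem hasDerivAt_thA {z : ℂ} (hz : 0 < z.im) :
    HasDerivAt thA (Real.pi * I / 3 * thA z * (eisTwo z - thB z - thC z)) z := by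
  have h1 := (hasDerivAt_eta (im_div_two_pos hz)).comp z ((hasDerivAt_id z).div_const 2)
  have h2 := (h1.pow 8).div ((hasDerivAt_eta hz).pow 4) (pow_ne_zero _ (eta_ne_zero' hz))
  refine h2.congr_deriv ?_
  have h0 := eta_ne_zero' hz
  simp only [Function.comp, id, (eisTwo_half_and_double hz).1, thA, Pi.pow_apply]
  field_simp
  ring

theorem hasDerivAt_thB {z : ℂ} (hz : 0 < z.im) :
    HasDerivAt thB (Real.pi * I / 3 * thB z * (eisTwo z + thA z + thC z)) z := by
  have h1 := (hasDerivAt_eta (im_two_mul_pos hz)).comp z ((hasDerivAt_id z).const_mul 2)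
  have h2 := ((h1.pow 8).const_mul 16).div ((hasDerivAt_eta hz).pow 4)
    (pow_ne_zero _ (eta_ne_zero' hz))
  refine h2.congr_deriv ?_
  have h0 := eta_ne_zero' hz
  have h3 : eisTwo (2 * z) = (2 * eisTwo z + thA z + thC z) / 4 := by
    rw [← (eisTwo_half_and_double hz).2]; ring
  simp only [Function.comp, h3, thB, Pi.pow_apply]
  field_simp
  ring

end HypMod

namespace HypMod

open Filter ModularForm
open Complex hiding eta
open UpperHalfPlane hiding I

/-! ### Restriction to the imaginary axis -/

/-- `y ↦ η(iy)`, a positive real function. -/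
noncomputable def axEta (y : ℝ) : ℝ := (eta (I * y)).re

theorem im_I_mul_pos {y : ℝ} (hy : 0 < y) : 0 < (I * y : ℂ).im := by simpa using hy

theorem exists_eulerProd_ofReal {q : ℝ} (h0 : 0 ≤ q) (h1 : q < 1) :
    ∃ p : ℝ, 0 ≤ p ∧ eulerProd (q : ℂ) = p := by
  have hs : Summable fun n : ℕ => ‖-q ^ (n + 1)‖ := by
    simpa [abs_of_nonneg h0] using (summable_nat_add_iff 1).mpr (summable_geometric_of_lt_one h0 h1)
  have hm : Multipliable fun n : ℕ => 1 - q ^ (n + 1) := by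
    simpa [sub_eq_add_neg] using multipliable_one_add_of_summable hs
  refine ⟨∏' n : ℕ, (1 - q ^ (n + 1)), ?_, ?_⟩
  · refine ge_of_tendsto hm.hasProd (Eventually.of_forall fun s => Finset.prod_nonneg fun n _ => ?_)
    exact sub_nonneg.2 (pow_le_one₀ h0 h1.le)
  · have := hm.hasProd.map ofRealHom continuous_ofReal
    rw [eulerProd, show ((∏' n : ℕ, (1 - q ^ (n + 1)) : ℝ) : ℂ) = ofRealHom _ from rfl,
      ← this.tprod_eq]
    refine tprod_congr fun n => ?_
    simp

theorem eta_I_mul {y : ℝ} (hy : 0 < y) : eta (I * y) = axEta y ∧ 0 < axEta y := by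
  have e1 : cexp (2 * Real.pi * I * (I * y)) = (Real.exp (-(2 * Real.pi * y)) : ℝ) := by
    push_cast; congr 1; linear_combination (2 * Real.pi * y : ℂ) * I_mul_I
  have e2 : cexp (2 * Real.pi * I * (I * y) / 24) = (Real.exp (-(2 * Real.pi * y) / 24) : ℝ) := by
    push_cast; congr 1; linear_combination (2 * Real.pi * y / 24 : ℂ) * I_mul_I
  obtain ⟨p, hp, hpe⟩ := exists_eulerProd_ofReal (Real.exp_pos (-(2 * Real.pi * y))).le
    (Real.exp_lt_one_iff.2 (neg_lt_zero.2 (by have := Real.pi_pos; positivity)))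
  have e3 : eta (I * y) = ((Real.exp (-(2 * Real.pi * y) / 24) * p : ℝ) : ℂ) := by
    rw [eta_eq, e1, e2, hpe]; push_cast; rfl
  have e4 : axEta y = Real.exp (-(2 * Real.pi * y) / 24) * p := by rw [axEta, e3, ofReal_re]
  refine ⟨by rw [e4, e3], lt_of_le_of_ne (by rw [e4]; positivity) fun h => ?_⟩
  rw [← e4, ← h] at e3
  exact eta_ne_zero' (im_I_mul_pos hy) (by simpa using e3)

theorem axEta_pos {y : ℝ} (hy : 0 < y) : 0 < axEta y := (eta_I_mul hy).2

/-- The restriction of `θ₄⁴` to the imaginary axis. -/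
noncomputable def axA (y : ℝ) : ℝ := axEta (y / 2) ^ 8 / axEta y ^ 4

/-- The restriction of `θ₂⁴` to the imaginary axis. -/
noncomputable def axB (y : ℝ) : ℝ := 16 * axEta (2 * y) ^ 8 / axEta y ^ 4

/-- The restriction of `E₂` to the imaginary axis. -/
noncomputable def axE (y : ℝ) : ℝ := (eisTwo (I * y)).re

theorem axA_pos {y : ℝ} (hy : 0 < y) : 0 < axA y := by
  have := axEta_pos hy
  have := axEta_pos (half_pos hy)
  rw [axA]; positivity

theorem axB_pos {y : ℝ} (hy : 0 < y) : 0 < axB y := by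
  have := axEta_pos hy
  have := axEta_pos (mul_pos two_pos hy)
  rw [axB]; positivity

theorem thA_I_mul {y : ℝ} (hy : 0 < y) : thA (I * y) = axA y := by
  rw [thA, axA, show I * (y : ℂ) / 2 = I * ((y / 2 : ℝ) : ℂ) by push_cast; ring,
    (eta_I_mul (half_pos hy)).1, (eta_I_mul hy).1]
  push_cast; rfl

theorem thB_I_mul {y : ℝ} (hy : 0 < y) : thB (I * y) = axB y := by
  rw [thB, axB, show 2 * (I * (y : ℂ)) = I * ((2 * y : ℝ) : ℂ) by push_cast; ring,
    (eta_I_mul (mul_pos two_pos hy)).1, (eta_I_mul hy).1]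
  push_cast; rfl

theorem thC_I_mul {y : ℝ} (hy : 0 < y) : thC (I * y) = axA y + axB y := by
  rw [thC_eq_add (im_I_mul_pos hy), thA_I_mul hy, thB_I_mul hy]

theorem hasDerivAt_comp_I_mul {F : ℂ → ℂ} {D : ℂ} {y : ℝ} (hD : HasDerivAt F D (I * y)) :
    HasDerivAt (fun t : ℝ => F (I * t)) (I * D) y := by
  have h1 : HasDerivAt (fun t : ℝ => I * (t : ℂ)) I y := by
    simpa using (ofRealCLM.hasDerivAt (x := y)).const_mul I
  have := HasDerivAt.scomp (𝕜 := ℝ) (𝕜' := ℂ) y (h := fun t : ℝ => I * (t : ℂ)) hD h1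
  simpa [smul_eq_mul, Function.comp_def] using this

theorem hasDerivAt_re_im {f : ℝ → ℂ} {D : ℂ} {y : ℝ} (h : HasDerivAt f D y) :
    HasDerivAt (fun t => (f t).re) D.re y ∧ HasDerivAt (fun t => (f t).im) D.im y :=
  ⟨reCLM.hasFDerivAt.comp_hasDerivAt y h, imCLM.hasFDerivAt.comp_hasDerivAt y h⟩

/-- Since η is real along the axis, the imaginary part of its derivative there is zero, and that
derivative is a nonzero real multiple of E₂. -/
theorem eisTwo_I_mul {y : ℝ} (hy : 0 < y) : eisTwo (I * y) = axE y := by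
  have h := (hasDerivAt_re_im (hasDerivAt_comp_I_mul (hasDerivAt_eta (im_I_mul_pos hy)))).2
  have h0 : HasDerivAt (fun t : ℝ => (eta (I * t)).im) 0 y := by
    refine (hasDerivAt_const y (0 : ℝ)).congr_of_eventuallyEq ?_
    filter_upwards [eventually_gt_nhds hy] with t ht
    rw [(eta_I_mul ht).1, ofReal_im]
  have h1 := h.unique h0
  rw [(eta_I_mul hy).1, show I * (Real.pi * I / 12 * eisTwo (I * y) * axEta y) =
    ((-(Real.pi / 12 * axEta y) : ℝ) : ℂ) * eisTwo (I * y) by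
      push_cast; linear_combination (Real.pi * eisTwo (I * y) * axEta y / 12 : ℂ) * I_mul_I,
    im_ofReal_mul] at h1
  have h2 : -(Real.pi / 12 * axEta y) ≠ 0 := by
    have := axEta_pos hy; have := Real.pi_pos; exact neg_ne_zero.2 (by positivity)
  have h3 := (mul_eq_zero.1 h1).resolve_left h2
  rw [axE]
  apply Complex.ext <;> simp [h3]

/-- The derivative along the imaginary axis of a function that is real there. -/
theorem hasDerivAt_axis {F : ℂ → ℂ} {f : ℝ → ℝ} {D : ℂ} {d y : ℝ} (hy : 0 < y)
    (hf : ∀ t : ℝ, 0 < t → F (I * t) = f t) (hD : HasDerivAt F D (I * y)) (hd : I * D = d) :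
    HasDerivAt f d y := by
  have h := (hasDerivAt_re_im (hasDerivAt_comp_I_mul hD)).1
  rw [hd, ofReal_re] at h
  refine h.congr_of_eventuallyEq ?_
  filter_upwards [eventually_gt_nhds hy] with t ht
  rw [hf t ht, ofReal_re]

theorem hasDerivAt_axEta {y : ℝ} (hy : 0 < y) :
    HasDerivAt axEta (-(Real.pi / 12) * axE y * axEta y) y := by
  refine hasDerivAt_axis hy (fun t ht => (eta_I_mul ht).1) (hasDerivAt_eta (im_I_mul_pos hy)) ?_
  rw [eisTwo_I_mul hy, (eta_I_mul hy).1]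
  push_cast
  linear_combination (Real.pi * axE y * axEta y / 12 : ℂ) * I_mul_I

theorem hasDerivAt_axE {y : ℝ} (hy : 0 < y) :
    HasDerivAt axE (-(Real.pi / 6) * (axE y ^ 2 - (axA y ^ 2 + axA y * axB y + axB y ^ 2))) y := by
  refine hasDerivAt_axis hy (fun t ht => eisTwo_I_mul ht) (hasDerivAt_eisTwo (im_I_mul_pos hy)) ?_
  rw [eisTwo_I_mul hy, thA_I_mul hy, thB_I_mul hy]
  push_cast
  linear_combination (Real.pi / 6 * (axE y ^ 2 - (axA y ^ 2 + axA y * axB y + axB y ^ 2)) : ℂ) *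
    I_mul_I

theorem hasDerivAt_axA {y : ℝ} (hy : 0 < y) :
    HasDerivAt axA (-(Real.pi / 3) * axA y * (axE y - axA y - 2 * axB y)) y := by
  refine hasDerivAt_axis hy (fun t ht => thA_I_mul ht) (hasDerivAt_thA (im_I_mul_pos hy)) ?_
  rw [eisTwo_I_mul hy, thA_I_mul hy, thB_I_mul hy, thC_I_mul hy]
  push_cast
  linear_combination (Real.pi / 3 * axA y * (axE y - axA y - 2 * axB y) : ℂ) * I_mul_I

theorem hasDerivAt_axB {y : ℝ} (hy : 0 < y) :
    HasDerivAt axB (-(Real.pi / 3) * axB y * (axE y + 2 * axA y + axB y)) y := by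
  refine hasDerivAt_axis hy (fun t ht => thB_I_mul ht) (hasDerivAt_thB (im_I_mul_pos hy)) ?_
  rw [eisTwo_I_mul hy, thA_I_mul hy, thB_I_mul hy, thC_I_mul hy]
  push_cast
  linear_combination (Real.pi / 3 * axB y * (axE y + 2 * axA y + axB y) : ℂ) * I_mul_I

theorem tendsto_I_mul_imInf : Tendsto (fun y : ℝ => I * (y : ℂ)) atTop imInf := by
  rw [imInf, tendsto_comap_iff]
  refine tendsto_id.congr fun y => ?_
  simp

theorem tendsto_axis {F : ℂ → ℂ} {f : ℝ → ℝ} {l : ℝ} (hf : ∀ t : ℝ, 0 < t → F (I * t) = f t)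
    (h : Tendsto F imInf (𝓝 (l : ℂ))) : Tendsto f atTop (𝓝 l) := by
  have := (Complex.continuous_re.tendsto _).comp (h.comp tendsto_I_mul_imInf)
  rw [ofReal_re] at this
  refine this.congr' ?_
  filter_upwards [eventually_gt_atTop 0] with t ht
  simp [hf t ht]

theorem tendsto_axA : Tendsto axA atTop (𝓝 1) :=
  tendsto_axis (fun _ => thA_I_mul) (by simpa using tendsto_thA)

theorem tendsto_axB : Tendsto axB atTop (𝓝 0) :=
  tendsto_axis (fun _ => thB_I_mul) (by simpa using tendsto_thB)

theorem tendsto_axE : Tendsto axE atTop (𝓝 1) :=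
  tendsto_axis (fun _ => eisTwo_I_mul) (by simpa using tendsto_eisTwo)

theorem neg_one_div_I_mul {y : ℝ} (hy : 0 < y) : -1 / (I * y : ℂ) = I * ((y⁻¹ : ℝ) : ℂ) := by
  have : (y : ℂ) ≠ 0 := ofReal_ne_zero.2 hy.ne'
  have := I_ne_zero
  push_cast
  field_simp
  rw [I_sq]

theorem axA_inv {y : ℝ} (hy : 0 < y) : axA y⁻¹ = y ^ 2 * axB y := by
  have := thA_neg_one_div (im_I_mul_pos hy)
  rw [neg_one_div_I_mul hy, thA_I_mul (inv_pos.2 hy), thB_I_mul hy, mul_pow, I_sq] at this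
  exact_mod_cast (by rw [this]; ring : (axA y⁻¹ : ℂ) = y ^ 2 * axB y)

theorem axB_inv {y : ℝ} (hy : 0 < y) : axB y⁻¹ = y ^ 2 * axA y := by
  have := thB_neg_one_div (im_I_mul_pos hy)
  rw [neg_one_div_I_mul hy, thB_I_mul (inv_pos.2 hy), thA_I_mul hy, mul_pow, I_sq] at this
  exact_mod_cast (by rw [this]; ring : (axB y⁻¹ : ℂ) = y ^ 2 * axA y)

theorem axA_mul_axB_mul {y : ℝ} (hy : 0 < y) :
    axA y * axB y * (axA y + axB y) = 16 * axEta y ^ 12 := by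
  have := thA_mul_thB_mul_thC (im_I_mul_pos hy)
  rw [thA_I_mul hy, thB_I_mul hy, thC_I_mul hy, (eta_I_mul hy).1] at this
  exact_mod_cast this

/-- The elliptic modular function on the imaginary axis. -/
noncomputable def axLam (y : ℝ) : ℝ := axB y / (axA y + axB y)

theorem one_sub_axLam {y : ℝ} (hy : 0 < y) : 1 - axLam y = axA y / (axA y + axB y) := by
  have := axA_pos hy
  have := axB_pos hy
  rw [axLam]; field_simp; ring

theorem axLam_mem {y : ℝ} (hy : 0 < y) : axLam y ∈ Set.Ioo (0 : ℝ) 1 := by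
  have h1 := axA_pos hy
  have h2 := axB_pos hy
  refine ⟨by rw [axLam]; positivity, sub_pos.1 ?_⟩
  rw [one_sub_axLam hy]; positivity

/-- λ has weight zero, so E₂ cancels in its logarithmic derivative and only θ₄⁴ remains. This is the
Jacobian in all later substitutions. -/
theorem hasDerivAt_axLam {y : ℝ} (hy : 0 < y) :
    HasDerivAt axLam (-(Real.pi * axLam y * axA y)) y := by
  have h1 := axA_pos hy
  have h2 := axB_pos hy
  refine ((hasDerivAt_axB hy).div ((hasDerivAt_axA hy).add (hasDerivAt_axB hy))
    (add_pos h1 h2).ne').congr_deriv ?_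
  rw [axLam, Pi.add_apply]
  field_simp
  ring

theorem axLam_inv {y : ℝ} (hy : 0 < y) : axLam y⁻¹ = 1 - axLam y := by
  have h1 := axA_pos hy
  have h2 := axB_pos hy
  rw [one_sub_axLam hy, axLam, axA_inv hy, axB_inv hy]
  field_simp
  ring

theorem tendsto_axLam : Tendsto axLam atTop (𝓝 0) := by
  have := tendsto_axB.div (tendsto_axA.add tendsto_axB) (by norm_num)
  rwa [add_zero, zero_div] at this

theorem tendsto_axLam_zero : Tendsto axLam (𝓝[>] 0) (𝓝 1) := by
  have := (tendsto_axLam.comp tendsto_inv_nhdsGT_zero).const_sub 1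
  rw [sub_zero] at this
  refine this.congr' ?_
  filter_upwards [self_mem_nhdsWithin] with y hy
  have := axLam_inv hy
  simp [this]

theorem strictAntiOn_axLam : StrictAntiOn axLam (Set.Ioi 0) := by
  refine strictAntiOn_of_deriv_neg (convex_Ioi 0)
    (fun y hy => (hasDerivAt_axLam hy).continuousAt.continuousWithinAt) fun y hy => ?_
  rw [interior_Ioi] at hy
  rw [(hasDerivAt_axLam hy).deriv]
  have := axA_pos hy
  have := (axLam_mem hy).1
  have := Real.pi_pos
  exact neg_lt_zero.2 (by positivity)

theorem image_axLam : axLam '' Set.Ioi 0 = Set.Ioo 0 1 := by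
  apply Set.Subset.antisymm
  · rintro _ ⟨y, hy, rfl⟩
    exact axLam_mem hy
  · rintro t ⟨h0, h1⟩
    obtain ⟨u, hu, hu'⟩ := ((tendsto_axLam_zero.eventually (lt_mem_nhds h1)).and
      self_mem_nhdsWithin).exists
    obtain ⟨v, hv, hv'⟩ := ((tendsto_axLam.eventually (gt_mem_nhds h0)).and
      (eventually_gt_atTop 0)).exists
    have hc : ContinuousOn axLam (Set.Ioi 0) :=
      fun y hy => (hasDerivAt_axLam hy).continuousAt.continuousWithinAt
    exact isPreconnected_Ioi.intermediate_value hv' hu' hc ⟨hv.le, hu.le⟩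

open MeasureTheory in
/-- The substitution `x = λ(iy)`. -/
theorem integral_comp_axLam (f : ℝ → ℝ) (hf : IntegrableOn f (Set.Ioo 0 1)) :
    IntegrableOn (fun y => Real.pi * axLam y * axA y * f (axLam y)) (Set.Ioi 0) ∧
      ∫ y in Set.Ioi 0, Real.pi * axLam y * axA y * f (axLam y) = ∫ x in Set.Ioo 0 1, f x := by
  have hd : ∀ y ∈ Set.Ioi (0 : ℝ), HasDerivWithinAt axLam (-(Real.pi * axLam y * axA y))
    (Set.Ioi 0) y := fun y hy => (hasDerivAt_axLam hy).hasDerivWithinAt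
  have he : Set.EqOn (fun y => |-(Real.pi * axLam y * axA y)| • f (axLam y))
      (fun y => Real.pi * axLam y * axA y * f (axLam y)) (Set.Ioi 0) := by
    intro y hy
    have := axA_pos hy
    have := (axLam_mem hy).1
    have := Real.pi_pos
    simp only [abs_neg, smul_eq_mul]
    rw [abs_of_pos (by positivity)]
  constructor
  · rw [← image_axLam, integrableOn_image_iff_integrableOn_abs_deriv_smul measurableSet_Ioi hd
      strictAntiOn_axLam.injOn] at hf
    exact hf.congr_fun he measurableSet_Ioi
  · rw [← image_axLam, integral_image_eq_integral_abs_deriv_smul measurableSet_Ioi hd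
      strictAntiOn_axLam.injOn]
    exact (setIntegral_congr_fun measurableSet_Ioi he).symm

theorem eq_of_hasDerivAt_zero {f : ℝ → ℝ} {l : ℝ} (hd : ∀ y, 0 < y → HasDerivAt f 0 y)
    (hl : Tendsto f atTop (𝓝 l)) {y : ℝ} (hy : 0 < y) : f y = l := by
  have hc : ∀ z ∈ Set.Ioi (0 : ℝ), f z = f y := fun z hz =>
    isOpen_Ioi.is_const_of_deriv_eq_zero isPreconnected_Ioi
      (fun x hx => (hd x hx).differentiableAt.differentiableWithinAt)
      (fun x hx => (hd x hx).deriv) hz hy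
  refine tendsto_nhds_unique (tendsto_const_nhds.congr' ?_) hl
  filter_upwards [eventually_gt_atTop 0] with z hz using (hc z hz).symm

/-- `θ₃²` on the imaginary axis is `₂F₁(1/2, 1/2; 1; λ)`. -/
theorem sqrt_eq_ellipF {y : ℝ} (hy : 0 < y) :
    √(axA y + axB y) = ellipF (axLam y) := by
  set w : ℝ → ℝ := fun y => √(axA y + axB y) with hw
  -- p is the function for which w' = -π p w². Then (w, p) and (F∘λ, P∘λ) solve the same linear
  -- system, with coefficients -π w² and -π λ θ₄⁴/4.
  set p : ℝ → ℝ := fun y => (axE y + axB y - axA y) / (6 * w y) with hp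
  have wpos : ∀ y, 0 < y → 0 < w y := fun y hy => by
    have := axA_pos hy
    have := axB_pos hy
    exact Real.sqrt_pos.2 (by positivity)
  have wsq : ∀ y, 0 < y → w y ^ 2 = axA y + axB y := fun y hy => by
    have := axA_pos hy
    have := axB_pos hy
    exact Real.sq_sqrt (by positivity)
  have dw : ∀ y, 0 < y → HasDerivAt w (-Real.pi * p y * w y ^ 2) y := fun y hy => by
    have h1 := axA_pos hy
    have h2 := axB_pos hy
    refine (((hasDerivAt_axA hy).add (hasDerivAt_axB hy)).sqrt (add_pos h1 h2).ne').congr_deriv ?_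
    have h3 := wpos y hy
    have h4 := wsq y hy
    rw [Pi.add_apply]
    change _ / (2 * w y) = _
    simp only [hp]
    field_simp
    linear_combination (6 * (axE y + axB y - axA y) : ℝ) * h4
  have dp : ∀ y, 0 < y → HasDerivAt p (-(Real.pi / 4) * w y * axLam y * axA y) y := fun y hy => by
    have h1 := axA_pos hy
    have h2 := axB_pos hy
    have h3 := wpos y hy
    have h4 := wsq y hy
    refine ((((hasDerivAt_axE hy).add (hasDerivAt_axB hy)).sub (hasDerivAt_axA hy)).div
      ((dw y hy).const_mul 6) (by positivity)).congr_deriv ?_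
    have hb : axB y = w y ^ 2 - axA y := by rw [h4]; ring
    simp only [Pi.add_apply, Pi.sub_apply, hp, axLam, hb]
    field_simp
    ring
  have hlam : ∀ y, 0 < y → axA y = (1 - axLam y) * w y ^ 2 := fun y hy => by
    have h1 := axA_pos hy
    have h2 := axB_pos hy
    rw [wsq y hy, one_sub_axLam hy]
    field_simp
  have dF : ∀ y, 0 < y → HasDerivAt (fun y => ellipF (axLam y))
      (-Real.pi * ellipP (axLam y) * w y ^ 2) y := fun y hy => by
    obtain ⟨h0, h1⟩ := axLam_mem hy
    refine ((hasDerivAt_ellipF h0 h1).comp y (hasDerivAt_axLam hy)).congr_deriv ?_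
    rw [hlam y hy]
    have := sub_pos.2 h1
    field_simp
  have dP : ∀ y, 0 < y → HasDerivAt (fun y => ellipP (axLam y))
      (ellipF (axLam y) / 4 * (-(Real.pi * axLam y * axA y))) y := fun y hy => by
    obtain ⟨h0, h1⟩ := axLam_mem hy
    exact (hasDerivAt_ellipP (abs_lt.2 ⟨by linarith, h1⟩)).comp y (hasDerivAt_axLam hy)
  have lw : Tendsto w atTop (𝓝 1) := by
    have := (tendsto_axA.add tendsto_axB).sqrt
    simpa using this
  have lp : Tendsto p atTop (𝓝 0) := by
    have := ((tendsto_axE.add tendsto_axB).sub tendsto_axA).div (lw.const_mul 6) (by norm_num)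
    rwa [add_zero, sub_self, zero_div] at this
  have lF : Tendsto (fun y => ellipF (axLam y)) atTop (𝓝 1) := by
    have := continuousAt_ellipF_zero.tendsto.comp tendsto_axLam
    rwa [ellipF_zero] at this
  have lP : Tendsto (fun y => ellipP (axLam y)) atTop (𝓝 0) := by
    have := continuousAt_ellipP_zero.tendsto.comp tendsto_axLam
    rwa [ellipP_zero] at this
  -- The Wronskian of the two solutions is constant, and its limit at infinity is 1·0 - 0·1. It is
  -- the numerator of the derivative of w/F∘λ, up to a factor, so that quotient is constant as well,
  -- with limit 1.
  have hW : ∀ y, 0 < y → w y * ellipP (axLam y) - p y * ellipF (axLam y) = 0 := fun y hy => by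
    refine eq_of_hasDerivAt_zero (f := fun y => w y * ellipP (axLam y) - p y * ellipF (axLam y))
      (fun y hy => ?_) (by simpa using (lw.mul lP).sub (lp.mul lF)) hy
    refine (((dw y hy).mul (dP y hy)).sub ((dp y hy).mul (dF y hy))).congr_deriv ?_
    ring
  have hF : ∀ y, 0 < y → 0 < ellipF (axLam y) := fun y hy => by
    obtain ⟨h0, h1⟩ := axLam_mem hy
    exact one_pos.trans_le (one_le_ellipF h0.le h1)
  have := eq_of_hasDerivAt_zero (f := fun y => w y / ellipF (axLam y)) (fun y hy => by
    refine ((dw y hy).div (dF y hy) (hF y hy).ne').congr_deriv ?_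
    rw [div_eq_zero_iff]
    left
    linear_combination Real.pi * w y ^ 2 * hW y hy)
    (by have := lw.div lF one_ne_zero; rwa [div_one] at this) hy
  rwa [div_eq_one_iff_eq (hF y hy).ne'] at this

end HypMod

namespace HypMod

open Filter ModularForm MeasureTheory
open Complex hiding eta
open UpperHalfPlane hiding I
open ProbabilityTheory (beta)

/-! ### The eta quotients with integer exponents -/

theorem K1_eq {r s : ℚ} {a b c : ℤ} (ha : 16 * s - 8 * r - 16 = a) (hb : 8 * r + 8 * s - 12 = b)
    (hc : 24 * s - 32 = -c) (τ : ℍ) :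
    K1 r s τ = eta ((τ : ℂ) / 2) ^ a * eta (2 * (τ : ℂ)) ^ b * eta (τ : ℂ) ^ c := by
  rw [K1, ha, hb, hc, show ((-c : ℚ) : ℂ) = ((-c : ℤ) : ℂ) by push_cast; rfl]
  simp only [Rat.cast_intCast, cpow_intCast, zpow_neg, div_inv_eq_mul]

theorem K2_eq {r s : ℚ} {a b c : ℤ} (ha : 16 * s - 8 * r - 12 = a) (hb : 8 * s + 8 * r - 12 = b)
    (hc : 24 * s - 30 = -c) (τ : ℍ) :
    K2 r s τ = eta ((τ : ℂ) / 2) ^ a * eta (2 * (τ : ℂ)) ^ b * eta (τ : ℂ) ^ c := by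
  rw [K2, ha, hb, hc, show ((-c : ℚ) : ℂ) = ((-c : ℤ) : ℂ) by push_cast; rfl]
  simp only [Rat.cast_intCast, cpow_intCast, zpow_neg, div_inv_eq_mul]

/-- The weight two eta quotient `η(τ/2)^a η(τ)^(4-a)`. -/
noncomputable def etaQuot (a : ℤ) (τ : ℍ) : ℂ := eta ((τ : ℂ) / 2) ^ a * eta (τ : ℂ) ^ (4 - a)

theorem formK_eq (j : ℕ) : formK (j / 12) = etaQuot (j - 4) := by
  ext τ
  rw [formK, K1_eq (a := j - 4) (b := 0) (c := 4 - (j - 4)) (by push_cast; ring)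
    (by push_cast; ring) (by push_cast; ring), zpow_zero, mul_one, etaQuot]

theorem formE_eq (j : ℕ) : formE (j / 12) = etaQuot (j + 8) := by
  ext τ
  rw [formE, K1_eq (a := j + 8) (b := 0) (c := 4 - (j + 8)) (by push_cast; ring)
    (by push_cast; ring) (by push_cast; ring), zpow_zero, mul_one, etaQuot]

/-- `y ↦ η(iy/2) / η(iy)`. -/
noncomputable def axG (y : ℝ) : ℝ := axEta (y / 2) / axEta y

theorem axG_pos {y : ℝ} (hy : 0 < y) : 0 < axG y := div_pos (axEta_pos (half_pos hy)) (axEta_pos hy)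

/-- θ₄¹² = η(τ/2)²⁴/η(τ)¹², while η¹² = (θ₂θ₃θ₄)⁴/16. Both sides being positive on the axis, roots
can be taken, which expresses every power of G through λ. -/
theorem axG_pow {y : ℝ} (hy : 0 < y) : axG y ^ 24 = 16 * (1 - axLam y) ^ 2 / axLam y := by
  have h0 := axEta_pos hy
  have h1 := axA_pos hy
  have h2 := axB_pos hy
  have h3 := axEta_pos (half_pos hy)
  have e : axG y ^ 24 = axA y ^ 3 / axEta y ^ 12 := by
    rw [axG, axA]; field_simp
  have e1 : axEta y ^ 12 = axA y * axB y * (axA y + axB y) / 16 := by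
    rw [axA_mul_axB_mul hy]; ring
  rw [e, e1, one_sub_axLam hy, axLam]
  field_simp

theorem axG_zpow {y : ℝ} (hy : 0 < y) (n : ℤ) : axG y ^ n =
    4 ^ ((n : ℝ) / 12) * (1 - axLam y) ^ ((n : ℝ) / 12) * axLam y ^ (-((n : ℝ) / 24)) := by
  obtain ⟨h0, h1⟩ := axLam_mem hy
  have h2 : 0 < 1 - axLam y := sub_pos.2 h1
  have e : axG y ^ n = (axG y ^ 24) ^ ((n : ℝ) / 24) := by
    rw [← Real.rpow_natCast, ← Real.rpow_mul (axG_pos hy).le, ← Real.rpow_intCast]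
    congr 1; push_cast; ring
  rw [e, axG_pow hy, Real.div_rpow (by positivity) h0.le, Real.mul_rpow (by norm_num) (by positivity),
    Real.rpow_neg h0.le, show (16 : ℝ) = 4 ^ (2 : ℕ) by norm_num, ← Real.rpow_natCast (4 : ℝ),
    ← Real.rpow_natCast (1 - axLam y), ← Real.rpow_mul (by norm_num), ← Real.rpow_mul h2.le,
    div_eq_mul_inv]
  congr 3 <;> (push_cast; ring)

/-- Puts the integrand in the shape Jacobian times function of λ, ready for the substitution x = λ.
-/
theorem axA_mul_axG_zpow {y : ℝ} (hy : 0 < y) (n : ℤ) : axA y * axG y ^ n =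
    Real.pi * axLam y * axA y * (4 ^ ((n : ℝ) / 12) / Real.pi *
      (axLam y ^ (-((n : ℝ) / 24) - 1) * (1 - axLam y) ^ ((n : ℝ) / 12))) := by
  have h0 := (axLam_mem hy).1
  have := Real.pi_pos
  rw [axG_zpow hy, Real.rpow_sub_one h0.ne']
  field_simp

theorem onAxis_eq (f : ℍ → ℂ) {y : ℝ} (hy : 0 < y) : onAxis f y = f ⟨I * y, im_I_mul_pos hy⟩ := by
  rw [onAxis, ofComplex_apply_of_im_pos (im_I_mul_pos hy)]

theorem I_mul_div_two (y : ℝ) : I * (y : ℂ) / 2 = I * ((y / 2 : ℝ) : ℂ) := by push_cast; ring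

theorem two_mul_I_mul (y : ℝ) : 2 * (I * (y : ℂ)) = I * ((2 * y : ℝ) : ℂ) := by push_cast; ring

theorem onAxis_etaQuot (a : ℤ) {y : ℝ} (hy : 0 < y) :
    onAxis (etaQuot a) y = ((axA y * axG y ^ (a - 8) : ℝ) : ℂ) := by
  have h0 := axEta_pos hy
  have h1 := axEta_pos (half_pos hy)
  rw [onAxis_eq _ hy, etaQuot]
  simp only
  rw [I_mul_div_two, (eta_I_mul hy).1, (eta_I_mul (half_pos hy)).1, axA, axG]
  norm_cast
  rw [div_zpow, zpow_sub₀ h1.ne', zpow_sub₀ h0.ne', zpow_sub₀ h0.ne']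
  norm_cast
  field_simp

/-- `L`-values of functions that are pulled back from the `λ`-line. -/
theorem hasLValueOne_of_axLam {f : ℍ → ℂ} {φ : ℝ → ℝ} (hφ : IntegrableOn φ (Set.Ioo 0 1))
    (h : ∀ y : ℝ, 0 < y →
      onAxis f y = ((Real.pi * axLam y * axA y * φ (axLam y) : ℝ) : ℂ)) :
    HasLValueOne f ((2 * Real.pi * ∫ x in Set.Ioo 0 1, φ x : ℝ) : ℂ) := by
  obtain ⟨h1, h2⟩ := integral_comp_axLam φ hφ
  refine ⟨IntegrableOn.congr_fun (Integrable.ofReal h1) (fun y hy => (h y hy).symm)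
    measurableSet_Ioi, ?_⟩
  rw [setIntegral_congr_fun measurableSet_Ioi (fun y hy => by rw [h y hy] : Set.EqOn _
    (fun y => ((Real.pi * axLam y * axA y * φ (axLam y) : ℝ) : ℂ) * I) _), integral_mul_const,
    integral_complex_ofReal, h2]
  push_cast
  linear_combination (2 * Real.pi * ∫ x in Set.Ioo (0 : ℝ) 1, (φ x : ℝ) : ℂ) * I_mul_I

/-- K(r) restricts to θ₄⁴ G^(j-12), hence to a multiple of x^((1-r)/2 - 1) (1-x)^(r-1) dx. -/
theorem hasLValueOne_formK {j : ℕ} (hj : 1 ≤ j) (hj' : j ≤ 11) :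
    HasLValueOne (formK (j / 12))
      ((2 * 4 ^ ((j : ℝ) / 12 - 1) * beta ((1 - (j : ℝ) / 12) / 2) ((j : ℝ) / 12) : ℝ) : ℂ) := by
  have h1 : (1 : ℝ) ≤ j := by exact_mod_cast hj
  have h2 : (j : ℝ) ≤ 11 := by exact_mod_cast hj'
  obtain ⟨b1, b2⟩ := integrableOn_beta_and_integral (u := (1 - (j : ℝ) / 12) / 2)
    (v := (j : ℝ) / 12) (by linarith) (by linarith)
  have := hasLValueOne_of_axLam (f := formK (j / 12))
    (b1.const_mul (4 ^ ((j : ℝ) / 12 - 1) / Real.pi)) (fun y hy => by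
      rw [formK_eq, onAxis_etaQuot _ hy, axA_mul_axG_zpow hy]
      push_cast
      congr 3
      · congr 2; ring
      · congr 2; ring
      · ring_nf)
  rw [integral_const_mul, b2] at this
  convert this using 2
  have := Real.pi_pos
  field_simp

/-- The form is θ₄⁴ G^(j-12) times η(2τ)⁴/η(τ)² = √λ θ₃²/4. The factor √λ shifts the exponent of x
to -r/2, and θ₃² becomes F(x). -/
theorem hasLValueOne_K2_first {j : ℕ} (hj : 1 ≤ j) (hj' : j ≤ 11) :
    HasLValueOne (K2 (1 - j / 24) (1 + j / 24))
      ((4 ^ ((j : ℝ) / 12 - 1) / 2 * (beta (1 - (j : ℝ) / 12 / 2) ((j : ℝ) / 12) *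
        ∑' k, unitSummand ((j : ℝ) / 12) ((j : ℝ) / 12 / 2) k) : ℝ) : ℂ) := by
  have h1 : (1 : ℝ) ≤ j := by exact_mod_cast hj
  have h2 : (j : ℝ) ≤ 11 := by exact_mod_cast hj'
  obtain ⟨b1, b2⟩ := integral_beta_mul_ellipF (a := (j : ℝ) / 12) (c := (j : ℝ) / 12 / 2)
    (by linarith) (by linarith) (by linarith)
  have := hasLValueOne_of_axLam (f := K2 (1 - j / 24) (1 + j / 24))
    (b1.const_mul (4 ^ ((j : ℝ) / 12 - 1) / (4 * Real.pi))) (fun y hy => by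
      have p0 := axEta_pos hy
      have p1 := axEta_pos (half_pos hy)
      have p2 := axEta_pos (mul_pos two_pos hy)
      have p3 := (axLam_mem hy).1
      have hA := axA_pos hy
      have hB := axB_pos hy
      have hw : √(axLam y) * √(axA y + axB y) / 4 = axEta (2 * y) ^ 4 / axEta y ^ 2 := by
        rw [← Real.sqrt_mul p3.le, axLam, div_mul_cancel₀ _ (by positivity), axB,
          show 16 * axEta (2 * y) ^ 8 / axEta y ^ 4 = (4 * axEta (2 * y) ^ 4 / axEta y ^ 2) ^ 2 by
            field_simp; ring, Real.sqrt_sq (by positivity)]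
        field_simp
      have e1 : onAxis (K2 (1 - j / 24) (1 + j / 24)) y = ((axA y * axG y ^ ((j : ℤ) - 12) *
          (√(axLam y) * √(axA y + axB y) / 4) : ℝ) : ℂ) := by
        rw [onAxis_eq _ hy, K2_eq (a := j - 4) (b := 4) (c := 6 - j) (by push_cast; ring)
          (by push_cast; ring) (by push_cast; ring)]
        simp only
        rw [I_mul_div_two, two_mul_I_mul, (eta_I_mul hy).1, (eta_I_mul (half_pos hy)).1,
          (eta_I_mul (mul_pos two_pos hy)).1, hw, axA, axG]
        generalize (j : ℤ) = m
        norm_cast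
        rw [div_zpow, zpow_sub₀ p1.ne', zpow_sub₀ p1.ne', zpow_sub₀ p0.ne', zpow_sub₀ p0.ne']
        norm_cast
        field_simp
      rw [e1, axA_mul_axG_zpow hy, sqrt_eq_ellipF hy, Real.sqrt_eq_rpow]
      have e2 : axLam y ^ (-((((j : ℤ) - 12 : ℤ) : ℝ) / 24) - 1) * axLam y ^ (1 / 2 : ℝ) =
          axLam y ^ (-((j : ℝ) / 12 / 2)) := by
        rw [← Real.rpow_add p3]; congr 1; push_cast; ring
      have e3 : (((j : ℤ) - 12 : ℤ) : ℝ) / 12 = (j : ℝ) / 12 - 1 := by push_cast; ring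
      rw [← e2, e3]
      congr 1
      ring)
  rw [integral_const_mul, b2] at this
  convert this using 2
  have := Real.pi_pos
  field_simp
  ring

/-- Here the extra factor is η(τ)¹⁰/(η(τ/2)⁴ η(2τ)⁴) = θ₃² alone, so the exponent of x is -(1+r)/2.
-/
theorem hasLValueOne_K2_second {j : ℕ} (hj : 1 ≤ j) (hj' : j ≤ 11) :
    HasLValueOne (K2 ((12 - j) / 24) ((12 + j) / 24))
      ((2 * 4 ^ ((j : ℝ) / 12 - 1) * (beta (1 - (1 + (j : ℝ) / 12) / 2) ((j : ℝ) / 12) *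
        ∑' k, unitSummand ((j : ℝ) / 12) ((1 + (j : ℝ) / 12) / 2) k) : ℝ) : ℂ) := by
  have h1 : (1 : ℝ) ≤ j := by exact_mod_cast hj
  have h2 : (j : ℝ) ≤ 11 := by exact_mod_cast hj'
  obtain ⟨b1, b2⟩ := integral_beta_mul_ellipF (a := (j : ℝ) / 12) (c := (1 + (j : ℝ) / 12) / 2)
    (by linarith) (by linarith) (by linarith)
  have := hasLValueOne_of_axLam (f := K2 ((12 - j) / 24) ((12 + j) / 24))
    (b1.const_mul (4 ^ ((j : ℝ) / 12 - 1) / Real.pi)) (fun y hy => by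
      have p0 := axEta_pos hy
      have p1 := axEta_pos (half_pos hy)
      have p2 := axEta_pos (mul_pos two_pos hy)
      have p3 := (axLam_mem hy).1
      have hA := axA_pos hy
      have hB := axB_pos hy
      have hw : √(axA y + axB y) = axEta y ^ 10 / (axEta (y / 2) ^ 4 * axEta (2 * y) ^ 4) := by
        have e : axA y + axB y =
            (axEta y ^ 10 / (axEta (y / 2) ^ 4 * axEta (2 * y) ^ 4)) ^ 2 := by
          have := axA_mul_axB_mul hy
          apply mul_left_cancel₀ (mul_pos hA hB).ne'
          rw [this, axA, axB]
          generalize axEta (2 * y) = d at *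
          field_simp
        rw [e, Real.sqrt_sq (by positivity)]
      have e1 : onAxis (K2 ((12 - j) / 24) ((12 + j) / 24)) y =
          ((axA y * axG y ^ ((j : ℤ) - 12) * √(axA y + axB y) : ℝ) : ℂ) := by
        rw [onAxis_eq _ hy, K2_eq (a := j - 8) (b := -4) (c := 18 - j) (by push_cast; ring)
          (by push_cast; ring) (by push_cast; ring)]
        simp only
        rw [I_mul_div_two, two_mul_I_mul, (eta_I_mul hy).1, (eta_I_mul (half_pos hy)).1,
          (eta_I_mul (mul_pos two_pos hy)).1, hw, axA, axG]
        generalize (j : ℤ) = m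
        norm_cast
        rw [div_zpow, zpow_sub₀ p1.ne', zpow_sub₀ p1.ne', zpow_sub₀ p0.ne', zpow_sub₀ p0.ne',
          zpow_negSucc]
        norm_num
        field_simp
      rw [e1, axA_mul_axG_zpow hy, sqrt_eq_ellipF hy]
      have e2 : -((((j : ℤ) - 12 : ℤ) : ℝ) / 24) - 1 = -((1 + (j : ℝ) / 12) / 2) := by
        push_cast; ring
      have e3 : (((j : ℤ) - 12 : ℤ) : ℝ) / 12 = (j : ℝ) / 12 - 1 := by push_cast; ring
      rw [e2, e3]
      congr 1
      ring)
  rw [integral_const_mul, b2] at this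
  convert this using 2
  have := Real.pi_pos
  field_simp

/-! ### The regularized `L`-value -/

/-- The logarithmic derivative of G is proportional to E₂(τ) - E₂(τ/2)/2, which is a combination of
theta constants. This is the integration by parts behind the regularization: θ₄⁴ G^j is a total
derivative minus 2 θ₂⁴ G^j. -/
theorem hasDerivAt_axG_pow (j : ℕ) {y : ℝ} (hy : 0 < y) :
    HasDerivAt (fun y => axG y ^ j)
      (Real.pi * j / 24 * (axA y * axG y ^ j + 2 * (axB y * axG y ^ j))) y := by
  have h0 := axEta_pos hy
  have h1 := axEta_pos (half_pos hy)
  have e : axE (y / 2) = 2 * axE y - axA y - 2 * axB y := by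
    have := (eisTwo_half_and_double (im_I_mul_pos hy)).1
    rw [I_mul_div_two, eisTwo_I_mul (half_pos hy), eisTwo_I_mul hy, thB_I_mul hy,
      thC_I_mul hy] at this
    have h : ((axE (y / 2) : ℝ) : ℂ) = ((2 * axE y - axB y - (axA y + axB y) : ℝ) : ℂ) := by
      rw [this]; push_cast; ring
    rw [ofReal_inj.1 h]; ring
  have d1 : HasDerivAt (fun y => axEta (y / 2))
      (-(Real.pi / 12) * axE (y / 2) * axEta (y / 2) * (1 / 2)) y :=
    HasDerivAt.comp (h₂ := axEta) (h := fun y => y / 2) y (hasDerivAt_axEta (half_pos hy))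
      ((hasDerivAt_id y).div_const 2)
  rcases j with _ | j
  · simpa using hasDerivAt_const y (1 : ℝ)
  refine ((d1.div (hasDerivAt_axEta hy) h0.ne').pow (j + 1)).congr_deriv ?_
  rw [e]
  simp only [Pi.div_apply, Nat.add_sub_cancel, axG, pow_succ]
  field_simp
  ring

theorem tendsto_axG_zero : Tendsto axG (𝓝[>] 0) (𝓝 0) := by
  have h := ((tendsto_axLam_zero.const_sub 1).pow 2).const_mul 16 |>.div tendsto_axLam_zero one_ne_zero
  have h2 : Tendsto (fun y => axG y ^ 24) (𝓝[>] 0) (𝓝 0) := by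
    norm_num at h
    refine h.congr' ?_
    filter_upwards [self_mem_nhdsWithin] with y hy
    exact (axG_pow hy).symm
  have h3 := h2.rpow_const (p := 1 / 24) (Or.inr (by norm_num))
  rw [Real.zero_rpow (by norm_num)] at h3
  refine h3.congr' ?_
  filter_upwards [self_mem_nhdsWithin] with y hy
  rw [← Real.rpow_natCast, ← Real.rpow_mul (axG_pos hy).le]
  norm_num

/-- G^j = e^(πjT/24) (1 + O(e^(-πT))), because the quotient of Euler products is differentiable at q
= 0 with value 1. As j < 24 the error still tends to zero, so one exponential carries all the
growth. -/
theorem tendsto_axG_pow_sub_exp {j : ℕ} (hj' : j ≤ 11) :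
    Tendsto (fun T : ℝ => axG T ^ j - Real.exp (Real.pi * j / 24 * T)) atTop (𝓝 0) := by
  set ψ : ℂ → ℂ := fun q => (eulerProd q / eulerProd (q ^ 2)) ^ j with hψ
  have hd : DifferentiableAt ℂ ψ 0 := by
    have h1 := differentiableAt_eulerProd (q := 0) (by simp)
    have h2 : DifferentiableAt ℂ (fun q => eulerProd (q ^ 2)) 0 :=
      (differentiableAt_eulerProd (q := 0 ^ 2) (by simp)).comp 0 (f := fun q : ℂ => q ^ 2)
        (by fun_prop)
    exact (h1.div h2 (by simp [eulerProd_zero])).pow j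
  have hO := hd.isBigO_sub
  have h0 : ψ 0 = 1 := by simp [hψ, eulerProd_zero]
  simp only [h0, sub_zero] at hO
  have hpi := Real.pi_pos
  have ht : Tendsto (fun T : ℝ => ((Real.exp (-(Real.pi * T)) : ℝ) : ℂ)) atTop (𝓝 0) := by
    have : Tendsto (fun T : ℝ => Real.exp (-(Real.pi * T))) atTop (𝓝 0) :=
      Real.tendsto_exp_neg_atTop_nhds_zero.comp (tendsto_id.const_mul_atTop hpi)
    exact_mod_cast (Complex.continuous_ofReal.tendsto 0).comp this
  have hO2 := (Asymptotics.isBigO_refl (fun T : ℝ => ((Real.exp (Real.pi * j / 24 * T) : ℝ) : ℂ))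
    atTop).mul (hO.comp_tendsto ht)
  have hlim : Tendsto (fun T : ℝ => ((Real.exp (Real.pi * j / 24 * T) : ℝ) : ℂ) *
      ((Real.exp (-(Real.pi * T)) : ℝ) : ℂ)) atTop (𝓝 0) := by
    have hj2 : (j : ℝ) ≤ 11 := by exact_mod_cast hj'
    have : Tendsto (fun T : ℝ => Real.exp (-(Real.pi * (1 - j / 24) * T))) atTop (𝓝 0) :=
      Real.tendsto_exp_neg_atTop_nhds_zero.comp (tendsto_id.const_mul_atTop
        (mul_pos hpi (by linarith)))
    have := (Complex.continuous_ofReal.tendsto 0).comp this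
    rw [ofReal_zero] at this
    refine this.congr fun T => ?_
    simp only [Function.comp]
    rw [← ofReal_mul, ← Real.exp_add]
    congr 2; ring
  have := hO2.trans_tendsto hlim
  have h3 : Tendsto (fun T : ℝ => ((axG T ^ j - Real.exp (Real.pi * j / 24 * T) : ℝ) : ℂ)) atTop
      (𝓝 0) := by
    refine this.congr' ?_
    filter_upwards [eventually_gt_atTop 0] with T hT
    have e1 : cexp (2 * Real.pi * I * (I * ((T / 2 : ℝ) : ℂ))) = (Real.exp (-(Real.pi * T)) : ℝ) := by
      push_cast; congr 1; linear_combination (Real.pi * T : ℂ) * I_mul_I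
    have e2 : cexp (2 * Real.pi * I * (I * T)) = ((Real.exp (-(Real.pi * T)) : ℝ) : ℂ) ^ 2 := by
      rw [← e1, ← Complex.exp_nat_mul]; congr 1; push_cast; ring
    have e3 : (axG T : ℂ) = cexp (Real.pi / 24 * T) *
        (eulerProd (Real.exp (-(Real.pi * T)) : ℝ) /
          eulerProd (((Real.exp (-(Real.pi * T)) : ℝ) : ℂ) ^ 2)) := by
      rw [axG, ofReal_div, ← (eta_I_mul (half_pos hT)).1, ← (eta_I_mul hT).1, eta_eq, eta_eq, e1, e2,
        mul_div_mul_comm, ← Complex.exp_sub]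
      congr 2
      push_cast
      linear_combination (-(Real.pi * T / 24) : ℂ) * I_mul_I
    push_cast
    rw [e3, mul_pow, ← Complex.exp_nat_mul]
    simp only [hψ, Function.comp]
    push_cast
    rw [show (j : ℂ) * (Real.pi / 24 * T) = Real.pi * j / 24 * T by ring]
    ring
  have := (Complex.continuous_re.tendsto _).comp h3
  simpa [Function.comp_def, -ofReal_sub, -ofReal_pow, -ofReal_exp] using this

/-- On the λ-line the function blows up only at x = 0, that is at i∞. Restricting to y ≤ T means x ≥
λ(T), so an indicator cuts the singularity off. -/
theorem integrableOn_axA_mul_axG_pow (j : ℕ) {T : ℝ} (hT : 0 < T) :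
    IntegrableOn (fun y => axA y * axG y ^ j) (Set.Ioc 0 T) := by
  set φ : ℝ → ℝ := fun x => 4 ^ ((j : ℝ) / 12) / Real.pi *
      (x ^ (-((j : ℝ) / 24) - 1) * (1 - x) ^ ((j : ℝ) / 12)) with hφ
  obtain ⟨h0, h1⟩ := axLam_mem hT
  have hc : ContinuousOn φ (Set.Icc (axLam T) 1) := by
    refine ContinuousOn.mul continuousOn_const (ContinuousOn.mul ?_ ?_)
    · exact continuousOn_id.rpow_const fun x hx => Or.inl (h0.trans_le hx.1).ne'
    · exact (continuousOn_const.sub continuousOn_id).rpow_const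
        fun x hx => Or.inr (by positivity)
  have hi : IntegrableOn ((Set.Icc (axLam T) 1).indicator φ) (Set.Ioo 0 1) :=
    ((hc.integrableOn_Icc).integrable_indicator measurableSet_Icc).integrableOn
  refine ((integral_comp_axLam _ hi).1.mono_set Set.Ioc_subset_Ioi_self).congr_fun
    (fun y hy => ?_) measurableSet_Ioc
  have hm : axLam y ∈ Set.Icc (axLam T) 1 :=
    ⟨strictAntiOn_axLam.antitoneOn hy.1 hT hy.2, (axLam_mem hy.1).2.le⟩
  have := axA_mul_axG_zpow hy.1 j
  simp only [Set.indicator_of_mem hm, zpow_natCast, Int.cast_natCast] at this ⊢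
  exact this.symm

/-- θ₂⁴ = λ θ₄⁴/(1-λ): relative to θ₄⁴ G^j this raises the exponent of x by one and so removes the
pole at i∞. -/
theorem integrableOn_axB_mul_axG_pow {j : ℕ} (hj : 1 ≤ j) (hj' : j ≤ 11) :
    IntegrableOn (fun y => axB y * axG y ^ j) (Set.Ioi 0) ∧
      ∫ y in Set.Ioi (0 : ℝ), axB y * axG y ^ j =
        4 ^ ((j : ℝ) / 12) / Real.pi * beta (1 - (j : ℝ) / 12 / 2) ((j : ℝ) / 12) := by
  have h1 : (1 : ℝ) ≤ j := by exact_mod_cast hj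
  have h2 : (j : ℝ) ≤ 11 := by exact_mod_cast hj'
  obtain ⟨b1, b2⟩ := integrableOn_beta_and_integral (u := 1 - (j : ℝ) / 12 / 2)
    (v := (j : ℝ) / 12) (by linarith) (by linarith)
  obtain ⟨c1, c2⟩ := integral_comp_axLam _ (b1.const_mul (4 ^ ((j : ℝ) / 12) / Real.pi))
  have he : Set.EqOn (fun y => Real.pi * axLam y * axA y * (4 ^ ((j : ℝ) / 12) / Real.pi *
      (axLam y ^ (1 - (j : ℝ) / 12 / 2 - 1) * (1 - axLam y) ^ ((j : ℝ) / 12 - 1))))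
      (fun y => axB y * axG y ^ j) (Set.Ioi 0) := by
    intro y hy
    have hA := axA_pos hy
    have hB := axB_pos hy
    have hm := sub_pos.2 (axLam_mem hy).2
    have hb : axB y = axLam y * axA y / (1 - axLam y) := by
      rw [one_sub_axLam hy, axLam]; field_simp
    have hg := axG_zpow hy j
    rw [zpow_natCast, Int.cast_natCast] at hg
    have hpi := Real.pi_pos
    simp only
    rw [hg, hb, Real.rpow_sub_one hm.ne', show 1 - (j : ℝ) / 12 / 2 - 1 = -((j : ℝ) / 24) by ring]
    field_simp
  rw [setIntegral_congr_fun measurableSet_Ioi he, integral_const_mul, b2] at c2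
  exact ⟨c1.congr_fun he measurableSet_Ioi, c2⟩

/-- On [0,T] the integral of θ₄⁴ G^j is 24/(πj) G(T)^j minus twice the integral of θ₂⁴ G^j; the
boundary term at 0 vanishes. Once the exponential is removed only the Beta integral remains. -/
theorem hasRegularizedLValueOne_formE {j : ℕ} (hj : 1 ≤ j) (hj' : j ≤ 11) :
    HasRegularizedLValueOne (formE (j / 12))
      ((-4 * 4 ^ ((j : ℝ) / 12) * beta (1 - (j : ℝ) / 12 / 2) ((j : ℝ) / 12) : ℝ) : ℂ) := by
  have hE : ∀ y : ℝ, 0 < y → onAxis (formE (j / 12)) y = ((axA y * axG y ^ j : ℝ) : ℂ) := by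
    intro y hy
    rw [formE_eq, onAxis_etaQuot _ hy, add_sub_cancel_right, zpow_natCast]
  have hjr : (0 : ℝ) < j := by exact_mod_cast hj
  have hpi := Real.pi_pos
  obtain ⟨b1, b2⟩ := integrableOn_axB_mul_axG_pow hj hj'
  -- The removed term is (48/j) e^(πjT/24), with 48/j = 2π · 24/(πj) and 2π = (-2πi) · i.
  refine ⟨fun T hT => IntegrableOn.congr_fun (Integrable.ofReal (integrableOn_axA_mul_axG_pow j hT))
    (fun y hy => (hE y hy.1).symm) measurableSet_Ioc, {Real.pi * j / 24}, fun _ => 48 / j,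
    fun a ha => by rw [Finset.mem_singleton.1 ha]; positivity, ?_⟩
  have hint : ∀ T : ℝ, 0 < T → ∫ y in Set.Ioc 0 T, axA y * axG y ^ j =
      24 / (Real.pi * j) * axG T ^ j - 2 * ∫ y in Set.Ioc 0 T, axB y * axG y ^ j := by
    intro T hT
    have i1 := integrableOn_axA_mul_axG_pow j hT
    have i2 := b1.mono_set (Set.Ioc_subset_Ioi_self : Set.Ioc 0 T ⊆ _)
    have i3 : IntervalIntegrable (fun y => Real.pi * j / 24 *
        (axA y * axG y ^ j + 2 * (axB y * axG y ^ j))) volume 0 T :=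
      (intervalIntegrable_iff_integrableOn_Ioc_of_le hT.le).2 ((i1.add (i2.const_mul 2)).const_mul _)
    have h0 := tendsto_axG_zero.pow j
    rw [zero_pow (by omega)] at h0
    have := intervalIntegral.integral_eq_sub_of_hasDerivAt_of_tendsto hT
      (fun y hy => hasDerivAt_axG_pow j hy.1) i3 h0
      ((hasDerivAt_axG_pow j hT).continuousAt.tendsto.mono_left nhdsWithin_le_nhds)
    rw [intervalIntegral.integral_of_le hT.le, integral_const_mul,
      integral_add i1 (i2.const_mul 2), integral_const_mul, sub_zero] at this
    field_simp
    linarith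
  have hlim : Tendsto (fun T : ℝ => 48 / (j : ℝ) * (axG T ^ j - Real.exp (Real.pi * j / 24 * T)) -
      4 * Real.pi * ∫ y in Set.Ioc 0 T, axB y * axG y ^ j) atTop
      (𝓝 (-4 * 4 ^ ((j : ℝ) / 12) * beta (1 - (j : ℝ) / 12 / 2) ((j : ℝ) / 12))) := by
    have h1 := intervalIntegral_tendsto_integral_Ioi (0 : ℝ) b1 tendsto_id
    rw [b2] at h1
    have h2 := ((tendsto_axG_pow_sub_exp hj').const_mul (48 / (j : ℝ))).sub
      (h1.const_mul (4 * Real.pi))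
    convert! h2.congr' ?_ using 2
    · field_simp
      ring
    · filter_upwards [eventually_ge_atTop 0] with T hT
      simp [intervalIntegral.integral_of_le hT]
  refine ((Complex.continuous_ofReal.tendsto _).comp hlim).congr' ?_
  filter_upwards [eventually_gt_atTop 0] with T hT
  rw [setIntegral_congr_fun measurableSet_Ioc (fun y hy => by rw [hE y hy.1] : Set.EqOn _
    (fun y => ((axA y * axG y ^ j : ℝ) : ℂ) * I) _), integral_mul_const, integral_complex_ofReal, hint T hT]
  simp only [Function.comp, Finset.sum_singleton]
  have hjc : (j : ℂ) ≠ 0 := by exact_mod_cast hjr.ne'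
  have hpc : (Real.pi : ℂ) ≠ 0 := by exact_mod_cast hpi.ne'
  push_cast
  field_simp
  linear_combination (48 * (axG T : ℂ) ^ j -
    4 * j * Real.pi * ((∫ y in Set.Ioc 0 T, axB y * axG y ^ j : ℝ) : ℂ)) * I_sq

end HypMod

/-! ### The product of Beta values and the three identities -/

namespace HypMod

open ProbabilityTheory (beta)

/-- Duplication at (1-r)/2 collapses the numerators, duplication at (1+r)/2 the denominators, and
reflection turns Γ(r)Γ(1-r) into π/sin(πr). -/
theorem beta_mul_beta {r : ℝ} (h0 : 0 < r) (h1 : r < 1) :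
    beta ((1 - r) / 2) r * beta (1 - r / 2) r =
      4 ^ r * (Real.pi / Real.sin (Real.pi * r)) * (Real.Gamma r / Real.Gamma (1 + r)) := by
  have d1 := Real.Gamma_mul_Gamma_add_half ((1 - r) / 2)
  have d2 := Real.Gamma_mul_Gamma_add_half ((1 + r) / 2)
  have rf := Real.Gamma_mul_Gamma_one_sub r
  rw [show (1 - r) / 2 + 1 / 2 = 1 - r / 2 by ring, show 2 * ((1 - r) / 2) = 1 - r by ring,
    show 1 - (1 - r) = r by ring] at d1
  rw [show (1 + r) / 2 + 1 / 2 = 1 + r / 2 by ring, show 2 * ((1 + r) / 2) = 1 + r by ring,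
    show 1 - (1 + r) = -r by ring, Real.rpow_neg (by norm_num)] at d2
  have g1 := Real.Gamma_pos_of_pos (show 0 < (1 + r) / 2 by linarith)
  have g2 := Real.Gamma_pos_of_pos (show 0 < 1 + r / 2 by linarith)
  have g3 := Real.Gamma_pos_of_pos (show 0 < 1 + r by linarith)
  have hp := Real.sqrt_pos.2 Real.pi_pos
  have h2 : (0 : ℝ) < 2 ^ r := by positivity
  have h4 : (4 : ℝ) ^ r = 2 ^ r * 2 ^ r := by
    rw [← Real.mul_rpow (by norm_num) (by norm_num)]; norm_num
  rw [← rf, h4, beta, beta, show (1 - r) / 2 + r = (1 + r) / 2 by ring,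
    show 1 - r / 2 + r = 1 + r / 2 by ring, div_mul_div_comm, d2,
    show ∀ a b c : ℝ, a * c * (b * c) = a * b * c ^ 2 by intros; ring, d1]
  field_simp

theorem Gamma_one_add_div {r : ℝ} (h0 : 0 < r) : Real.Gamma r / Real.Gamma (1 + r) = 1 / r := by
  rw [add_comm, Real.Gamma_add_one h0.ne']
  have := Real.Gamma_pos_of_pos h0
  field_simp

/-- The squares of Γ(r + 1/2) cancel, leaving the Beta product up to the factor 4^r. -/
theorem Omega_mul_whippleFactor {j : ℕ} (hj : 1 ≤ j) :
    Omega j * whippleFactor ((j : ℝ) / 12) = Real.pi / Real.sin (Real.pi * ((j : ℝ) / 12)) *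
      (Real.Gamma ((j : ℝ) / 12) / Real.Gamma (1 + (j : ℝ) / 12)) := by
  have h0 : (0 : ℝ) < (j : ℝ) / 12 := by
    have : (0 : ℝ) < j := by exact_mod_cast hj
    positivity
  have g1 := Real.Gamma_pos_of_pos h0
  have g2 := Real.Gamma_pos_of_pos (show 0 < (j : ℝ) / 12 + 1 / 2 by linarith)
  have g3 := Real.Gamma_pos_of_pos (show 0 < 1 + (j : ℝ) / 12 by linarith)
  rw [Omega, whippleFactor, add_comm (1 / 2 : ℝ), show (j : ℝ) * Real.pi / 12 =
    Real.pi * ((j : ℝ) / 12) by ring]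
  generalize Real.Gamma ((j : ℝ) / 12 + 1 / 2) = x at *
  generalize Real.Gamma (1 + (j : ℝ) / 12) = y at *
  generalize Real.Gamma ((j : ℝ) / 12) = z at *
  generalize Real.sin (Real.pi * ((j : ℝ) / 12)) = s
  field_simp

theorem two_rpow_half (j : ℕ) : (2 : ℝ) ^ ((j : ℝ) / 2) = (4 ^ ((j : ℝ) / 12)) ^ 3 := by
  rw [← Real.rpow_natCast, ← Real.rpow_mul (by norm_num), show (4 : ℝ) = 2 ^ (2 : ℝ) by norm_num,
    ← Real.rpow_mul (by norm_num)]
  congr 1; push_cast; ring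

/-- The values of the two series and of the four `L`-values, and the relations between them. -/
theorem exists_values {j : ℕ} (hj : 1 ≤ j) (hj' : j ≤ 11) :
    ∃ F₄ F₅ LK LE L₁ L₂ : ℂ,
      (HD4 (j / 12)).HasValue (-1) F₄ ∧
      (HD5 (j / 12)).HasValue (-1) F₅ ∧
      HasLValueOne (formK (j / 12)) LK ∧
      HasRegularizedLValueOne (formE (j / 12)) LE ∧
      HasLValueOne (K2 (1 - j / 24) (1 + j / 24)) L₁ ∧
      HasLValueOne (K2 ((12 - j) / 24) ((12 + j) / 24)) L₂ ∧
      (((2 : ℝ) ^ ((j : ℝ) / 2 - 4) * Omega j : ℝ) : ℂ) * F₄ = LK * L₁ ∧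
      (((2 : ℝ) ^ ((j : ℝ) / 2 + 1) * Omega j : ℝ) : ℂ) * F₅ = -(LE * L₂) ∧
      LK * LE = ((-(3 * (2 : ℝ) ^ ((j : ℝ) / 2 + 3) /
        (j * Real.sin (Real.pi * j / 12)) * Real.pi) : ℝ) : ℂ) := by
  have hq1 : (1 : ℚ) ≤ j := by exact_mod_cast hj
  have hq2 : (j : ℚ) ≤ 11 := by exact_mod_cast hj'
  have hr1 : (1 : ℝ) ≤ j := by exact_mod_cast hj
  have hr2 : (j : ℝ) ≤ 11 := by exact_mod_cast hj'
  have v4 := hasValue_HD4 (r := j / 12) (by linarith) (by linarith)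
  have v5 := hasValue_HD5 (r := j / 12) (by linarith) (by linarith)
  have hcast : (((j / 12 : ℚ)) : ℝ) = (j : ℝ) / 12 := by push_cast; rfl
  rw [hcast] at v4 v5
  have hBB := beta_mul_beta (r := (j : ℝ) / 12) (by linarith) (by linarith)
  have hO := Omega_mul_whippleFactor hj
  -- Each of LK·L₁, LE·L₂ and LK·LE contains the same pair of Beta values: for c = (1+r)/2 one has 1
  -- - c = (1-r)/2, and for c = r/2 one has 1 - c = 1 - r/2. In the first two identities the ₃F₂ sum
  -- occurs on both sides.
  rw [mul_assoc, ← hO] at hBB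
  refine ⟨_, _, _, _, _, _, v4, v5, hasLValueOne_formK hj hj', hasRegularizedLValueOne_formE hj hj',
    hasLValueOne_K2_first hj hj', hasLValueOne_K2_second hj hj', ?_, ?_, ?_⟩
  · simp only [← Complex.ofReal_mul, Complex.ofReal_inj]
    rw [Real.rpow_sub (by norm_num), Real.rpow_sub (by norm_num), two_rpow_half, Real.rpow_one,
      show (2 : ℝ) ^ (4 : ℝ) = 16 by norm_num]
    generalize (∑' k, unitSummand ((j : ℝ) / 12) ((j : ℝ) / 12 / 2) k) = S
    linear_combination (-(4 ^ ((j : ℝ) / 12)) ^ 2 / 16 * S) * hBB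
  · simp only [← Complex.ofReal_mul, ← Complex.ofReal_neg, Complex.ofReal_inj]
    rw [Real.rpow_add (by norm_num), Real.rpow_sub (by norm_num), two_rpow_half, Real.rpow_one,
      show (1 - (1 + (j : ℝ) / 12) / 2) = (1 - (j : ℝ) / 12) / 2 by ring, Real.rpow_one]
    generalize (∑' k, unitSummand ((j : ℝ) / 12) ((1 + (j : ℝ) / 12) / 2) k) = S
    linear_combination (-2 * (4 ^ ((j : ℝ) / 12)) ^ 2 * S) * hBB
  · simp only [← Complex.ofReal_mul, Complex.ofReal_inj]
    rw [hO, Gamma_one_add_div (by linarith)] at hBB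
    rw [Real.rpow_add (by norm_num), Real.rpow_sub (by norm_num), two_rpow_half, Real.rpow_one,
      show (2 : ℝ) ^ (3 : ℝ) = 8 by norm_num]
    have e : 1 / ((j : ℝ) / 12) = 12 / j := by field_simp
    rw [e] at hBB
    rw [show Real.pi * (j : ℝ) / 12 = Real.pi * (j / 12) by ring]
    have e2 : 3 * ((4 ^ ((j : ℝ) / 12)) ^ 3 * 8) / (j * Real.sin (Real.pi * (j / 12))) * Real.pi =
        2 * (4 ^ ((j : ℝ) / 12)) ^ 2 *
          (4 ^ ((j : ℝ) / 12) * (Real.pi / Real.sin (Real.pi * (j / 12)) * (12 / j))) := by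
      ring
    rw [e2, ← hBB]
    ring

end HypMod

namespace HypMod

open Filter ModularForm
open Complex hiding eta
open UpperHalfPlane hiding I

/-! ### Transformation behaviour of the eta quotients -/

theorem slash_two_apply {f : ℍ → ℂ} {F : ℂ → ℂ} (hf : ∀ τ : ℍ, f τ = F τ) (γ : SL(2, ℤ))
    (τ : ℍ) : (f ∣[(2 : ℤ)] γ) τ =
      F ((γ 0 0 * τ + γ 0 1) / (γ 1 0 * τ + γ 1 1)) * ((γ 1 0 * τ + γ 1 1 : ℂ) ^ 2)⁻¹ := by
  rw [SL_slash_apply, hf, UpperHalfPlane.coe_specialLinearGroup_apply, ModularGroup.denom_apply, zpow_neg]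
  simp

/-- The companion `η(2τ)^a η(τ)^(4-a)` of `etaQuot` at the cusp `0`. -/
noncomputable def etaQuotDual (a : ℤ) (τ : ℍ) : ℂ := eta (2 * (τ : ℂ)) ^ a * eta (τ : ℂ) ^ (4 - a)

theorem etaQuot_apply (a : ℤ) (τ : ℍ) :
    etaQuot a τ = (fun z : ℂ => eta (z / 2) ^ a * eta z ^ (4 - a)) τ := rfl

theorem etaQuotDual_apply (a : ℤ) (τ : ℍ) :
    etaQuotDual a τ = (fun z : ℂ => eta (2 * z) ^ a * eta z ^ (4 - a)) τ := rfl

theorem etaQuot_slash_T_sq (a : ℤ) :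
    etaQuot a ∣[(2 : ℤ)] (ModularGroup.T * ModularGroup.T) = zeta24 ^ (8 - a) • etaQuot a := by
  ext τ
  rw [slash_two_apply (F := fun z => eta (z / 2) ^ a * eta z ^ (4 - a)) (etaQuot_apply a), Pi.smul_apply,
    etaQuot_apply]
  simp [ModularGroup.coe_T, Matrix.mul_apply, Fin.sum_univ_two]
  rw [show ((τ : ℂ) + 2) / 2 = τ / 2 + 1 by ring, show (τ : ℂ) + 2 = τ + 1 + 1 by ring, eta_add_one, eta_add_one,
    eta_add_one, mul_zpow, mul_zpow, mul_zpow, show (8 - a) = a + (4 - a) + (4 - a) by ring,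
    zpow_add₀ zeta24_ne_zero, zpow_add₀ zeta24_ne_zero]
  ring

theorem etaQuotDual_slash_T (a : ℤ) :
    etaQuotDual a ∣[(2 : ℤ)] ModularGroup.T = zeta24 ^ (a + 4) • etaQuotDual a := by
  ext τ
  rw [slash_two_apply (F := fun z => eta (2 * z) ^ a * eta z ^ (4 - a)) (etaQuotDual_apply a), Pi.smul_apply,
    etaQuotDual_apply]
  simp [ModularGroup.coe_T]
  rw [show 2 * ((τ : ℂ) + 1) = 2 * τ + 1 + 1 by ring, eta_add_one, eta_add_one,
    eta_add_one, mul_zpow, mul_zpow, mul_zpow, show (a + 4) = a + a + (4 - a) by ring,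
    zpow_add₀ zeta24_ne_zero, zpow_add₀ zeta24_ne_zero]
  ring

theorem eta_neg_one_div {z : ℂ} (hz : 0 < z.im) :
    eta (-1 / z) = (sqrt I)⁻¹ * (sqrt z * eta z) := eta_comp_eq_csqrt_I_inv hz

theorem sqrt_pow_four {w : ℂ} (hw : w ≠ 0) : sqrt w ^ 4 = w ^ 2 := by
  rw [sqrt_eq_exp hw, ← exp_nat_mul, show ((4 : ℕ) : ℂ) * (log w / 2) = (2 : ℕ) * log w by
    push_cast; ring, exp_nat_mul, exp_log hw]

theorem sqrt_ne_zero' {w : ℂ} (hw : w ≠ 0) : sqrt w ≠ 0 := by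
  rw [sqrt_eq_exp hw]; exact exp_ne_zero _

/-- The principal square root is multiplicative here because 2 is a positive real. -/
theorem sqrt_two_mul {z : ℂ} (hz : z ≠ 0) : sqrt (2 * z) = sqrt 2 * sqrt z := by
  rw [sqrt_eq_exp (by simpa using hz), sqrt_eq_exp two_ne_zero, sqrt_eq_exp hz, ← exp_add]
  congr 1
  have := log_ofReal_mul (r := 2) (by norm_num) hz
  push_cast at this
  rw [this, show Complex.log 2 = ((Real.log 2 : ℝ) : ℂ) by rw [ofReal_log (by norm_num)]; norm_num]
  ring

/-- The exponents a and 4 - a add up to 4, so the branches of √z and √i combine into integral powers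
for every a; only √2^a, from η(-1/(2z)), survives. -/
theorem etaQuot_slash_S (a : ℤ) :
    etaQuot a ∣[(2 : ℤ)] ModularGroup.S = (-sqrt 2 ^ a) • etaQuotDual a := by
  ext τ
  have hz : 0 < (τ : ℂ).im := τ.im_pos
  have h0 := ne_zero_of_im_pos hz
  have h1 := sqrt_ne_zero' h0
  have h2 := sqrt_ne_zero' I_ne_zero
  have h3 := sqrt_pow_four h0
  have h4 := sqrt_pow_four I_ne_zero
  rw [I_sq] at h4
  rw [slash_two_apply (F := fun z => eta (z / 2) ^ a * eta z ^ (4 - a)) (etaQuot_apply a)]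
  simp only [ModularGroup.coe_S, Pi.smul_apply, etaQuotDual, smul_eq_mul]
  norm_num
  rw [show -1 / (τ : ℂ) / 2 = -1 / (2 * τ) by field_simp, eta_neg_one_div (im_two_mul_pos hz),
    eta_neg_one_div hz, sqrt_two_mul h0]
  simp only [mul_zpow, inv_zpow]
  generalize eta (2 * (τ : ℂ)) ^ a = x
  generalize eta (τ : ℂ) ^ (4 - a) = y
  generalize sqrt 2 ^ a = w
  rw [zpow_sub₀ h2, zpow_sub₀ h1, ← h3,
    show sqrt I ^ (4 : ℤ) = -1 by rw [← h4]; norm_cast,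
    show sqrt (τ : ℂ) ^ (4 : ℤ) = sqrt (τ : ℂ) ^ (4 : ℕ) by norm_cast]
  have h5 := zpow_ne_zero a h1
  have h6 := zpow_ne_zero a h2
  field_simp

/-- The lower triangular unipotent matrix `V = (1 0; 1 1)`. -/
def lowerUnipotent : SL(2, ℤ) := ⟨!![1, 0; 1, 1], by simp [Matrix.det_fin_two]⟩

theorem coe_lowerUnipotent : (lowerUnipotent : Matrix (Fin 2) (Fin 2) ℤ) = !![1, 0; 1, 1] := rfl

theorem lowerUnipotent_mul :
    lowerUnipotent * ModularGroup.S * ModularGroup.T = ModularGroup.S := by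
  apply Subtype.ext
  rw [Matrix.SpecialLinearGroup.coe_mul, Matrix.SpecialLinearGroup.coe_mul, coe_lowerUnipotent,
    ModularGroup.coe_S, ModularGroup.coe_T]
  simp

/-- From V S T = S, the action of V is conjugate through S to that of T⁻¹ on the dual quotient,
which is a scalar. -/
theorem etaQuot_slash_lowerUnipotent (a : ℤ) :
    etaQuot a ∣[(2 : ℤ)] lowerUnipotent = zeta24 ^ (-(a + 4)) • etaQuot a := by
  have h : ((etaQuot a ∣[(2 : ℤ)] lowerUnipotent) ∣[(2 : ℤ)] ModularGroup.S) ∣[(2 : ℤ)] ModularGroup.T =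
      (zeta24 ^ (-(a + 4)) • (etaQuot a ∣[(2 : ℤ)] ModularGroup.S)) ∣[(2 : ℤ)] ModularGroup.T := by
    rw [← SlashAction.slash_mul, ← SlashAction.slash_mul, ← mul_assoc, lowerUnipotent_mul, etaQuot_slash_S,
      SL_smul_slash, SL_smul_slash, etaQuotDual_slash_T, smul_comm (zeta24 ^ (-(a + 4))) _, smul_smul,
      smul_smul, mul_assoc, ← zpow_add₀ zeta24_ne_zero, neg_add_cancel, zpow_zero, mul_one]
  have h2 := congrArg (fun f : ℍ → ℂ => (f ∣[(2 : ℤ)] ModularGroup.T⁻¹) ∣[(2 : ℤ)] ModularGroup.S⁻¹) h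
  simp only [← SlashAction.slash_mul, mul_inv_cancel_right, mul_inv_cancel, SlashAction.slash_one,
    SL_smul_slash] at h2
  exact h2

end HypMod

namespace HypMod

open Filter ModularForm
open UpperHalfPlane hiding I

/-! ### The character of the eta quotients on `Γ⁰(2)` -/

/-- The part of the exponent that multiplies `a`. -/
def etaPhi {R : Type*} [CommRing R] (p b c d : R) : R :=
  (p + (2 * d + 1)) * c - 2 * b * (2 * d + 1) * c ^ 2 - b * (2 * d + 1) -
    3 * c * (2 * d + 1) + 6 * d * (d + 1)

/-- The part of the exponent that multiplies `4`. -/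
def etaPsi {R : Type*} [CommRing R] (p b c d : R) : R :=
  (p + (2 * d + 1)) * c - 2 * b * (2 * d + 1) * (c ^ 2 - 1) + 6 * d - 3 * c * (2 * d + 1)

/-- The exponent of the multiplier of `etaQuot a` at the matrix `(p 2b; c 2d+1)`. -/
def etaExponent (a p b c d : ℤ) : ℤ := a * etaPhi p b c d + 4 * etaPsi p b c d

theorem dvd_of_zmod {m : ℕ} {x : ℤ} (h : (x : ZMod m) = 0) : (m : ℤ) ∣ x :=
  (ZMod.intCast_zmod_eq_zero_iff_dvd x m).1 h

theorem intCast_etaPhi (m : ℕ) (p b c d : ℤ) :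
    ((etaPhi p b c d : ℤ) : ZMod m) = etaPhi (p : ZMod m) b c d := by
  simp [etaPhi]

theorem intCast_etaPsi (m : ℕ) (p b c d : ℤ) :
    ((etaPsi p b c d : ℤ) : ZMod m) = etaPsi (p : ZMod m) b c d := by
  simp [etaPsi]

/-- The two parts are the changes of the exponent under left multiplication by T² and by V. `etaPhi`
is needed modulo 24, hence modulo 3 and 8; `etaPsi` is multiplied by 4 and is needed only modulo 6.
-/
theorem etaPhi_zmod_three : ∀ p b c d : ZMod 3, p * (2 * d + 1) - 2 * b * c = 1 →
    etaPhi (p + 2 * c) (b + (2 * d + 1)) c d - etaPhi p b c d + 1 = 0 ∧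
    etaPhi p b (c + p) (d + b) - etaPhi p b c d + 1 = 0 := by
  unfold etaPhi; decide

theorem etaPhi_zmod_eight (p b c d : ZMod 8) (h : p * (2 * d + 1) - 2 * b * c = 1) :
    etaPhi (p + 2 * c) (b + (2 * d + 1)) c d - etaPhi p b c d + 1 = 0 ∧
    etaPhi p b (c + p) (d + b) - etaPhi p b c d + 1 = 0 := by
  -- Odd squares are 1 modulo 8, so the determinant condition solves for p and leaves three free
  -- variables for the finite check.
  have hd : ∀ d : ZMod 8, (2 * d + 1) ^ 2 = 1 := by decide
  obtain rfl : p = (2 * d + 1) * (1 + 2 * b * c) := by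
    linear_combination (2 * d + 1) * h - p * hd d
  clear h hd
  revert b c d
  unfold etaPhi
  decide +kernel

theorem etaPsi_zmod_three : ∀ p b c d : ZMod 3, p * (2 * d + 1) - 2 * b * c = 1 →
    etaPsi (p + 2 * c) (b + (2 * d + 1)) c d - etaPsi p b c d - 2 = 0 ∧
    etaPsi p b (c + p) (d + b) - etaPsi p b c d + 1 = 0 := by
  unfold etaPsi; decide

theorem etaPsi_zmod_two : ∀ p b c d : ZMod 2, p * (2 * d + 1) - 2 * b * c = 1 →
    etaPsi (p + 2 * c) (b + (2 * d + 1)) c d - etaPsi p b c d - 2 = 0 ∧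
    etaPsi p b (c + p) (d + b) - etaPsi p b c d + 1 = 0 := by
  unfold etaPsi; decide

theorem etaExponent_eq (a p b c d : ℤ) :
    etaExponent a p b c d = a * etaPhi p b c d + 4 * etaPsi p b c d := rfl

theorem zmod_det {p b c d : ℤ} (h : p * (2 * d + 1) - 2 * b * c = 1) (m : ℕ) :
    (p : ZMod m) * (2 * d + 1) - 2 * b * c = 1 := by
  exact_mod_cast congrArg (Int.cast : ℤ → ZMod m) h

theorem etaExponent_T_sq {p b c d : ℤ} (h : p * (2 * d + 1) - 2 * b * c = 1) (a : ℤ) :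
    24 ∣ etaExponent a (p + 2 * c) (b + (2 * d + 1)) c d - etaExponent a p b c d - (8 - a) := by
  have h3 : ((3 : ℕ) : ℤ) ∣ etaPhi (p + 2 * c) (b + (2 * d + 1)) c d - etaPhi p b c d + 1 :=
    dvd_of_zmod (by
      push_cast [intCast_etaPhi]; exact (etaPhi_zmod_three _ _ _ _ (zmod_det h 3)).1)
  have h8 : ((8 : ℕ) : ℤ) ∣ etaPhi (p + 2 * c) (b + (2 * d + 1)) c d - etaPhi p b c d + 1 :=
    dvd_of_zmod (by
      push_cast [intCast_etaPhi]; exact (etaPhi_zmod_eight _ _ _ _ (zmod_det h 8)).1)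
  have k3 : ((3 : ℕ) : ℤ) ∣ etaPsi (p + 2 * c) (b + (2 * d + 1)) c d - etaPsi p b c d - 2 :=
    dvd_of_zmod (by
      push_cast [intCast_etaPsi]; exact (etaPsi_zmod_three _ _ _ _ (zmod_det h 3)).1)
  have k2 : ((2 : ℕ) : ℤ) ∣ etaPsi (p + 2 * c) (b + (2 * d + 1)) c d - etaPsi p b c d - 2 :=
    dvd_of_zmod (by
      push_cast [intCast_etaPsi]; exact (etaPsi_zmod_two _ _ _ _ (zmod_det h 2)).1)
  rw [etaExponent_eq, etaExponent_eq]
  obtain ⟨u, hu⟩ : (24 : ℤ) ∣ etaPhi (p + 2 * c) (b + (2 * d + 1)) c d - etaPhi p b c d + 1 := by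
    omega
  obtain ⟨v, hv⟩ : (6 : ℤ) ∣ etaPsi (p + 2 * c) (b + (2 * d + 1)) c d - etaPsi p b c d - 2 := by
    omega
  exact ⟨a * u + v, by linear_combination a * hu + 4 * hv⟩

theorem etaExponent_lowerUnipotent {p b c d : ℤ} (h : p * (2 * d + 1) - 2 * b * c = 1) (a : ℤ) :
    24 ∣ etaExponent a p b (c + p) (d + b) - etaExponent a p b c d - -(a + 4) := by
  have h3 : ((3 : ℕ) : ℤ) ∣ etaPhi p b (c + p) (d + b) - etaPhi p b c d + 1 :=
    dvd_of_zmod (by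
      push_cast [intCast_etaPhi]; exact (etaPhi_zmod_three _ _ _ _ (zmod_det h 3)).2)
  have h8 : ((8 : ℕ) : ℤ) ∣ etaPhi p b (c + p) (d + b) - etaPhi p b c d + 1 :=
    dvd_of_zmod (by
      push_cast [intCast_etaPhi]; exact (etaPhi_zmod_eight _ _ _ _ (zmod_det h 8)).2)
  have k3 : ((3 : ℕ) : ℤ) ∣ etaPsi p b (c + p) (d + b) - etaPsi p b c d + 1 :=
    dvd_of_zmod (by
      push_cast [intCast_etaPsi]; exact (etaPsi_zmod_three _ _ _ _ (zmod_det h 3)).2)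
  have k2 : ((2 : ℕ) : ℤ) ∣ etaPsi p b (c + p) (d + b) - etaPsi p b c d + 1 :=
    dvd_of_zmod (by
      push_cast [intCast_etaPsi]; exact (etaPsi_zmod_two _ _ _ _ (zmod_det h 2)).2)
  rw [etaExponent_eq, etaExponent_eq]
  obtain ⟨u, hu⟩ : (24 : ℤ) ∣ etaPhi p b (c + p) (d + b) - etaPhi p b c d + 1 := by omega
  obtain ⟨v, hv⟩ : (6 : ℤ) ∣ etaPsi p b (c + p) (d + b) - etaPsi p b c d + 1 := by omega
  exact ⟨a * u + v, by linear_combination a * hu + 4 * hv⟩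

theorem zeta24_zpow_congr {m n : ℤ} (h : 24 ∣ m - n) : zeta24 ^ m = zeta24 ^ n := by
  obtain ⟨k, hk⟩ := h
  rw [show m = n + (24 : ℕ) * k by push_cast; linarith, zpow_add₀ zeta24_ne_zero, zpow_mul,
    zpow_natCast, zeta24_pow_twentyfour, one_zpow, mul_one]

/-- `γ` acts on `etaQuot a` through `etaExponent` if it belongs to `Γ⁰(2)`. -/
def HasMultiplier (a : ℤ) (γ : SL(2, ℤ)) : Prop :=
  ∀ b d : ℤ, γ 0 1 = 2 * b → γ 1 1 = 2 * d + 1 →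
    etaQuot a ∣[(2 : ℤ)] γ = zeta24 ^ etaExponent a (γ 0 0) b (γ 1 0) d • etaQuot a

theorem det_entries (γ : SL(2, ℤ)) : γ 0 0 * γ 1 1 - γ 0 1 * γ 1 0 = 1 := by
  have := γ.det_coe
  rwa [Matrix.det_fin_two] at this

theorem T_sq_mul_entries (γ : SL(2, ℤ)) :
    (ModularGroup.T * ModularGroup.T * γ) 0 0 = γ 0 0 + 2 * γ 1 0 ∧
    (ModularGroup.T * ModularGroup.T * γ) 0 1 = γ 0 1 + 2 * γ 1 1 ∧
    (ModularGroup.T * ModularGroup.T * γ) 1 0 = γ 1 0 ∧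
    (ModularGroup.T * ModularGroup.T * γ) 1 1 = γ 1 1 := by
  simp only [Matrix.SpecialLinearGroup.coe_mul, ModularGroup.coe_T, Matrix.mul_apply,
    Fin.sum_univ_two]
  norm_num

theorem lowerUnipotent_mul_entries (γ : SL(2, ℤ)) :
    (lowerUnipotent * γ) 0 0 = γ 0 0 ∧ (lowerUnipotent * γ) 0 1 = γ 0 1 ∧
    (lowerUnipotent * γ) 1 0 = γ 1 0 + γ 0 0 ∧ (lowerUnipotent * γ) 1 1 = γ 1 1 + γ 0 1 := by
  simp only [Matrix.SpecialLinearGroup.coe_mul, coe_lowerUnipotent, Matrix.mul_apply,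
    Fin.sum_univ_two]
  norm_num
  constructor <;> ring

/-- Stated as an equivalence so that the descent may multiply by T² or by its inverse. -/
theorem hasMultiplier_T_sq_mul (a : ℤ) (γ : SL(2, ℤ)) :
    HasMultiplier a (ModularGroup.T * ModularGroup.T * γ) ↔ HasMultiplier a γ := by
  obtain ⟨e1, e2, e3, e4⟩ := T_sq_mul_entries γ
  have hdet := det_entries γ
  have key : ∀ b d : ℤ, γ 0 1 = 2 * b → γ 1 1 = 2 * d + 1 →
      zeta24 ^ etaExponent a (γ 0 0 + 2 * γ 1 0) (b + (2 * d + 1)) (γ 1 0) d =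
        zeta24 ^ (8 - a) * zeta24 ^ etaExponent a (γ 0 0) b (γ 1 0) d := by
    intro b d hb hd
    rw [← zpow_add₀ zeta24_ne_zero]
    apply zeta24_zpow_congr
    have := etaExponent_T_sq (p := γ 0 0) (b := b) (c := γ 1 0) (d := d)
      (by rw [← hb, ← hd]; exact hdet) a
    convert this using 1
    ring
  simp only [HasMultiplier, e1, e2, e3, e4]
  constructor
  · intro h b d hb hd
    have := h (b + (2 * d + 1)) d (by rw [hb, hd]; ring) hd
    rw [SlashAction.slash_mul, etaQuot_slash_T_sq, SL_smul_slash, key b d hb hd, mul_smul] at this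
    exact smul_right_injective _ (zpow_ne_zero _ zeta24_ne_zero) this
  · intro h b d hb hd
    have hb' : γ 0 1 = 2 * (b - (2 * d + 1)) := by rw [hd] at hb; linarith
    have hk := key _ d hb' hd
    rw [sub_add_cancel] at hk
    rw [SlashAction.slash_mul, etaQuot_slash_T_sq, SL_smul_slash, hk, mul_smul, h _ d hb' hd]

theorem hasMultiplier_lowerUnipotent_mul (a : ℤ) (γ : SL(2, ℤ)) :
    HasMultiplier a (lowerUnipotent * γ) ↔ HasMultiplier a γ := by
  obtain ⟨e1, e2, e3, e4⟩ := lowerUnipotent_mul_entries γ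
  have hdet := det_entries γ
  have key : ∀ b d : ℤ, γ 0 1 = 2 * b → γ 1 1 = 2 * d + 1 →
      zeta24 ^ etaExponent a (γ 0 0) b (γ 1 0 + γ 0 0) (d + b) =
        zeta24 ^ (-(a + 4)) * zeta24 ^ etaExponent a (γ 0 0) b (γ 1 0) d := by
    intro b d hb hd
    rw [← zpow_add₀ zeta24_ne_zero]
    apply zeta24_zpow_congr
    have := etaExponent_lowerUnipotent (p := γ 0 0) (b := b) (c := γ 1 0) (d := d)
      (by rw [← hb, ← hd]; exact hdet) a
    convert this using 1
    ring
  simp only [HasMultiplier, e1, e2, e3, e4]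
  constructor
  · intro h b d hb hd
    have := h b (d + b) hb (by rw [hb, hd]; ring)
    rw [SlashAction.slash_mul, etaQuot_slash_lowerUnipotent, SL_smul_slash, key b d hb hd,
      mul_smul] at this
    exact smul_right_injective _ (zpow_ne_zero _ zeta24_ne_zero) this
  · intro h b d hb hd
    have hd' : γ 1 1 = 2 * (d - b) + 1 := by rw [hb] at hd; linarith
    have hk := key b _ hb hd'
    rw [sub_add_cancel] at hk
    rw [SlashAction.slash_mul, etaQuot_slash_lowerUnipotent, SL_smul_slash, hk, mul_smul,
      h b _ hb hd']

theorem hasMultiplier_of_lower (a : ℤ) (n : ℕ) : ∀ γ : SL(2, ℤ), γ 0 1 = 0 → (γ 1 0).natAbs = n →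
    HasMultiplier a γ := by
  induction n using Nat.strong_induction_on with
  | _ n ih =>
    intro γ hb hc
    have hdet := det_entries γ
    rw [hb, zero_mul, sub_zero] at hdet
    rcases n.eq_zero_or_pos with rfl | hn
    · have hc0 : γ 1 0 = 0 := Int.natAbs_eq_zero.1 hc
      intro b d hb' hd'
      have hb0 : b = 0 := by omega
      subst hb0
      rw [hc0]
      rcases Int.eq_one_or_neg_one_of_mul_eq_one' hdet with ⟨h1, h2⟩ | ⟨h1, h2⟩
      · have hd0 : d = 0 := by omega
        have : γ = 1 := by
          ext i j
          fin_cases i <;> fin_cases j <;> simp [hb, hc0, h1, h2]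
        rw [this, hd0, SlashAction.slash_one]
        simp [etaExponent, etaPhi, etaPsi]
      · have hd0 : d = -1 := by omega
        have : γ = -1 := by
          ext i j
          fin_cases i <;> fin_cases j <;> simp [hb, hc0, h1, h2]
        -- At -1, where d = -1, `etaPhi` is 0 and `etaPsi` is -6, so the exponent is -24; this
        -- agrees with the trivial action of -1 in even weight.
        have e : zeta24 ^ etaExponent a (γ 0 0) 0 0 d = 1 := by
          rw [← zpow_zero zeta24]
          apply zeta24_zpow_congr
          rw [hd0]
          simp [etaExponent, etaPhi, etaPsi]
        rw [e, one_smul, this]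
        ext τ
        rw [slash_two_apply (F := fun z => eta (z / 2) ^ a * eta z ^ (4 - a)) (etaQuot_apply a),
          etaQuot_apply]
        simp
    · rcases Int.eq_one_or_neg_one_of_mul_eq_one' hdet with ⟨h1, h2⟩ | ⟨h1, h2⟩ <;>
      rcases le_or_gt 0 (γ 1 0) with hs | hs
      -- The upper left entry is ±1, so V or V⁻¹, according to signs, brings the lower left entry
      -- one step closer to zero.
      all_goals
        first
        | (obtain ⟨e1, e2, e3, e4⟩ := lowerUnipotent_mul_entries γ
           rw [← hasMultiplier_lowerUnipotent_mul]
           refine ih _ ?_ _ (by rw [e2, hb]) rfl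
           rw [e3, h1]; omega)
        | (obtain ⟨e1, e2, e3, e4⟩ := lowerUnipotent_mul_entries (lowerUnipotent⁻¹ * γ)
           rw [mul_inv_cancel_left] at e1 e2 e3 e4
           rw [← mul_inv_cancel_left lowerUnipotent γ, hasMultiplier_lowerUnipotent_mul]
           refine ih _ ?_ _ (by rw [← e2, hb]) rfl
           rw [← e1, h1] at e3; omega)

/-- The descent on the second column proving the multiplier formula on `Γ⁰(2)`. -/
theorem hasMultiplier_of_column (a : ℤ) (n : ℕ) : ∀ γ : SL(2, ℤ),
    (γ 0 1).natAbs + (γ 1 1).natAbs = n → HasMultiplier a γ := by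
  induction n using Nat.strong_induction_on with
  | _ n ih =>
    intro γ hn
    by_cases hpar : Even (γ 0 1) ∧ Odd (γ 1 1)
    swap
    · intro b d hb hd
      exact absurd ⟨⟨b, by omega⟩, ⟨d, hd⟩⟩ hpar
    obtain ⟨⟨b, hb⟩, ⟨d, hd⟩⟩ := hpar
    rcases eq_or_ne (γ 0 1) 0 with h0 | h0
    · exact hasMultiplier_of_lower a _ γ h0 rfl
    have T1 : (ModularGroup.T * ModularGroup.T * γ) 0 1 = _ ∧ _ :=
      (T_sq_mul_entries γ).2
    obtain ⟨t1, -, t3⟩ := T1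
    obtain ⟨-, v1, -, v3⟩ := lowerUnipotent_mul_entries γ
    obtain ⟨-, t1', -, t3'⟩ := T_sq_mul_entries ((ModularGroup.T * ModularGroup.T)⁻¹ * γ)
    obtain ⟨-, v1', -, v3'⟩ := lowerUnipotent_mul_entries (lowerUnipotent⁻¹ * γ)
    rw [mul_inv_cancel_left] at t1' t3' v1' v3'
    -- One entry of the column is even and the other odd, so the absolute values differ. If the
    -- lower is larger, V^{±1} shrinks it; if the upper is larger, T^{±2} shrinks it. The relative
    -- sign selects the exponent.
    rcases lt_or_gt_of_ne (show (γ 0 1).natAbs ≠ (γ 1 1).natAbs by omega) with hlt | hlt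
    · by_cases hs : 0 < γ 0 1 ↔ 0 < γ 1 1
      · rw [← mul_inv_cancel_left lowerUnipotent γ, hasMultiplier_lowerUnipotent_mul]
        exact ih _ (by omega) _ rfl
      · rw [← hasMultiplier_lowerUnipotent_mul]
        exact ih _ (by omega) _ rfl
    · by_cases hs : 0 < γ 0 1 ↔ 0 < γ 1 1
      · rw [← mul_inv_cancel_left (ModularGroup.T * ModularGroup.T) γ, hasMultiplier_T_sq_mul]
        exact ih _ (by omega) _ rfl
      · rw [← hasMultiplier_T_sq_mul]
        exact ih _ (by omega) _ rfl

theorem etaQuot_slash_of_even (a : ℤ) {γ : SL(2, ℤ)} {b d : ℤ} (hb : γ 0 1 = 2 * b)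
    (hd : γ 1 1 = 2 * d + 1) :
    etaQuot a ∣[(2 : ℤ)] γ = zeta24 ^ etaExponent a (γ 0 0) b (γ 1 0) d • etaQuot a :=
  hasMultiplier_of_column a _ γ rfl b d hb hd

/-- Level 48 makes b, c and d multiples of 24, and every term of the exponent contains one of them.
-/
theorem etaQuot_slash_of_mem_Gamma (a : ℤ) {γ : SL(2, ℤ)} (hγ : γ ∈ CongruenceSubgroup.Gamma 48) :
    etaQuot a ∣[(2 : ℤ)] γ = etaQuot a := by
  obtain ⟨-, h2, h3, h4⟩ := CongruenceSubgroup.Gamma_mem.1 hγ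
  rw [ZMod.intCast_zmod_eq_zero_iff_dvd] at h2 h3
  have h4' : (48 : ℤ) ∣ γ 1 1 - 1 := (ZMod.intCast_zmod_eq_zero_iff_dvd _ 48).1 (by
    push_cast; rw [h4, sub_self])
  obtain ⟨b, hb⟩ := h2
  obtain ⟨c, hc⟩ := h3
  obtain ⟨d, hd⟩ := h4'
  rw [etaQuot_slash_of_even a (b := 24 * b) (d := 24 * d) (by rw [hb]; push_cast; ring)
    (by linarith), zeta24_zpow_congr (n := 0), zpow_zero, one_smul]
  rw [hc, sub_zero]
  push_cast
  generalize γ 0 0 = p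
  refine ⟨a * ((p + (48 * d + 1)) * 2 * c - 2 * b * (48 * d + 1) * (48 * c) ^ 2 -
    b * (48 * d + 1) - 6 * c * (48 * d + 1) + 6 * d * (24 * d + 1)) + 4 *
    ((p + (48 * d + 1)) * 2 * c - 2 * b * (48 * d + 1) * ((48 * c) ^ 2 - 1) + 6 * d -
      6 * c * (48 * d + 1)), ?_⟩
  unfold etaExponent etaPhi etaPsi
  ring

end HypMod

namespace HypMod

open Filter ModularForm Asymptotics
open Complex hiding eta
open UpperHalfPlane hiding I

/-! ### Growth of the eta quotients at the cusps -/

theorem tendsto_coe_imInf : Tendsto (fun τ : ℍ => (τ : ℂ)) atImInfty imInf := by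
  rw [imInf, tendsto_comap_iff]
  exact tendsto_comap

/-- The product part of `etaQuot a`. -/
noncomputable def etaQuotFactor (a : ℤ) (z : ℂ) : ℂ :=
  eulerProd (cexp (2 * Real.pi * I * (z / 2))) ^ a * eulerProd (cexp (2 * Real.pi * I * z)) ^ (4 - a)

theorem etaQuot_eq_exp_mul (a : ℤ) (τ : ℍ) :
    etaQuot a τ = cexp (2 * Real.pi * I * ((8 - a) / 48 : ℝ) * τ) * etaQuotFactor a τ := by
  rw [etaQuot, eta_eq, eta_eq, mul_zpow, mul_zpow, ← Complex.exp_int_mul, ← Complex.exp_int_mul,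
    etaQuotFactor, mul_mul_mul_comm, ← Complex.exp_add]
  congr 2
  push_cast; ring

theorem etaQuotDual_eq_exp_mul (a : ℤ) (τ : ℍ) :
    etaQuotDual a τ = cexp (2 * Real.pi * I * ((a + 4) / 24 : ℝ) * τ) *
      (eulerProd (cexp (2 * Real.pi * I * (2 * τ))) ^ a *
        eulerProd (cexp (2 * Real.pi * I * τ)) ^ (4 - a)) := by
  rw [etaQuotDual, eta_eq, eta_eq, mul_zpow, mul_zpow, ← Complex.exp_int_mul, ← Complex.exp_int_mul,
    mul_mul_mul_comm, ← Complex.exp_add]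
  congr 2
  push_cast; ring

theorem tendsto_etaQuotFactor (a : ℤ) :
    Tendsto (fun τ : ℍ => etaQuotFactor a τ) atImInfty (𝓝 1) := by
  have h1 := (tendsto_eulerProd_exp.comp (tendsto_div_two_imInf.comp tendsto_coe_imInf)).zpow₀ a
    (Or.inl one_ne_zero)
  have h2 := (tendsto_eulerProd_exp.comp tendsto_coe_imInf).zpow₀ (4 - a) (Or.inl one_ne_zero)
  simpa [etaQuotFactor] using h1.mul h2

theorem tendsto_etaQuotDualFactor (a : ℤ) :
    Tendsto (fun τ : ℍ => eulerProd (cexp (2 * Real.pi * I * (2 * τ))) ^ a *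
        eulerProd (cexp (2 * Real.pi * I * τ)) ^ (4 - a)) atImInfty (𝓝 1) := by
  have h1 := (tendsto_eulerProd_exp.comp (tendsto_two_mul_imInf.comp tendsto_coe_imInf)).zpow₀ a
    (Or.inl one_ne_zero)
  have h2 := (tendsto_eulerProd_exp.comp tendsto_coe_imInf).zpow₀ (4 - a) (Or.inl one_ne_zero)
  simpa using h1.mul h2

theorem norm_exp_two_pi_I_mul (κ : ℝ) (τ : ℍ) :
    ‖cexp (2 * Real.pi * I * κ * τ)‖ = Real.exp (-(2 * Real.pi * κ) * τ.im) := by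
  rw [Complex.norm_exp]
  congr 1
  simp [mul_assoc]

theorem isBigO_exp_mul {R : ℍ → ℂ} {l : ℂ} (hR : Tendsto R atImInfty (𝓝 l)) (κ : ℝ) :
    (fun τ : ℍ => cexp (2 * Real.pi * I * κ * τ) * R τ) =O[atImInfty]
      fun τ => Real.exp (-(2 * Real.pi * κ) * τ.im) := by
  have h1 : (fun τ : ℍ => cexp (2 * Real.pi * I * κ * τ)) =O[atImInfty]
      fun τ => Real.exp (-(2 * Real.pi * κ) * τ.im) := by
    refine IsBigO.of_norm_eventuallyLE (Eventually.of_forall fun τ => ?_)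
    exact (norm_exp_two_pi_I_mul κ τ).le
  simpa using h1.mul (hR.isBigO_one ℝ)

theorem isBigO_etaQuot (a : ℤ) : etaQuot a =O[atImInfty]
    fun τ => Real.exp (-(2 * Real.pi * ((8 - a) / 48)) * τ.im) := by
  rw [show etaQuot a = _ from funext (etaQuot_eq_exp_mul a)]
  exact isBigO_exp_mul (tendsto_etaQuotFactor a) _

theorem isBigO_etaQuotDual (a : ℤ) : etaQuotDual a =O[atImInfty]
    fun τ => Real.exp (-(2 * Real.pi * ((a + 4) / 24)) * τ.im) := by
  rw [show etaQuotDual a = _ from funext (etaQuotDual_eq_exp_mul a)]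
  exact isBigO_exp_mul (tendsto_etaQuotDualFactor a) _

theorem isBigO_etaQuot_slash_T (a : ℤ) : (etaQuot a ∣[(2 : ℤ)] ModularGroup.T) =O[atImInfty]
    fun τ => Real.exp (-(2 * Real.pi * ((8 - a) / 48)) * τ.im) := by
  have him : ∀ τ : ℍ, (ModularGroup.T • τ).im = τ.im := fun τ => by
    rw [modular_T_smul]; simp
  have ht : Tendsto (fun τ : ℍ => ModularGroup.T • τ) atImInfty atImInfty := by
    rw [atImInfty, tendsto_comap_iff]
    exact tendsto_comap.congr fun τ => (him τ).symm
  have h := (isBigO_etaQuot a).comp_tendsto ht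
  simp only [Function.comp_def, him] at h
  refine h.congr_left fun τ => ?_
  rw [SL_slash_apply, ModularGroup.denom_apply]
  simp [ModularGroup.coe_T]

/-- Every translate of `etaQuot a` is, up to a constant, `etaQuot a`, its translate by `T`, or
`etaQuotDual a`. -/
theorem etaQuot_slash_cases (a : ℤ) (γ : SL(2, ℤ)) : ∃ c : ℂ,
    etaQuot a ∣[(2 : ℤ)] γ = c • etaQuot a ∨
    etaQuot a ∣[(2 : ℤ)] γ = c • (etaQuot a ∣[(2 : ℤ)] ModularGroup.T) ∨
    etaQuot a ∣[(2 : ℤ)] γ = c • etaQuotDual a := by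
  have main : ∀ γ' : SL(2, ℤ), Even (γ' 0 1) → ∃ c : ℂ, etaQuot a ∣[(2 : ℤ)] γ' = c • etaQuot a := by
    rintro γ' ⟨b, hb⟩
    have hdet := det_entries γ'
    obtain ⟨d, hd⟩ : Odd (γ' 1 1) := by
      by_contra h
      rw [Int.not_odd_iff_even] at h
      have h2 : Even (γ' 0 0 * γ' 1 1 - γ' 0 1 * γ' 1 0) :=
        (h.mul_left _).sub ((show Even (γ' 0 1) from ⟨b, hb⟩).mul_right _)
      rw [hdet] at h2
      exact absurd h2 (by decide)
    exact ⟨_, etaQuot_slash_of_even a (b := b) (d := d) (by rw [hb]; ring) hd⟩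
  -- The cosets of Γ⁰(2) are represented by 1, S and T; the parities of the top row show which one
  -- contains γ.
  by_cases h1 : Even (γ 0 1)
  · obtain ⟨c, hc⟩ := main γ h1
    exact ⟨c, Or.inl hc⟩
  by_cases h0 : Even (γ 0 0)
  · obtain ⟨c, hc⟩ := main (γ * ModularGroup.S⁻¹) (by
      have : (γ * ModularGroup.S⁻¹) 0 1 = γ 0 0 := by
        rw [Matrix.SpecialLinearGroup.coe_mul, Matrix.SpecialLinearGroup.coe_inv, ModularGroup.coe_S]
        simp [Matrix.mul_apply, Fin.sum_univ_two, Matrix.adjugate_fin_two]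
      rwa [this])
    refine ⟨c * (-sqrt 2 ^ a), Or.inr (Or.inr ?_)⟩
    rw [← inv_mul_cancel_right γ ModularGroup.S, SlashAction.slash_mul, hc, SL_smul_slash,
      etaQuot_slash_S, smul_smul]
  · obtain ⟨c, hc⟩ := main (γ * ModularGroup.T⁻¹) (by
      have : (γ * ModularGroup.T⁻¹) 0 1 = γ 0 1 - γ 0 0 := by
        rw [Matrix.SpecialLinearGroup.coe_mul, Matrix.SpecialLinearGroup.coe_inv, ModularGroup.coe_T]
        simp [Matrix.mul_apply, Fin.sum_univ_two, Matrix.adjugate_fin_two]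
        ring
      rw [this]
      rw [Int.not_even_iff_odd] at h0 h1
      exact h1.sub_odd h0)
    refine ⟨c, Or.inr (Or.inl ?_)⟩
    rw [← inv_mul_cancel_right γ ModularGroup.T, SlashAction.slash_mul, hc, SL_smul_slash]

theorem isBigO_etaQuot_slash (a : ℤ) (γ : SL(2, ℤ)) :
    (etaQuot a ∣[(2 : ℤ)] γ) =O[atImInfty]
        (fun τ => Real.exp (-(2 * Real.pi * ((8 - a) / 48)) * τ.im)) ∨
      (etaQuot a ∣[(2 : ℤ)] γ) =O[atImInfty]
        (fun τ => Real.exp (-(2 * Real.pi * ((a + 4) / 24)) * τ.im)) := by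
  obtain ⟨c, h | h | h⟩ := etaQuot_slash_cases a γ
  · exact Or.inl (h ▸ (isBigO_etaQuot a).const_smul_left c)
  · exact Or.inl (h ▸ (isBigO_etaQuot_slash_T a).const_smul_left c)
  · exact Or.inr (h ▸ (isBigO_etaQuotDual a).const_smul_left c)

theorem exp_isBigO_one {k : ℝ} (hk : k ≤ 0) :
    (fun τ : ℍ => Real.exp (k * τ.im)) =O[atImInfty] (1 : ℍ → ℝ) := by
  refine IsBigO.of_bound 1 (Eventually.of_forall fun τ => ?_)
  have := τ.im_pos
  simp only [Real.norm_eq_abs, Real.abs_exp, Pi.one_apply, abs_one, mul_one]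
  exact Real.exp_le_one_iff.2 (mul_nonpos_of_nonpos_of_nonneg hk this.le)

/-- The bounds on a say exactly that the orders (8-a)/48 and (a+4)/24 are nonnegative. -/
theorem isBoundedAtImInfty_etaQuot_slash {a : ℤ} (h1 : -4 ≤ a) (h2 : a ≤ 8) (γ : SL(2, ℤ)) :
    IsBoundedAtImInfty (etaQuot a ∣[(2 : ℤ)] γ) := by
  have h1' : (-4 : ℝ) ≤ a := by exact_mod_cast h1
  have h2' : (a : ℝ) ≤ 8 := by exact_mod_cast h2
  have hpi := Real.pi_pos
  rcases isBigO_etaQuot_slash a γ with h | h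
  · exact h.trans (exp_isBigO_one (neg_nonpos.2 (mul_nonneg (by positivity) (by linarith))))
  · exact h.trans (exp_isBigO_one (neg_nonpos.2 (mul_nonneg (by positivity) (by linarith))))

/-- For a > 8 the leading exponential grows, and the remaining factor tends to 1, so it can be
divided out of a supposed bound. -/
theorem not_isBoundedAtImInfty_etaQuot {a : ℤ} (ha : 8 < a) :
    ¬ IsBoundedAtImInfty (etaQuot a) := by
  intro h
  have ha' : (8 : ℝ) < a := by exact_mod_cast ha
  have hR := ((tendsto_etaQuotFactor a).inv₀ one_ne_zero).isBigO_one ℝ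
  have h1 := IsBigO.mul h hR
  have h2 : (fun τ : ℍ => Real.exp (-(2 * Real.pi * ((8 - a) / 48)) * τ.im)) =O[atImInfty]
      fun _ => (1 : ℝ) := by
    refine IsBigO.trans ?_ (h1.trans (by simpa using isBigO_refl (fun _ : ℍ => (1 : ℝ)) _))
    refine IsBigO.of_bound 1 ?_
    have hne : ∀ᶠ τ : ℍ in atImInfty, etaQuotFactor a (τ : ℂ) ≠ 0 :=
      (tendsto_etaQuotFactor a).eventually_ne one_ne_zero
    filter_upwards [hne] with τ hτ
    rw [etaQuot_eq_exp_mul, mul_inv_cancel_right₀ hτ, norm_exp_two_pi_I_mul, Real.norm_eq_abs,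
      Real.abs_exp, one_mul]
  have h3 : Tendsto (fun τ : ℍ => Real.exp (-(2 * Real.pi * ((8 - a) / 48)) * τ.im)) atImInfty
      atTop := by
    refine Real.tendsto_exp_atTop.comp (Tendsto.const_mul_atTop ?_ tendsto_comap)
    rw [neg_pos]
    exact mul_neg_of_pos_of_neg (by have := Real.pi_pos; positivity) (by linarith)
  rw [isBigO_one_iff] at h2
  refine not_isBoundedUnder_of_tendsto_atTop h3 ?_
  simpa [Function.comp_def] using h2

theorem mdifferentiable_etaQuot (a : ℤ) : MDiff (etaQuot a) := by
  rw [UpperHalfPlane.mdifferentiable_iff]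
  have hd : ∀ z : ℂ, 0 < z.im →
      DifferentiableAt ℂ (fun z : ℂ => eta (z / 2) ^ a * eta z ^ (4 - a)) z := fun z hz => by
    have h1 : DifferentiableAt ℂ (fun z => eta (z / 2)) z :=
      (differentiableAt_eta (im_div_two_pos hz)).comp z (f := fun z : ℂ => z / 2) (by fun_prop)
    exact (h1.zpow (Or.inl (eta_ne_zero' (im_div_two_pos hz)))).mul
      ((differentiableAt_eta hz).zpow (Or.inl (eta_ne_zero' hz)))
  refine .congr (fun z hz ↦ (hd z hz).differentiableWithinAt) fun z hz ↦ ?_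
  simp [etaQuot, ofComplex_apply_of_im_pos hz]

/-! ### Modularity -/

theorem isCongruenceModularForm_etaQuot {a : ℤ} (h1 : -4 ≤ a) (h2 : a ≤ 8) :
    IsCongruenceModularForm 2 (etaQuot a) := by
  have hΓ : CongruenceSubgroup.IsCongruenceSubgroup (CongruenceSubgroup.Gamma 48) :=
    CongruenceSubgroup.Gamma_is_cong_sub 48
  have := hΓ.finiteIndex
  refine ⟨CongruenceSubgroup.Gamma 48, hΓ,
    { toFun := etaQuot a
      slash_action_eq' := ?_
      holo' := mdifferentiable_etaQuot a
      bdd_at_cusps' := ?_ }, rfl⟩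
  · rintro _ ⟨γ, hγ, rfl⟩
    exact etaQuot_slash_of_mem_Gamma a hγ
  · intro c hc
    rw [Subgroup.IsArithmetic.isCusp_iff_isCusp_SL2Z] at hc
    rw [OnePoint.isBoundedAt_iff_forall_SL2Z hc]
    intro γ _
    exact isBoundedAtImInfty_etaQuot_slash h1 h2 γ

theorem isWeaklyHolomorphicModularForm_etaQuot (a : ℤ) :
    IsWeaklyHolomorphicModularForm 2 (etaQuot a) := by
  refine ⟨mdifferentiable_etaQuot a, ⟨CongruenceSubgroup.Gamma 48,
    CongruenceSubgroup.Gamma_is_cong_sub 48, fun γ hγ => etaQuot_slash_of_mem_Gamma a hγ⟩,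
    fun γ => ?_⟩
  rcases isBigO_etaQuot_slash a γ with h | h
  · exact ⟨_, h⟩
  · exact ⟨_, h⟩

theorem not_isCongruenceModularForm_etaQuot {a : ℤ} (ha : 8 < a) :
    ¬ IsCongruenceModularForm 2 (etaQuot a) := by
  rintro ⟨Γ, hΓ, g, hg⟩
  have := hΓ.finiteIndex
  have h := ModularFormClass.bdd_at_infty g
  rw [hg] at h
  exact not_isBoundedAtImInfty_etaQuot ha h

end HypMod

theorem theorem1p1 (j : ℕ) (hj : 1 ≤ j) (hj' : j ≤ 11) :
    HypMod.IsCongruenceModularForm 2 (HypMod.formK (j / 12)) ∧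
    HypMod.IsWeaklyHolomorphicModularForm 2 (HypMod.formE (j / 12)) ∧
    ¬ HypMod.IsCongruenceModularForm 2 (HypMod.formE (j / 12)) ∧
    ∃ F₄ F₅ LK LE L₁ L₂ : ℂ,
      (HypMod.HD4 (j / 12)).HasValue (-1) F₄ ∧
      (HypMod.HD5 (j / 12)).HasValue (-1) F₅ ∧
      HypMod.HasLValueOne (HypMod.formK (j / 12)) LK ∧
      HypMod.HasRegularizedLValueOne (HypMod.formE (j / 12)) LE ∧
      HypMod.HasLValueOne (HypMod.K2 (1 - j / 24) (1 + j / 24)) L₁ ∧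
      HypMod.HasLValueOne (HypMod.K2 ((12 - j) / 24) ((12 + j) / 24)) L₂ ∧
      (((2 : ℝ) ^ ((j : ℝ) / 2 - 4) * HypMod.Omega j : ℝ) : ℂ) * F₄ = LK * L₁ ∧
      (((2 : ℝ) ^ ((j : ℝ) / 2 + 1) * HypMod.Omega j : ℝ) : ℂ) * F₅ = -(LE * L₂) ∧
      LK * LE = ((-(3 * (2 : ℝ) ^ ((j : ℝ) / 2 + 3) /
        (j * Real.sin (Real.pi * j / 12)) * Real.pi) : ℝ) : ℂ) := by
  refine ⟨?_, ?_, ?_, HypMod.exists_values hj hj'⟩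
  · rw [HypMod.formK_eq]
    exact HypMod.isCongruenceModularForm_etaQuot (by omega) (by omega)
  · rw [HypMod.formE_eq]
    exact HypMod.isWeaklyHolomorphicModularForm_etaQuot _
  · rw [HypMod.formE_eq]
    exact HypMod.not_isCongruenceModularForm_etaQuot (by omega)
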